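/- Work in the ring $\mathbb{Z}[[q]]$ of formal power series (infinite sums and products converge coefficientwise), and write $(a;q)_n=\prod_{k=0}^{n-1}(1-aq^k)$, $(a;q)_\infty=\prod_{k\ge 0}(1-aq^k)$ and $E_j=(q^j;q^j)_\infty$ for $j\ge 1$. Let $\phi$ be Ramanujan's Appell–Lerch sum and $a(n)$ its coefficients: $$\phi(q)=\sum_{n=0}^{\infty}\frac{(-q;q)_{2n}\,q^{n+1}}{(q;q^2)_{n+1}^2}=\sum_{n=1}^{\infty}a(n)q^n .$$ **Theorem.** The generating function of $a(10n+9)$ is $$\sum_{n=0}^{\infty}a(10n+9)q^n=5\left(46\,\frac{E_5E_{10}^2}{E_2^2}+460\,q\,\frac{E_{10}^5}{E_1^3E_2}+1125\,q^2\,\frac{E_{10}^8}{E_1^6E_5}+1875\,q\,\frac{E_2^8E_5^9}{E_1^{16}}+15625\,q^2\,\frac{E_2^8E_5^{15}}{E_1^{22}}\right).$$ In particular, $a(10n+9)\equiv 0\pmod 5$ for every integer $n\ge 0$. -/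

import Mathlib

open PowerSeries
open scoped PowerSeries.WithPiTopology

namespace AppellLerch

/-- The finite `q`-shifted factorial `(a; q)_n = ∏_{k < n} (1 - a q ^ k)`, for formal power series
`a` and `q` with integer coefficients. -/
noncomputable def qPoch (a q : ℤ⟦X⟧) (n : ℕ) : ℤ⟦X⟧ :=
  ∏ k ∈ Finset.range n, (1 - a * q ^ k)

/-- The infinite `q`-shifted factorial `(a; q)_∞ = ∏_{k ≥ 0} (1 - a q ^ k)`. The product is taken in
the topology of coefficientwise convergence on `ℤ⟦X⟧`. -/
noncomputable def qPochInf (a q : ℤ⟦X⟧) : ℤ⟦X⟧ :=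
  ∏' k : ℕ, (1 - a * q ^ k)

/-- The quotient `f / g` of formal power series; it is meaningful when `g` is a unit of `ℤ⟦X⟧`,
as all the denominators below are (`isUnit_E`, `isUnit_qPoch`). -/
noncomputable def quot (f g : ℤ⟦X⟧) : ℤ⟦X⟧ :=
  f * Ring.inverse g

/-- `E_j = (q^j; q^j)_∞`, with `q` the variable `X`. -/
noncomputable def E (j : ℕ) : ℤ⟦X⟧ :=
  qPochInf (X ^ j) (X ^ j)

/-- The `n`-th term `(-q; q)_{2n} q^{n+1} / (q; q^2)_{n+1}^2` of the series `φ(q)`. -/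
noncomputable def phiTerm (n : ℕ) : ℤ⟦X⟧ :=
  quot (qPoch (-X) X (2 * n) * X ^ (n + 1)) (qPoch X (X ^ 2) (n + 1) ^ 2)

/-- Ramanujan's Appell–Lerch sum `φ(q) = ∑_{n ≥ 0} (-q; q)_{2n} q^{n+1} / (q; q^2)_{n+1}^2`. -/
noncomputable def phi : ℤ⟦X⟧ :=
  ∑' n : ℕ, phiTerm n

/-- The coefficients `a(n)` in `φ(q) = ∑ a(n) q^n` (here `a(0) = 0`). -/
noncomputable def a (n : ℕ) : ℤ :=
  coeff n phi

/-- `quot f g` is the quotient of `f` by `g` when `g` is a unit. -/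
theorem quot_mul_cancel (f : ℤ⟦X⟧) {g : ℤ⟦X⟧} (hg : IsUnit g) : quot f g * g = f := by
  rw [quot, mul_assoc, Ring.inverse_mul_cancel _ hg, mul_one]

/-- The product defining `E_j` converges for `j ≥ 1`. -/
theorem multipliable_E {j : ℕ} (hj : 0 < j) :
    Multipliable fun k : ℕ => (1 : ℤ⟦X⟧) - X ^ j * (X ^ j) ^ k := by
  simp_rw [sub_eq_add_neg]
  apply WithPiTopology.multipliable_one_add_of_tendsto_order_atTop_nhds_top
  refine ENat.tendsto_nhds_top_iff_natCast_lt.mpr fun n => Filter.eventually_atTop.mpr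
    ⟨n, fun m hm => ?_⟩
  rw [order_neg, ← pow_succ', ← pow_mul, order_X_pow, Nat.cast_lt]
  nlinarith

theorem isUnit_E {j : ℕ} (hj : 0 < j) : IsUnit (E j) := by
  rw [isUnit_iff_constantCoeff, E, qPochInf,
    (multipliable_E hj).map_tprod _ (WithPiTopology.continuous_constantCoeff ℤ)]
  simp [hj.ne']

theorem isUnit_qPoch (n : ℕ) : IsUnit (qPoch X (X ^ 2) n) := by
  rw [isUnit_iff_constantCoeff, qPoch, map_prod]
  simp

/-- The series defining `φ(q)` converges. -/
theorem summable_phiTerm : Summable phiTerm := by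
  apply WithPiTopology.summable_of_tendsto_order_atTop_nhds_top
  refine ENat.tendsto_nhds_top_iff_natCast_lt.mpr fun n => Filter.eventually_atTop.mpr
    ⟨n, fun m hm => ?_⟩
  have h : ((m + 1 : ℕ) : ℕ∞) ≤ (phiTerm m).order := by
    rw [phiTerm, quot]
    grw [← le_order_mul, ← le_order_mul, order_X_pow]
    exact le_add_right le_add_self
  refine lt_of_lt_of_le ?_ h
  exact_mod_cast Nat.lt_succ_of_le hm

end AppellLerch

namespace AppellLerch

open Filter Topology

/-! ### Convergence of families of power series -/

/-! Write θ(q) = ∑ q^(n²) and ψ(q) = ∑_{n≥0} q^(n(n+1)/2). The odd part of the Appell–Lerch sum is a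
single eta quotient, ∑ a(2n+1) qⁿ = E_2^8 / E_1^7 (`sect_two_one_phi`). Its coefficients of index
5n+4 are then found by rationalising a denominator and expressing everything through one parameter.

For the odd part, a Bailey pair (`bailey_pair_sum`) and a q-summation (`tsum_gaussTerm`) give φ ·
E_1² = E_2 · L with L = ∑ (-1)^r q^((r+1)²)/(1-q^(2r+1)), that is φ · θ(-q) = L. The product 2θ(-q)L
is a convolution of two bilateral sequences; up to q ↦ q² and explicit powers of q, its terms c_s
obey c_{s+2} = q^s c_s, so only c_0 and c_1 remain (`th_mul_lerchSum`). Neither is evaluated on its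
own, but 2ψ(q²)c_0 + θ(q)c_1 = E_1³ (`lerchConv_zero_one`): a theta function vanishing at z = 1
meets a generating function with a simple pole there, and the product of derivative and residue is
E_1³ by Jacobi. After multiplication by θ(q)², the odd part contains exactly this combination.

For the dissection, E_2^8/E_1^7 = ψ(q)³/θ(-q)², where ψ and θ(-q) each have three nonzero components
modulo 5. Multiplying by the conjugates of θ(-q) under q ↦ ζq, ζ⁵ = 1, moves the denominator into
ℤ⟦q⁵⟧, and the last component is an explicit polynomial in theta functions
(`quinticNorm_sq_mul_sect`). All these theta functions are rational in Ramanujan's k = R(q)R(q²)², R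
being the Rogers–Ramanujan continued fraction, up to a scale that cancels. The functions (1-k²)/k,
(1+k-k²)/k and (1-4k-k²)/k are eta quotients, so a rational identity in k (`lastComponent_eq`)
becomes the stated formula (`eq_eta_combination_of_quinticNorm`). -/

/-- A family of power series *decays* if modulo any power of `X` all but finitely many members
vanish. -/
def Decays {ι : Type*} (f : ι → ℤ⟦X⟧) : Prop :=
  ∀ n : ℕ, {i | ¬ X ^ n ∣ f i}.Finite

namespace Decays

variable {ι κ : Type*} {f : ι → ℤ⟦X⟧} {g : κ → ℤ⟦X⟧}

theorem summable (hf : Decays f) : Summable f := by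
  rw [WithPiTopology.summable_iff_summable_coeff]
  intro d
  refine summable_of_hasFiniteSupport ((hf (d + 1)).subset fun i hi hdvd => hi ?_)
  exact X_pow_dvd_iff.mp hdvd d (Nat.lt_succ_self d)

theorem comp_injective (hf : Decays f) {e : κ → ι} (he : Function.Injective e) :
    Decays (f ∘ e) := fun n =>
  ((hf n).preimage he.injOn).subset fun _ hi => hi

theorem of_dvd {g : ι → ℤ⟦X⟧} (hf : Decays f) (h : ∀ i, f i ∣ g i) : Decays g := fun n =>
  (hf n).subset fun i hi hdvd => hi (hdvd.trans (h i))

theorem mul_left (hf : Decays f) (c : ι → ℤ⟦X⟧) : Decays fun i => c i * f i :=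
  hf.of_dvd fun i => Dvd.intro_left (c i) rfl

theorem mul_right (hf : Decays f) (c : ι → ℤ⟦X⟧) : Decays fun i => f i * c i :=
  hf.of_dvd fun i => Dvd.intro (c i) rfl

theorem mul (hf : Decays f) (hg : Decays g) : Decays fun p : ι × κ => f p.1 * g p.2 := fun n =>
  ((hf n).prod (hg n)).subset fun _ hp =>
    ⟨fun h => hp (h.mul_right _), fun h => hp (h.mul_left _)⟩

theorem tsum_mul_tsum (hf : Decays f) (hg : Decays g) :
    (∑' i, f i) * ∑' j, g j = ∑' p : ι × κ, f p.1 * g p.2 :=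
  hf.summable.tsum_mul_tsum hg.summable (hf.mul hg).summable

end Decays

theorem decays_X_pow {ι : Type*} {e : ι → ℕ} (he : ∀ n, {i | e i < n}.Finite) :
    Decays fun i => (X : ℤ⟦X⟧) ^ e i := fun n =>
  (he n).subset fun i hi => by
    by_contra h
    exact hi (pow_dvd_pow X (not_lt.mp h))

theorem decays_nat {f : ℕ → ℤ⟦X⟧} (h : ∀ n, X ^ n ∣ f n) : Decays f :=
  (decays_X_pow (e := fun n : ℕ => n) fun n => Set.finite_lt_nat n).of_dvd h

theorem eq_of_forall_X_pow_dvd {f g : ℤ⟦X⟧} (h : ∀ n : ℕ, X ^ n ∣ f - g) : f = g := by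
  ext n
  have := X_pow_dvd_iff.mp (h (n + 1)) n (Nat.lt_succ_self n)
  rwa [map_sub, sub_eq_zero] at this

theorem X_pow_dvd_of_tendsto {ι : Type*} {l : Filter ι} [l.NeBot] {f : ι → ℤ⟦X⟧} {g : ℤ⟦X⟧} {n : ℕ}
    (hf : Tendsto f l (𝓝 g)) (h : ∀ᶠ i in l, X ^ n ∣ f i) : X ^ n ∣ g := by
  rw [X_pow_dvd_iff]
  intro m hm
  refine tendsto_nhds_unique
    (((WithPiTopology.continuous_coeff ℤ m).tendsto g).comp hf) (tendsto_const_nhds.congr' ?_)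
  filter_upwards [h] with i hi using (X_pow_dvd_iff.mp hi m hm).symm

theorem X_pow_dvd_tsum {ι : Type*} {f : ι → ℤ⟦X⟧} {n : ℕ} (h : ∀ i, X ^ n ∣ f i) :
    X ^ n ∣ ∑' i, f i := by
  by_cases hf : Summable f
  · exact X_pow_dvd_of_tendsto hf.hasSum (.of_forall fun s => Finset.dvd_sum fun i _ => h i)
  · rw [tsum_eq_zero_of_not_summable hf]
    exact dvd_zero _

theorem tendsto_zero_of_X_pow_dvd {f : ℕ → ℤ⟦X⟧} (h : ∀ n, X ^ n ∣ f n) :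
    Tendsto f atTop (𝓝 0) := by
  rw [WithPiTopology.tendsto_iff_coeff_tendsto]
  intro d
  rw [map_zero]
  refine tendsto_const_nhds.congr' ?_
  filter_upwards [eventually_gt_atTop d] with n hn using (X_pow_dvd_iff.mp (h n) d hn).symm

/-- A telescoping series whose partial sums decay has sum `0`. -/
theorem tsum_telescope {g : ℕ → ℤ⟦X⟧} (h0 : g 0 = 0) (h : ∀ n, X ^ n ∣ g n) :
    ∑' n, (g (n + 1) - g n) = 0 := by
  have hg : Decays g := decays_nat h
  have hg' : Decays fun n => g (n + 1) := hg.comp_injective (add_left_injective 1)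
  rw [hg'.summable.tsum_sub hg.summable, hg.summable.tsum_eq_zero_add, h0, zero_add, sub_self]

/-! ### Substitution `X ↦ X ^ k` and sections -/

theorem continuous_expand (k : ℕ) (hk : k ≠ 0) :
    Continuous (expand (R := ℤ) k hk) := by
  rw [continuous_iff_continuousAt]
  intro f
  rw [ContinuousAt, WithPiTopology.tendsto_iff_coeff_tendsto]
  intro d
  simp only [coeff_expand]
  split_ifs
  · exact (WithPiTopology.continuous_coeff ℤ _).tendsto f
  · exact tendsto_const_nhds

theorem expand_tsum {ι : Type*} {f : ι → ℤ⟦X⟧} (hf : Summable f) (k : ℕ) (hk : k ≠ 0) :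
    expand k hk (∑' i, f i) = ∑' i, expand k hk (f i) :=
  hf.map_tsum (expand k hk) (continuous_expand k hk)

theorem expand_tprod {ι : Type*} {f : ι → ℤ⟦X⟧} (hf : Multipliable f) (k : ℕ) (hk : k ≠ 0) :
    expand k hk (∏' i, f i) = ∏' i, expand k hk (f i) :=
  hf.map_tprod (expand k hk) (continuous_expand k hk)

/-- The section `∑ f_n X ^ n ↦ ∑ f_{m n + r} X ^ n`. -/
noncomputable def sect (m r : ℕ) : ℤ⟦X⟧ →+ ℤ⟦X⟧ where
  toFun f := mk fun n => coeff (m * n + r) f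
  map_zero' := by ext; simp
  map_add' f g := by ext; simp

theorem coeff_sect (m r n : ℕ) (f : ℤ⟦X⟧) : coeff n (sect m r f) = coeff (m * n + r) f := by
  simp [sect]

/-- Sections are linear over series in `X ^ m`: in the Cauchy product at index `m * n + r`, only
pairs whose first entry is a multiple of `m` contribute. -/
theorem sect_expand_mul {m r : ℕ} (hm : m ≠ 0) (hr : r < m) (f g : ℤ⟦X⟧) :
    sect m r (expand m hm f * g) = f * sect m r g := by
  ext n
  rw [coeff_sect, coeff_mul, coeff_mul]
  symm
  refine Finset.sum_of_injOn (fun p => (m * p.1, m * p.2 + r)) ?_ ?_ ?_ ?_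
  · rintro ⟨i, j⟩ _ ⟨i', j'⟩ _ h
    simp only [Prod.mk.injEq, add_left_inj] at h
    exact Prod.ext (Nat.eq_of_mul_eq_mul_left (by lia) h.1)
      (Nat.eq_of_mul_eq_mul_left (by lia) h.2)
  · rintro ⟨i, j⟩ h
    simp only [Finset.mem_coe, Finset.HasAntidiagonal.mem_antidiagonal] at h ⊢
    rw [← h]; ring
  · rintro ⟨i, j⟩ h hn
    rw [coeff_expand]
    split_ifs with hd
    · obtain ⟨c, rfl⟩ := hd
      exfalso
      apply hn
      rw [Finset.HasAntidiagonal.mem_antidiagonal] at h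
      dsimp only at h
      have hc : c ≤ n := by
        by_contra hc
        have : m * (n + 1) ≤ m * c := Nat.mul_le_mul_left m (by lia)
        rw [mul_add] at this
        lia
      refine ⟨(c, n - c), Finset.mem_coe.mpr
        (Finset.HasAntidiagonal.mem_antidiagonal.mpr (by dsimp only; lia)), ?_⟩
      have : m * (n - c) + m * c = m * n := by rw [← mul_add, Nat.sub_add_cancel hc]
      simp only [Prod.mk.injEq, true_and]
      lia
    · rw [zero_mul]
  · rintro ⟨i, j⟩ _
    rw [coeff_sect, coeff_expand_mul]

theorem sect_X_pow_self {m r : ℕ} (hm : m ≠ 0) : sect m r (X ^ r) = 1 := by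
  ext n
  rw [coeff_sect, coeff_X_pow, coeff_one]
  simp [hm]

theorem sect_X_pow_of_ne {m r j : ℕ} (hj : j % m ≠ r % m) : sect m r (X ^ j) = 0 := by
  ext n
  rw [coeff_sect, coeff_X_pow, if_neg, map_zero]
  rintro rfl
  simp at hj

theorem sect_expand_mul_X_pow_self {m r : ℕ} (hm : m ≠ 0) (hr : r < m) (f : ℤ⟦X⟧) :
    sect m r (expand m hm f * X ^ r) = f := by
  rw [sect_expand_mul hm hr, sect_X_pow_self hm, mul_one]

theorem sect_expand_mul_X_pow_of_ne {m r j : ℕ} (hm : m ≠ 0) (hr : r < m) (hj : j % m ≠ r % m)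
    (f : ℤ⟦X⟧) : sect m r (expand m hm f * X ^ j) = 0 := by
  rw [sect_expand_mul hm hr, sect_X_pow_of_ne hj, mul_zero]

/-! ### Infinite `q`-shifted factorials -/

theorem multipliable_qPochInf (a : ℤ⟦X⟧) {q : ℤ⟦X⟧} (hq : X ∣ q) :
    Multipliable fun k : ℕ => 1 - a * q ^ k := by
  simp_rw [sub_eq_add_neg]
  apply WithPiTopology.multipliable_one_add_of_tendsto_order_atTop_nhds_top
  refine ENat.tendsto_nhds_top_iff_natCast_lt.mpr fun n => Filter.eventually_atTop.mpr
    ⟨n + 1, fun m hm => ?_⟩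
  rw [order_neg]
  have h : (X : ℤ⟦X⟧) ^ m ∣ a * q ^ m := (pow_dvd_pow_of_dvd hq m).mul_left a
  rw [X_pow_dvd_iff] at h
  refine lt_of_lt_of_le (b := (m : ℕ∞)) (by exact_mod_cast hm) (nat_le_order _ _ h)

theorem tendsto_qPoch (a : ℤ⟦X⟧) {q : ℤ⟦X⟧} (hq : X ∣ q) :
    Tendsto (qPoch a q) atTop (𝓝 (qPochInf a q)) :=
  (multipliable_qPochInf a hq).hasProd.tendsto_prod_nat

theorem qPoch_zero (a q : ℤ⟦X⟧) : qPoch a q 0 = 1 := by simp [qPoch]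

theorem qPoch_succ (a q : ℤ⟦X⟧) (n : ℕ) : qPoch a q (n + 1) = qPoch a q n * (1 - a * q ^ n) :=
  Finset.prod_range_succ _ _

theorem qPoch_add (a q : ℤ⟦X⟧) (m n : ℕ) :
    qPoch a q (m + n) = qPoch a q m * qPoch (a * q ^ m) q n := by
  simp only [qPoch, Finset.prod_range_add, pow_add, mul_assoc]

theorem qPochInf_eq_mul (a : ℤ⟦X⟧) {q : ℤ⟦X⟧} (hq : X ∣ q) (n : ℕ) :
    qPochInf a q = qPoch a q n * qPochInf (a * q ^ n) q := by
  refine tendsto_nhds_unique ((tendsto_qPoch a hq).comp (tendsto_add_atTop_nat n)) ?_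
  refine ((tendsto_qPoch (a * q ^ n) hq).const_mul (qPoch a q n)).congr fun m => ?_
  rw [Function.comp_apply, ← qPoch_add, add_comm]

theorem X_pow_dvd_qPoch_sub_one {a q : ℤ⟦X⟧} {n : ℕ} (ha : X ^ n ∣ a) (m : ℕ) :
    X ^ n ∣ qPoch a q m - 1 := by
  induction m with
  | zero => simp [qPoch_zero]
  | succ m ih =>
    have : qPoch a q (m + 1) - 1 = (qPoch a q m - 1) - qPoch a q m * q ^ m * a := by
      rw [qPoch_succ]; ring
    rw [this]
    exact dvd_sub ih (ha.mul_left _)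

theorem X_pow_dvd_qPochInf_sub_one {a q : ℤ⟦X⟧} (hq : X ∣ q) {n : ℕ} (ha : X ^ n ∣ a) :
    X ^ n ∣ qPochInf a q - 1 :=
  X_pow_dvd_of_tendsto ((tendsto_qPoch a hq).sub_const 1)
    (.of_forall fun m => X_pow_dvd_qPoch_sub_one ha m)

theorem X_pow_dvd_qPochInf_sub_qPoch (a : ℤ⟦X⟧) {q : ℤ⟦X⟧} (hq : X ∣ q) (n : ℕ) :
    X ^ n ∣ qPochInf a q - qPoch a q n := by
  have h : qPochInf a q - qPoch a q n = qPoch a q n * (qPochInf (a * q ^ n) q - 1) := by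
    rw [qPochInf_eq_mul a hq n]; ring
  rw [h]
  exact (X_pow_dvd_qPochInf_sub_one hq ((pow_dvd_pow_of_dvd hq n).mul_left a)).mul_left _

theorem isUnit_of_X_dvd_sub_one {f : ℤ⟦X⟧} (h : X ∣ f - 1) : IsUnit f := by
  rw [isUnit_iff_constantCoeff]
  rw [X_dvd_iff, map_sub, map_one, sub_eq_zero] at h
  rw [h]
  exact isUnit_one

theorem isUnit_qPochInf {a q : ℤ⟦X⟧} (ha : X ∣ a) (hq : X ∣ q) : IsUnit (qPochInf a q) :=
  isUnit_of_X_dvd_sub_one (by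
    simpa using X_pow_dvd_qPochInf_sub_one (n := 1) hq (by simpa using ha))

theorem isUnit_qPoch_of_dvd {a : ℤ⟦X⟧} (ha : X ∣ a) (q : ℤ⟦X⟧) (n : ℕ) : IsUnit (qPoch a q n) :=
  isUnit_of_X_dvd_sub_one (by simpa using X_pow_dvd_qPoch_sub_one (n := 1) (by simpa using ha) n)

theorem isUnit_one_sub_X_pow {n : ℕ} (hn : n ≠ 0) : IsUnit (1 - (X : ℤ⟦X⟧) ^ n) :=
  isUnit_of_X_dvd_sub_one (by
    rw [show 1 - (X : ℤ⟦X⟧) ^ n - 1 = -X ^ n by ring]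
    exact (dvd_pow_self X hn).neg_right)

theorem qPochInf_mul_qPochInf_neg (a : ℤ⟦X⟧) {q : ℤ⟦X⟧} (hq : X ∣ q) :
    qPochInf a q * qPochInf (-a) q = qPochInf (a ^ 2) (q ^ 2) := by
  rw [qPochInf, qPochInf, qPochInf,
    ← (multipliable_qPochInf a hq).tprod_mul (multipliable_qPochInf (-a) hq)]
  exact tprod_congr fun k => by ring

/-- Splitting of an infinite `q`-shifted factorial by the residue of the index modulo `d`. -/
theorem qPochInf_eq_prod (a : ℤ⟦X⟧) {q : ℤ⟦X⟧} (hq : X ∣ q) {d : ℕ} (hd : d ≠ 0) :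
    qPochInf a q = ∏ i ∈ Finset.range d, qPochInf (a * q ^ i) (q ^ d) := by
  have key : ∀ n, qPoch a q (d * n) =
      ∏ i ∈ Finset.range d, qPoch (a * q ^ i) (q ^ d) n := by
    intro n
    induction n with
    | zero => simp [qPoch_zero]
    | succ n ih =>
      simp only [qPoch_succ, Finset.prod_mul_distrib]
      rw [← ih, mul_add, mul_one, qPoch_add]
      congr 1
      exact Finset.prod_congr rfl fun i _ => by ring
  have hq' : X ∣ q ^ d := dvd_pow hq hd
  have h1 : Tendsto (fun n => qPoch a q (d * n)) atTop (𝓝 (qPochInf a q)) :=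
    (tendsto_qPoch a hq).comp (tendsto_id.const_mul_atTop' (Nat.pos_of_ne_zero hd))
  refine tendsto_nhds_unique h1 ?_
  simp only [key]
  exact tendsto_finsetProd _ fun i _ => tendsto_qPoch (a * q ^ i) hq'

theorem expand_qPochInf (a : ℤ⟦X⟧) {q : ℤ⟦X⟧} (hq : X ∣ q) (k : ℕ) (hk : k ≠ 0) :
    expand k hk (qPochInf a q) = qPochInf (expand k hk a) (expand k hk q) := by
  rw [qPochInf, qPochInf, expand_tprod (multipliable_qPochInf a hq)]
  exact tprod_congr fun i => by simp

theorem expand_E {j : ℕ} (hj : j ≠ 0) (k : ℕ) (hk : k ≠ 0) : expand k hk (E j) = E (k * j) := by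
  rw [E, E, expand_qPochInf _ (dvd_pow_self X hj)]
  simp [pow_mul]

theorem tendsto_of_eventually_X_pow_dvd {ι : Type*} {l : Filter ι} {f : ι → ℤ⟦X⟧} {g : ℤ⟦X⟧}
    (h : ∀ n : ℕ, ∀ᶠ i in l, X ^ n ∣ f i - g) : Tendsto f l (𝓝 g) := by
  rw [WithPiTopology.tendsto_iff_coeff_tendsto]
  intro d
  refine tendsto_const_nhds.congr' ?_
  filter_upwards [h (d + 1)] with i hi
  have := X_pow_dvd_iff.mp hi d (Nat.lt_succ_self d)
  rw [map_sub, sub_eq_zero] at this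
  exact this.symm

theorem X_pow_dvd_tsum_sub_sum {ι : Type*} {f : ι → ℤ⟦X⟧} (hf : Summable f) {n : ℕ}
    (s : Finset ι) (h : ∀ i ∉ s, X ^ n ∣ f i) : X ^ n ∣ ∑' i, f i - ∑ i ∈ s, f i := by
  classical
  refine X_pow_dvd_of_tendsto (hf.hasSum.sub_const (∑ i ∈ s, f i)) ?_
  filter_upwards [eventually_ge_atTop s] with t ht
  rw [← Finset.sum_sdiff ht, add_sub_cancel_right]
  exact Finset.dvd_sum fun i hi => h i (Finset.mem_sdiff.mp hi).2

/-! ### Gaussian binomial coefficients -/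

/-- The Gaussian binomial coefficient. -/
def gaussBinom {R : Type*} [CommRing R] (q : R) : ℕ → ℕ → R
  | _, 0 => 1
  | 0, _ + 1 => 0
  | N + 1, i + 1 => gaussBinom q N (i + 1) + q ^ (N - i) * gaussBinom q N i

section GaussBinom

variable {R : Type*} [CommRing R] (q : R)

@[simp]
theorem gaussBinom_zero_right (N : ℕ) : gaussBinom q N 0 = 1 := by cases N <;> rfl

theorem gaussBinom_succ_succ (N i : ℕ) : gaussBinom q (N + 1) (i + 1) =
    gaussBinom q N (i + 1) + q ^ (N - i) * gaussBinom q N i := rfl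

theorem gaussBinom_eq_zero {N i : ℕ} (h : N < i) : gaussBinom q N i = 0 := by
  induction N generalizing i with
  | zero => obtain ⟨i, rfl⟩ := Nat.exists_eq_succ_of_ne_zero h.ne'; rfl
  | succ N ih =>
    obtain ⟨i, rfl⟩ := Nat.exists_eq_succ_of_ne_zero (Nat.ne_zero_of_lt h)
    rw [Nat.succ_eq_add_one, gaussBinom_succ_succ, ih (by lia), ih (by lia)]
    ring

/-- The mirror q-Pascal rule. The definition extends the first product of the finite triple product,
and this rule extends the second. -/
theorem gaussBinom_succ_succ' (N i : ℕ) : gaussBinom q (N + 1) (i + 1) =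
    q ^ (i + 1) * gaussBinom q N (i + 1) + gaussBinom q N i := by
  induction N generalizing i with
  | zero =>
    rw [gaussBinom_succ_succ, gaussBinom_eq_zero q (show 0 < i + 1 by lia)]
    simp
  | succ N ih =>
    rw [gaussBinom_succ_succ]
    cases i with
    | zero =>
      have h1 := ih 0
      have h2 := gaussBinom_succ_succ q N 0
      simp only [gaussBinom_zero_right, tsub_zero, zero_add, pow_one] at h1 h2 ⊢
      linear_combination h1 - q * h2
    | succ i =>
      -- The exponents agree only for `i + 1 ≤ N`, because of truncated subtraction; beyond that the
      -- binomial vanishes.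
      have hz : (q ^ (N - i) * q ^ (i + 1) - q ^ (i + 2) * q ^ (N - (i + 1))) *
          gaussBinom q N (i + 1) = 0 := by
        rcases le_or_gt (i + 1) N with h | h
        · obtain ⟨k, rfl⟩ := Nat.exists_eq_add_of_le h
          rw [show i + 1 + k - i = k + 1 by lia, show i + 1 + k - (i + 1) = k by lia]
          ring
        · rw [gaussBinom_eq_zero q h, mul_zero]
      rw [show N + 1 - (i + 1) = N - i by lia]
      linear_combination ih (i + 1) + q ^ (N - i) * ih i -
        q ^ (i + 2) * gaussBinom_succ_succ q N (i + 1) - gaussBinom_succ_succ q N i + hz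

theorem map_gaussBinom {S : Type*} [CommRing S] (f : R →+* S) (N i : ℕ) :
    f (gaussBinom q N i) = gaussBinom (f q) N i := by
  induction N generalizing i with
  | zero => cases i <;> simp [gaussBinom]
  | succ N ih => cases i <;> simp [gaussBinom, ih]

end GaussBinom

theorem gaussBinom_mul_qPoch (q : ℤ⟦X⟧) (i k : ℕ) :
    gaussBinom q (i + k) i * (qPoch q q i * qPoch q q k) = qPoch q q (i + k) := by
  obtain ⟨N, hN⟩ : ∃ N, i + k = N := ⟨_, rfl⟩
  rw [hN]
  induction N generalizing i k with
  | zero =>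
    obtain ⟨rfl, rfl⟩ : i = 0 ∧ k = 0 := by lia
    simp [qPoch_zero]
  | succ N ih =>
    rcases i with _ | i
    · obtain rfl : k = N + 1 := by lia
      simp [qPoch_zero]
    rw [gaussBinom_succ_succ]
    have h1 := ih i k (by lia)
    rcases k with _ | k
    · obtain rfl : i = N := by lia
      rw [gaussBinom_eq_zero q (Nat.lt_succ_self i), qPoch_succ, Nat.sub_self]
      linear_combination (1 - q * q ^ i) * h1
    · have h2 := ih (i + 1) k (by lia)
      obtain rfl : N = i + k + 1 := by lia
      rw [show i + k + 1 - i = k + 1 by lia]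
      rw [qPoch_succ q q i] at h2 ⊢
      rw [qPoch_succ q q k] at h1 ⊢
      rw [qPoch_succ q q (i + k + 1)]
      linear_combination (1 - q * q ^ k) * h2 + q ^ (k + 1) * (1 - q * q ^ i) * h1

/-- Quantitative form of the limit of the Gaussian binomial, 1/(q;q)_∞, when both lower indices
grow: each finite factorial agrees with the infinite one modulo `X ^ M`. -/
theorem X_pow_dvd_gaussBinom_mul_sub_one {q : ℤ⟦X⟧} (hq : X ∣ q) {M i k : ℕ} (hi : M ≤ i)
    (hk : M ≤ k) : X ^ M ∣ gaussBinom q (i + k) i * qPochInf q q - 1 := by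
  have h := gaussBinom_mul_qPoch q i k
  have hd (n : ℕ) (hn : M ≤ n) : X ^ M ∣ qPochInf q q - qPoch q q n :=
    (pow_dvd_pow X hn).trans (X_pow_dvd_qPochInf_sub_qPoch q hq n)
  have hu := isUnit_qPochInf hq hq
  rw [← hu.dvd_mul_right]
  have : (gaussBinom q (i + k) i * qPochInf q q - 1) * qPochInf q q =
      gaussBinom q (i + k) i * (qPochInf q q * (qPochInf q q - qPoch q q k) +
        qPoch q q k * (qPochInf q q - qPoch q q i)) -
        (qPochInf q q - qPoch q q (i + k)) := by
    linear_combination h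
  rw [this]
  exact dvd_sub (((hd k hk).mul_left _).add ((hd i hi).mul_left _) |>.mul_left _)
    (hd _ (by lia))

/-- The limit of finite sums weighted by Gaussian binomial coefficients. -/
theorem tendsto_sum_gaussBinom {q : ℤ⟦X⟧} (hq : X ∣ q) {t : ℤ → ℤ⟦X⟧} (ht : Decays t) :
    Tendsto (fun n : ℕ => (∑ i ∈ Finset.range (n + (n + 1) + 1),
      gaussBinom q (n + (n + 1)) i * t (i - (n + 1 : ℕ))) * qPochInf q q) atTop
      (𝓝 (∑' j, t j)) := by
  refine tendsto_of_eventually_X_pow_dvd fun M => ?_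
  -- Modulo `X ^ M` only the `t j` with |j| ≤ B survive, and `n ≥ B + M` keeps both lower indices of
  -- their binomials at least `M`.
  obtain ⟨B, hB⟩ := ((ht M).image Int.natAbs).bddAbove
  have hB' : ∀ j : ℤ, B < j.natAbs → X ^ M ∣ t j := by
    intro j hj
    by_contra h
    exact absurd (hB ⟨j, h, rfl⟩) (not_le.mpr hj)
  filter_upwards [eventually_ge_atTop (B + M)] with n hn
  have himg : ∑ i ∈ Finset.range (n + (n + 1) + 1), t ((i : ℤ) - (n + 1 : ℕ)) =
      ∑ j ∈ Finset.Icc (-(n + 1 : ℕ) : ℤ) n, t j := by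
    refine Finset.sum_bij (fun i _ => (i : ℤ) - (n + 1 : ℕ)) ?_ ?_ ?_ fun _ _ => rfl
    · intro i hi
      rw [Finset.mem_range] at hi
      rw [Finset.mem_Icc]
      lia
    · intro i _ i' _ h
      lia
    · intro j hj
      rw [Finset.mem_Icc] at hj
      exact ⟨(j + (n + 1 : ℕ)).toNat, by rw [Finset.mem_range]; lia, by lia⟩
  have h1 := X_pow_dvd_tsum_sub_sum ht.summable (n := M) (Finset.Icc (-(n + 1 : ℕ) : ℤ) n)
    fun j hj => hB' j (by rw [Finset.mem_Icc] at hj; lia)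
  rw [← himg] at h1
  have h2 : X ^ M ∣ ∑ i ∈ Finset.range (n + (n + 1) + 1),
      (gaussBinom q (n + (n + 1)) i * qPochInf q q - 1) * t (i - (n + 1 : ℕ)) := by
    refine Finset.dvd_sum fun i hi => ?_
    rw [Finset.mem_range] at hi
    by_cases hj : B < ((i : ℤ) - (n + 1 : ℕ)).natAbs
    · exact (hB' _ hj).mul_left _
    · obtain ⟨k, hk⟩ : ∃ k, n + (n + 1) = i + k := ⟨n + (n + 1) - i, by lia⟩
      rw [hk]
      exact (X_pow_dvd_gaussBinom_mul_sub_one hq (by lia) (by lia)).mul_right _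
  have h3 : (∑ i ∈ Finset.range (n + (n + 1) + 1),
      gaussBinom q (n + (n + 1)) i * t (i - (n + 1 : ℕ))) * qPochInf q q - ∑' j, t j =
      ∑ i ∈ Finset.range (n + (n + 1) + 1),
        (gaussBinom q (n + (n + 1)) i * qPochInf q q - 1) * t (i - (n + 1 : ℕ)) -
      (∑' j, t j - ∑ i ∈ Finset.range (n + (n + 1) + 1), t ((i : ℤ) - (n + 1 : ℕ))) := by
    rw [Finset.sum_mul, sub_sub_eq_add_sub, ← Finset.sum_add_distrib]
    congr 1
    exact Finset.sum_congr rfl fun i _ => by ring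
  rw [h3]
  exact dvd_sub h2 h1

/-! ### The Jacobi triple product -/

/-- The triangular number `j (j + 1) / 2`. -/
def tri (j : ℤ) : ℕ := (j * (j + 1) / 2).toNat

theorem two_mul_tri (j : ℤ) : 2 * (tri j : ℤ) = j * (j + 1) := by
  have h0 : 0 ≤ j * (j + 1) := by
    rcases le_or_gt 0 j with h | h
    · positivity
    · exact mul_nonneg_of_nonpos_of_nonpos h.le (by lia)
  have h2 : j * (j + 1) % 2 = 0 := Int.even_iff.mp (Int.even_mul_succ_self j)
  rw [tri]
  lia

theorem tri_eq (j : ℤ) : (tri j : ℤ) = tri (j - 1) + j := by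
  have h1 := two_mul_tri j
  have h2 := two_mul_tri (j - 1)
  linarith

/-- The general term of Ramanujan's theta function `f(a, b)`. -/
def thetaTerm {R : Type*} [CommRing R] (a b : R) (j : ℤ) : R := a ^ tri j * b ^ tri (j - 1)

/-- The ratio of consecutive theta terms is a(ab)^(j-1). Since `j` may be negative, the power of
`ab` is split between the two sides with natural exponents. -/
theorem thetaTerm_mul_left {R : Type*} [CommRing R] (a b : R) {j : ℤ} {m k : ℕ}
    (h : (m : ℤ) + 1 = j + k) :
    a * (a * b) ^ m * thetaTerm a b (j - 1) = (a * b) ^ k * thetaTerm a b j := by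
  have h1 := tri_eq j
  have h2 := tri_eq (j - 1)
  have e1 : 1 + m + tri (j - 1) = k + tri j := by lia
  have e2 : m + tri (j - 1 - 1) = k + tri (j - 1) := by lia
  calc a * (a * b) ^ m * thetaTerm a b (j - 1)
      = a ^ (1 + m + tri (j - 1)) * b ^ (m + tri (j - 1 - 1)) := by rw [thetaTerm]; ring
    _ = _ := by rw [e1, e2, thetaTerm]; ring

theorem thetaTerm_mul_right {R : Type*} [CommRing R] (a b : R) {j : ℤ} {n i : ℕ}
    (h : (i : ℤ) = n + 1 + j) :
    b * (a * b) ^ n * thetaTerm a b (j + 1) = (a * b) ^ i * thetaTerm a b j := by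
  have h1 := tri_eq j
  have h2 := tri_eq (j + 1)
  rw [add_sub_cancel_right] at h2
  have e1 : n + tri (j + 1) = i + tri j := by lia
  have e2 : 1 + n + tri j = i + tri (j - 1) := by lia
  calc b * (a * b) ^ n * thetaTerm a b (j + 1)
      = a ^ (n + tri (j + 1)) * b ^ (1 + n + tri j) := by
        rw [thetaTerm, add_sub_cancel_right]; ring
    _ = _ := by rw [e1, e2, thetaTerm]; ring

theorem finite_triple_product_right {R : Type*} [CommRing R] (a b : R) (n : ℕ) :
    ∏ k ∈ Finset.range n, (1 + b * (a * b) ^ k) =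
      ∑ i ∈ Finset.range (n + 1), gaussBinom (a * b) n i * thetaTerm a b (i - n) := by
  induction n with
  | zero => simp [thetaTerm, tri]
  | succ n ih =>
    have h1 : ∀ i : ℕ, (a * b) ^ (i + 1) * thetaTerm a b (((i + 1 : ℕ) : ℤ) - (n + 1 : ℕ)) =
        b * (a * b) ^ n * thetaTerm a b (((i + 1 : ℕ) : ℤ) - n) := fun i => by
      rw [← thetaTerm_mul_right a b (j := ((i + 1 : ℕ) : ℤ) - (n + 1 : ℕ)) (n := n)
        (i := i + 1) (by push_cast; ring)]
      congr 2
      push_cast; ring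
    have h0 : thetaTerm a b (((0 : ℕ) : ℤ) - (n + 1 : ℕ)) =
        b * (a * b) ^ n * thetaTerm a b (((0 : ℕ) : ℤ) - n) := by
      rw [← one_mul (thetaTerm a b (((0 : ℕ) : ℤ) - (n + 1 : ℕ))), ← pow_zero (a * b),
        ← thetaTerm_mul_right a b (j := ((0 : ℕ) : ℤ) - (n + 1 : ℕ)) (n := n)
        (i := 0) (by push_cast; ring)]
      congr 2
      push_cast; ring
    have h2 : ∀ i : ℕ, thetaTerm a b (((i + 1 : ℕ) : ℤ) - (n + 1 : ℕ)) =
        thetaTerm a b ((i : ℤ) - n) := fun i => by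
      congr 1; push_cast; ring
    have h3 : ∑ i ∈ Finset.range (n + 1), gaussBinom (a * b) n (i + 1) *
        thetaTerm a b (((i + 1 : ℕ) : ℤ) - n) + thetaTerm a b (((0 : ℕ) : ℤ) - n) =
        ∑ i ∈ Finset.range (n + 1), gaussBinom (a * b) n i * thetaTerm a b (i - n) := by
      rw [Finset.sum_range_succ _ n, gaussBinom_eq_zero _ (Nat.lt_succ_self n),
        Finset.sum_range_succ' _ n, gaussBinom_zero_right]
      ring
    rw [Finset.prod_range_succ, ih, Finset.sum_range_succ' _ (n + 1), gaussBinom_zero_right,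
      one_mul, h0]
    have h4 : ∀ i : ℕ, gaussBinom (a * b) (n + 1) (i + 1) *
        thetaTerm a b (((i + 1 : ℕ) : ℤ) - (n + 1 : ℕ)) =
        b * (a * b) ^ n * (gaussBinom (a * b) n (i + 1) * thetaTerm a b (((i + 1 : ℕ) : ℤ) - n)) +
          gaussBinom (a * b) n i * thetaTerm a b ((i : ℤ) - n) := fun i => by
      rw [gaussBinom_succ_succ']
      linear_combination gaussBinom (a * b) n (i + 1) * h1 i + gaussBinom (a * b) n i * h2 i
    simp only [h4, Finset.sum_add_distrib, ← Finset.mul_sum]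
    linear_combination -(b * (a * b) ^ n) * h3

/-- The finite form of the Jacobi triple product. -/
theorem finite_triple_product {R : Type*} [CommRing R] (a b : R) (m n : ℕ) :
    (∏ k ∈ Finset.range m, (1 + a * (a * b) ^ k)) * ∏ k ∈ Finset.range n, (1 + b * (a * b) ^ k) =
      ∑ i ∈ Finset.range (m + n + 1), gaussBinom (a * b) (m + n) i * thetaTerm a b (i - n) := by
  induction m with
  | zero => rw [Finset.prod_range_zero, one_mul, zero_add, finite_triple_product_right]
  | succ m ih =>
    have h1 : ∀ i ∈ Finset.range (m + n + 1), gaussBinom (a * b) (m + n + 1) (i + 1) *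
        thetaTerm a b (((i + 1 : ℕ) : ℤ) - n) =
        gaussBinom (a * b) (m + n) (i + 1) * thetaTerm a b (((i + 1 : ℕ) : ℤ) - n) +
          a * (a * b) ^ m * (gaussBinom (a * b) (m + n) i * thetaTerm a b ((i : ℤ) - n)) := by
      intro i hi
      rw [Finset.mem_range] at hi
      have := thetaTerm_mul_left a b (j := ((i + 1 : ℕ) : ℤ) - n) (m := m) (k := m + n - i)
        (by push_cast; lia)
      rw [show ((i + 1 : ℕ) : ℤ) - n - 1 = (i : ℤ) - n by push_cast; ring] at this
      rw [gaussBinom_succ_succ]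
      linear_combination -gaussBinom (a * b) (m + n) i * this
    have h3 : ∑ i ∈ Finset.range (m + n + 1), gaussBinom (a * b) (m + n) (i + 1) *
        thetaTerm a b (((i + 1 : ℕ) : ℤ) - n) + thetaTerm a b (((0 : ℕ) : ℤ) - n) =
        ∑ i ∈ Finset.range (m + n + 1), gaussBinom (a * b) (m + n) i * thetaTerm a b (i - n) := by
      rw [Finset.sum_range_succ _ (m + n), gaussBinom_eq_zero _ (Nat.lt_succ_self (m + n)),
        Finset.sum_range_succ' _ (m + n), gaussBinom_zero_right]
      ring
    rw [Finset.prod_range_succ, mul_right_comm, ih, show m + 1 + n + 1 = m + n + 1 + 1 by ring,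
      show m + 1 + n = m + n + 1 by ring, Finset.sum_range_succ' _ (m + n + 1),
      Finset.sum_congr rfl h1, gaussBinom_zero_right, one_mul, Finset.sum_add_distrib,
      ← Finset.mul_sum]
    linear_combination -h3

theorem qPoch_eq_prod_one_add (a q : ℤ⟦X⟧) (n : ℕ) :
    qPoch (-a) q n = ∏ k ∈ Finset.range n, (1 + a * q ^ k) :=
  Finset.prod_congr rfl fun k _ => by ring

/-- The Jacobi triple product identity. -/
theorem triple_product {a b : ℤ⟦X⟧} (hab : X ∣ a * b) (h : Decays (thetaTerm a b)) :
    ∑' j, thetaTerm a b j =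
      qPochInf (-a) (a * b) * qPochInf (-b) (a * b) * qPochInf (a * b) (a * b) := by
  refine tendsto_nhds_unique (tendsto_sum_gaussBinom hab h) ?_
  simp only [← finite_triple_product, ← qPoch_eq_prod_one_add]
  exact (((tendsto_qPoch (-a) hab).mul
    ((tendsto_qPoch (-b) hab).comp (tendsto_add_atTop_nat 1))).mul_const _)

theorem decays_X_pow_tri : Decays fun j : ℤ => (X : ℤ⟦X⟧) ^ tri j := by
  refine decays_X_pow fun n => (Set.finite_Icc (-(2 * n + 2 : ℤ)) (2 * n + 2)).subset ?_
  intro j hj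
  have h1 := two_mul_tri j
  have h2 : (tri j : ℤ) < n := by exact_mod_cast hj
  rw [Set.mem_Icc]
  constructor <;> nlinarith

/-! ### Theta series in one variable -/

/-- `s ^ n` for a square root `s` of unity. -/
noncomputable def sgn (s : ℤ⟦X⟧) (n : ℤ) : ℤ⟦X⟧ := if Even n then 1 else s

@[simp]
theorem sgn_one (n : ℤ) : sgn 1 n = 1 := ite_self 1

@[simp]
theorem sgn_zero (s : ℤ⟦X⟧) : sgn s 0 = 1 := if_pos Even.zero

theorem sgn_congr (s : ℤ⟦X⟧) {m n : ℤ} (h : Even (m - n)) : sgn s m = sgn s n := by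
  rw [Int.even_sub] at h
  simp [sgn, h]

theorem sgn_mul {s : ℤ⟦X⟧} (hs : s * s = 1) (m n : ℤ) : sgn s m * sgn s n = sgn s (m + n) := by
  by_cases hm : Even m <;> by_cases hn : Even n <;> simp [sgn, Int.even_add, hm, hn, hs]

theorem pow_eq_sgn {s : ℤ⟦X⟧} (hs : s * s = 1) (n : ℕ) : s ^ n = sgn s n := by
  induction n with
  | zero => simp
  | succ n ih =>
    rw [pow_succ, ih, Nat.cast_succ, ← sgn_mul hs]
    simp [sgn]

theorem sgn_neg_one_succ (n : ℤ) : sgn (-1) (n + 1) = -sgn (-1) n := by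
  rw [← sgn_mul (by ring)]
  simp [sgn]

/-- The exponent `(A n ^ 2 + B n) / 2`. -/
def qexp (A B n : ℤ) : ℕ := ((A * n ^ 2 + B * n) / 2).toNat

/-- Conditions under which `(A n ^ 2 + B n) / 2` is a positive-definite function to `ℕ`. -/
structure IsThetaPair (A B : ℤ) : Prop where
  pos : 0 < A
  abs_right_le : |B| ≤ A
  two_dvd : 2 ∣ A - B

theorem IsThetaPair.two_mul_qexp {A B : ℤ} (h : IsThetaPair A B) (n : ℤ) :
    2 * (qexp A B n : ℤ) = A * n ^ 2 + B * n := by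
  have h0 : 0 ≤ A * n ^ 2 + B * n := by
    have h1 := abs_le.mp h.abs_right_le
    rcases lt_trichotomy n 0 with hn | rfl | hn
    · nlinarith [mul_nonneg (show 0 ≤ -n by lia) (show 0 ≤ -n - 1 by lia), h.pos,
        mul_nonneg (show 0 ≤ -n by lia) (show 0 ≤ A - B by lia)]
    · simp
    · nlinarith [mul_nonneg (show 0 ≤ n by lia) (show 0 ≤ n - 1 by lia), h.pos,
        mul_nonneg (show 0 ≤ n by lia) (show 0 ≤ A + B by lia)]
  have h2 : (2 : ℤ) ∣ A * n ^ 2 + B * n := by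
    obtain ⟨c, hc⟩ := h.two_dvd
    obtain ⟨d, hd⟩ := even_iff_two_dvd.mp (Int.even_mul_succ_self n)
    refine ⟨A * d - c * n, ?_⟩
    linear_combination A * hd - n * hc
  rw [qexp]
  lia

theorem IsThetaPair.decays {A B : ℤ} (h : IsThetaPair A B) :
    Decays fun n : ℤ => (X : ℤ⟦X⟧) ^ qexp A B n := by
  refine decays_X_pow fun N => (Set.finite_Icc (-(2 * N + 2 : ℤ)) (2 * N + 2)).subset ?_
  intro n hn
  have h1 := h.two_mul_qexp n
  have h2 : (qexp A B n : ℤ) < N := by exact_mod_cast hn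
  have h3 := abs_le.mp h.abs_right_le
  have h4 := h.pos
  rw [Set.mem_Icc]
  constructor
  · by_contra hc
    nlinarith [mul_nonneg (show 0 ≤ -n by lia) (show 0 ≤ A - B by lia),
      mul_nonneg (show 0 ≤ A - 1 by lia)
        (mul_nonneg (show 0 ≤ -n by lia) (show 0 ≤ -n - 1 by lia))]
  · by_contra hc
    nlinarith [mul_nonneg (show 0 ≤ n by lia) (show 0 ≤ A + B by lia),
      mul_nonneg (show 0 ≤ A - 1 by lia)
        (mul_nonneg (show 0 ≤ n by lia) (show 0 ≤ n - 1 by lia))]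

/-- The general term of `th`. -/
noncomputable def thTerm (s : ℤ⟦X⟧) (A B n : ℤ) : ℤ⟦X⟧ := sgn s n * X ^ qexp A B n

/-- The theta series `∑ s ^ n q ^ ((A n ^ 2 + B n) / 2)`. -/
noncomputable def th (s : ℤ⟦X⟧) (A B : ℤ) : ℤ⟦X⟧ := ∑' n, thTerm s A B n

theorem IsThetaPair.decays_thTerm {A B : ℤ} (h : IsThetaPair A B) (s : ℤ⟦X⟧) :
    Decays (thTerm s A B) :=
  h.decays.mul_left _

theorem expand_th {A B : ℤ} (h : IsThetaPair A B) {s : ℤ⟦X⟧} {k : ℕ} (hk : k ≠ 0)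
    (hs : expand k hk s = s) : expand k hk (th s A B) = th s (k * A) (k * B) := by
  have hk' : (0 : ℤ) < k := by exact_mod_cast Nat.pos_of_ne_zero hk
  have h' : IsThetaPair (k * A) (k * B) :=
    ⟨mul_pos hk' h.pos, by
      rw [abs_mul, abs_of_pos hk']
      exact mul_le_mul_of_nonneg_left h.abs_right_le hk'.le, by rw [← mul_sub]; exact h.two_dvd.mul_left _⟩
  rw [th, expand_tsum (h.decays_thTerm s).summable]
  refine tsum_congr fun n => ?_
  have h1 := h.two_mul_qexp n
  have h2 := h'.two_mul_qexp n
  have h3 : qexp (k * A) (k * B) n = k * qexp A B n := by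
    zify
    refine mul_left_cancel₀ (two_ne_zero (α := ℤ)) ?_
    linear_combination h2 - k * h1
  rw [thTerm, thTerm, map_mul, map_pow, expand_X, h3, pow_mul, sgn]
  split_ifs <;> simp [hs]

theorem thetaTerm_eq_thTerm {s : ℤ⟦X⟧} (hs : s * s = 1) {i j : ℕ}
    (h : IsThetaPair (i + j) (i - j)) (n : ℤ) :
    thetaTerm (s * X ^ i) (s * X ^ j) n = thTerm s (i + j) (i - j) n := by
  have h1 := h.two_mul_qexp n
  have h2 := two_mul_tri n
  have h3 := two_mul_tri (n - 1)
  have h4 : qexp (i + j) (i - j) n = i * tri n + j * tri (n - 1) := by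
    zify
    have : 2 * (qexp (i + j) (i - j) n : ℤ) = 2 * (i * tri n + j * tri (n - 1)) := by
      rw [h1]; linear_combination -(i : ℤ) * h2 - j * h3
    lia
  have h5 : s ^ (tri n + tri (n - 1)) = sgn s n := by
    rw [pow_eq_sgn hs]
    refine sgn_congr s ?_
    have : ((tri n + tri (n - 1) : ℕ) : ℤ) - n = n * (n - 1) := by
      push_cast
      linarith
    rw [this]
    exact Int.even_mul_pred_self n
  rw [thetaTerm, thTerm, h4, ← h5]
  ring

theorem th_eq_qPochInf {s : ℤ⟦X⟧} (hs : s * s = 1) {i j : ℕ} (hij : i + j ≠ 0) :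
    th s ((i + j : ℕ) : ℤ) (i - j) =
      qPochInf (-(s * X ^ i)) (X ^ (i + j)) * qPochInf (-(s * X ^ j)) (X ^ (i + j)) *
        E (i + j) := by
  have h : IsThetaPair ((i : ℤ) + j) (i - j) := by
    refine ⟨by lia, abs_le.mpr (by constructor <;> lia), ⟨j, by ring⟩⟩
  have hab : s * X ^ i * (s * X ^ j) = X ^ (i + j) := by
    linear_combination X ^ i * X ^ j * hs
  have ht : thetaTerm (s * X ^ i) (s * X ^ j) = thTerm s (i + j) (i - j) :=
    funext (thetaTerm_eq_thTerm hs h)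
  have := triple_product (a := s * X ^ i) (b := s * X ^ j)
    (by rw [hab]; exact dvd_pow_self X hij) (by rw [ht]; exact h.decays_thTerm s)
  rw [ht, hab] at this
  rw [th, Nat.cast_add, this, E]

theorem qPochInf_split (a : ℤ⟦X⟧) {q : ℤ⟦X⟧} (hq : X ∣ q) :
    qPochInf a q = qPochInf a (q ^ 2) * qPochInf (a * q) (q ^ 2) := by
  rw [qPochInf_eq_prod a hq two_ne_zero]
  simp [Finset.prod_range_succ]

theorem qPochInf_X_pow_split (i m : ℕ) (hm : m ≠ 0) :
    qPochInf (X ^ i) (X ^ m) =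
      qPochInf (X ^ i) (X ^ (2 * m)) * qPochInf (X ^ (i + m)) (X ^ (2 * m)) := by
  rw [qPochInf_split _ (dvd_pow_self X hm)]
  ring_nf

theorem qPochInf_X_pow_mul_neg (i m : ℕ) (hm : m ≠ 0) :
    qPochInf (X ^ i) (X ^ m) * qPochInf (-X ^ i) (X ^ m) =
      qPochInf (X ^ (2 * i)) (X ^ (2 * m)) := by
  rw [qPochInf_mul_qPochInf_neg _ (dvd_pow_self X hm)]
  ring_nf

theorem E_one : E 1 = qPochInf X X := by rw [E, pow_one]

theorem E_one_mul_qPochInf_neg : E 1 * qPochInf (-X) X = E 2 := by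
  have := qPochInf_X_pow_mul_neg 1 1 one_ne_zero
  simpa [E] using this

theorem E_one_eq : E 1 = qPochInf X (X ^ 2) * E 2 := by
  have := qPochInf_X_pow_split 1 1 one_ne_zero
  simpa [E] using this

/-- Gauss: `∑ (-1) ^ n q ^ (n ^ 2) = E_1 ^ 2 / E_2`. -/
theorem th_neg_one_two_zero : th (-1) 2 0 * E 2 = E 1 ^ 2 := by
  have h := th_eq_qPochInf (s := -1) (by ring) (i := 1) (j := 1) (by norm_num)
  norm_num at h
  rw [h, E_one_eq]
  ring

/-- Gauss: `∑ q ^ (n (n + 1) / 2) = E_2 ^ 2 / E_1`, summed over `n ≥ 0`. -/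
theorem th_one_one_one : th 1 1 1 * E 1 = 2 * E 2 ^ 2 := by
  have h := th_eq_qPochInf (s := 1) (by ring) (i := 1) (j := 0) (by norm_num)
  norm_num at h
  have h2 : qPochInf (-1) X = 2 * qPochInf (-X) X := by
    rw [qPochInf_eq_mul (-1) (dvd_refl X) 1]
    norm_num [qPoch]
  rw [h, h2]
  linear_combination 2 * (E 1 * qPochInf (-X) X + E 2) * E_one_mul_qPochInf_neg

/-- Jacobi's identity for `E_1 ^ 3`. -/
theorem tsum_int_mul_sgn_mul_X_pow_tri :
    ∑' j : ℤ, (j : ℤ⟦X⟧) * (sgn (-1) j * X ^ tri j) = E 1 ^ 3 := by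
  have hdec : Decays fun j : ℤ => (j : ℤ⟦X⟧) * (sgn (-1) j * X ^ tri j) :=
    (decays_X_pow_tri.mul_left _).mul_left _
  refine tendsto_nhds_unique (tendsto_sum_gaussBinom (dvd_refl X) hdec) ?_
  have hfin : ∀ n : ℕ, ∑ i ∈ Finset.range (n + (n + 1) + 1), gaussBinom (X : ℤ⟦X⟧) (n + (n + 1)) i *
      (((i - (n + 1 : ℕ) : ℤ) : ℤ⟦X⟧) * (sgn (-1) (i - (n + 1 : ℕ)) * X ^ tri (i - (n + 1 : ℕ)))) =
      qPoch X X n * qPoch X X n := by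
    intro n
    -- Dual numbers differentiate the finite triple product at z = 1, with 1 + ε for z and 1 - ε for
    -- its inverse: a = -X(1-ε) and b = -(1+ε), so that ab = X exactly.
    let ι : ℤ⟦X⟧ →+* DualNumber ℤ⟦X⟧ := TrivSqZeroExt.inlHom ℤ⟦X⟧ ℤ⟦X⟧
    let ε : DualNumber ℤ⟦X⟧ := DualNumber.eps
    have hε : ε * ε = 0 := DualNumber.eps_mul_eps
    have hone : ∀ k : ℕ, (1 + ε) ^ k = 1 + k * ε := by
      intro k
      induction k with
      | zero => simp
      | succ k ih => rw [pow_succ, ih]; push_cast; linear_combination (k : DualNumber ℤ⟦X⟧) * hε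
    have hone' : ∀ k : ℕ, (1 - ε) ^ k = 1 - k * ε := by
      intro k
      induction k with
      | zero => simp
      | succ k ih => rw [pow_succ, ih]; push_cast; linear_combination (k : DualNumber ℤ⟦X⟧) * hε
    have hab : -(ι X * (1 - ε)) * -(1 + ε) = ι X := by linear_combination -ι X * hε
    have hterm : ∀ j : ℤ, thetaTerm (-(ι X * (1 - ε))) (-(1 + ε)) j =
        ι (sgn (-1) j * X ^ tri j) * (1 - j * ε) := by
      intro j
      have h5 : (-1 : ℤ⟦X⟧) ^ (tri j + tri (j - 1)) = sgn (-1) j := by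
        rw [pow_eq_sgn (by ring)]
        refine sgn_congr _ ?_
        have h2 := two_mul_tri j
        have h3 := two_mul_tri (j - 1)
        have : ((tri j + tri (j - 1) : ℕ) : ℤ) - j = j * (j - 1) := by push_cast; linarith
        rw [this]
        exact Int.even_mul_pred_self j
      have hj : (tri j : DualNumber ℤ⟦X⟧) = tri (j - 1) + j := by
        exact_mod_cast congrArg (Int.cast : ℤ → DualNumber ℤ⟦X⟧) (tri_eq j)
      rw [← h5, thetaTerm, neg_pow, neg_pow (1 + ε), mul_pow, hone, hone', map_mul, map_pow,
        map_pow, map_neg, map_one, hj]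
      linear_combination (-1 : DualNumber ℤ⟦X⟧) ^ (tri j + tri (j - 1)) * ι X ^ tri j *
        (-(tri (j - 1) + j : DualNumber ℤ⟦X⟧) * tri (j - 1)) * hε
    have hpr : ∀ c : ℕ → ℤ⟦X⟧, ∀ d : ℕ → DualNumber ℤ⟦X⟧,
        (∏ k ∈ Finset.range n, (ι (c k) + d k * ε)) * ε =
          ι (∏ k ∈ Finset.range n, c k) * ε := by
      intro c d
      clear_value ε ι
      induction n with
      | zero => simp
      | succ n ih =>
        rw [Finset.prod_range_succ, Finset.prod_range_succ, map_mul]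
        linear_combination ι (c n) * ih +
          d n * (∏ k ∈ Finset.range n, (ι (c k) + d k * ε)) * hε
    have h := finite_triple_product (-(ι X * (1 - ε))) (-(1 + ε)) n (n + 1)
    simp only [hab, hterm, ← map_gaussBinom] at h
    rw [Finset.prod_range_succ'] at h
    -- The second product has one factor more than the first, and its factor of index 0 is -ε. It
    -- annihilates the ε-parts of all the others.
    have hl : (∏ k ∈ Finset.range n, (1 + -(ι X * (1 - ε)) * ι X ^ k)) *
        ((∏ k ∈ Finset.range n, (1 + -(1 + ε) * ι X ^ (k + 1))) * (1 + -(1 + ε) * ι X ^ 0)) =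
        -(ι (qPoch X X n * qPoch X X n) * ε) := by
      have h1 := hpr (fun k => 1 - X * X ^ k) fun k => ι X * ι X ^ k
      have h2 := hpr (fun k => 1 - X * X ^ k) fun k => -ι X ^ (k + 1)
      have e1 : ∏ k ∈ Finset.range n, (ι (1 - X * X ^ k) + ι X * ι X ^ k * ε) =
          ∏ k ∈ Finset.range n, (1 + -(ι X * (1 - ε)) * ι X ^ k) :=
        Finset.prod_congr rfl fun k _ => by
          rw [map_sub, map_mul, map_pow, map_one]; ring
      have e2 : ∏ k ∈ Finset.range n, (ι (1 - X * X ^ k) + -ι X ^ (k + 1) * ε) =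
          ∏ k ∈ Finset.range n, (1 + -(1 + ε) * ι X ^ (k + 1)) :=
        Finset.prod_congr rfl fun k _ => by
          rw [map_sub, map_mul, map_pow, map_one]; ring
      rw [e1] at h1
      rw [e2] at h2
      rw [map_mul]
      simp only [qPoch]
      linear_combination (-∏ k ∈ Finset.range n, (1 + -(ι X * (1 - ε)) * ι X ^ k)) * h2 -
        ι (∏ k ∈ Finset.range n, (1 - X * X ^ k)) * h1
    rw [hl] at h
    have hs := congrArg TrivSqZeroExt.snd h
    have hsnd : ∀ (c : ℤ⟦X⟧), (ι c * ε).snd = c := fun c => by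
      change (TrivSqZeroExt.inl c * TrivSqZeroExt.inr 1 : DualNumber ℤ⟦X⟧).snd = c
      rw [TrivSqZeroExt.inl_mul_inr, TrivSqZeroExt.snd_inr, smul_eq_mul, mul_one]
    have hsnd' : ∀ (g c : ℤ⟦X⟧) (j : ℤ),
        (ι g * (ι c * (1 - j * ε))).snd = -(g * (j * c)) := fun g c j => by
      have : ι g * (ι c * (1 - j * ε)) = ι (g * c) + -(ι (g * (j * c)) * ε) := by
        rw [map_mul, map_mul, map_mul, map_intCast]; ring
      rw [this, TrivSqZeroExt.snd_add, TrivSqZeroExt.snd_neg, hsnd,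
        show (ι (g * c)).snd = 0 from TrivSqZeroExt.snd_inl _ _, zero_add]
    rw [TrivSqZeroExt.snd_neg, hsnd, TrivSqZeroExt.snd_sum] at hs
    rw [Finset.sum_congr rfl fun i _ => hsnd' _ _ _, Finset.sum_neg_distrib, neg_inj] at hs
    exact hs.symm
  simp only [hfin]
  have := ((tendsto_qPoch X (dvd_refl X)).mul (tendsto_qPoch X (dvd_refl X))).mul_const
    (qPochInf (X : ℤ⟦X⟧) X)
  rwa [show qPochInf (X : ℤ⟦X⟧) X * qPochInf X X * qPochInf X X = E 1 ^ 3 by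
    rw [E_one]; ring] at this

/-! ### Reindexing double series -/

theorem Decays.tsum_prod {ι κ : Type*} {f : ι × κ → ℤ⟦X⟧} (hf : Decays f) :
    ∑' p, f p = ∑' i, ∑' j, f (i, j) :=
  hf.summable.tsum_prod' fun i => (hf.comp_injective (Prod.mk_right_injective i)).summable

theorem Decays.tsum_eq_tsum_antidiagonal {f : ℕ × ℕ → ℤ⟦X⟧} (hf : Decays f) :
    ∑' p, f p = ∑' n, ∑ p ∈ Finset.HasAntidiagonal.antidiagonal n, f p := by
  rw [← Finset.HasAntidiagonal.sigmaAntidiagonalEquivProd.tsum_eq f]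
  conv_rhs => congr; ext; rw [← Finset.sum_finset_coe, ← tsum_fintype (L := .unconditional _)]
  exact Summable.tsum_sigma'
    (f := fun c => f (Finset.HasAntidiagonal.sigmaAntidiagonalEquivProd c))
    (fun n => (hasSum_fintype _).summable)
    (hf.comp_injective Finset.HasAntidiagonal.sigmaAntidiagonalEquivProd.injective).summable

/-! ### Passing to the field of fractions -/

theorem algebraMap_inverse {u : ℤ⟦X⟧} (hu : IsUnit u) :
    algebraMap ℤ⟦X⟧ (FractionRing ℤ⟦X⟧) (Ring.inverse u) =
      (algebraMap ℤ⟦X⟧ (FractionRing ℤ⟦X⟧) u)⁻¹ := by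
  apply eq_inv_of_mul_eq_one_left
  rw [← map_mul, Ring.inverse_mul_cancel _ hu, map_one]

theorem algebraMap_quot (f : ℤ⟦X⟧) {u : ℤ⟦X⟧} (hu : IsUnit u) :
    algebraMap ℤ⟦X⟧ (FractionRing ℤ⟦X⟧) (quot f u) =
      algebraMap ℤ⟦X⟧ (FractionRing ℤ⟦X⟧) f / algebraMap ℤ⟦X⟧ (FractionRing ℤ⟦X⟧) u := by
  rw [quot, map_mul, algebraMap_inverse hu, div_eq_mul_inv]

theorem algebraMap_ne_zero_of_isUnit {u : ℤ⟦X⟧} (hu : IsUnit u) :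
    algebraMap ℤ⟦X⟧ (FractionRing ℤ⟦X⟧) u ≠ 0 :=
  (hu.map _).ne_zero

theorem one_sub_X_pow_ne_zero {n : ℕ} (hn : n ≠ 0) :
    1 - (algebraMap ℤ⟦X⟧ (FractionRing ℤ⟦X⟧) X) ^ n ≠ 0 := by
  have := algebraMap_ne_zero_of_isUnit (isUnit_one_sub_X_pow hn)
  rwa [map_sub, map_one, map_pow] at this

/-- The product `(q^2; q^2)_n`. -/
noncomputable abbrev evenPoch (n : ℕ) : ℤ⟦X⟧ := qPoch (X ^ 2) (X ^ 2) n

theorem isUnit_evenPoch (n : ℕ) : IsUnit (evenPoch n) :=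
  isUnit_qPoch_of_dvd (dvd_pow_self X two_ne_zero) _ _

theorem evenPoch_succ (n : ℕ) : evenPoch (n + 1) = evenPoch n * (1 - X ^ (2 * n + 2)) := by
  rw [evenPoch, qPoch_succ]
  ring

/-! ### The Bailey pair -/

/-- The sequence `(-1) ^ r q ^ (r ^ 2 + r) (1 + q ^ (2 r + 1)) / (1 - q ^ (2 r + 1))`. -/
noncomputable def baileyAlpha (r : ℕ) : ℤ⟦X⟧ :=
  quot ((-1) ^ r * X ^ (r * (r + 1)) * (1 + X ^ (2 * r + 1))) (1 - X ^ (2 * r + 1))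

/-- Certificate for `bailey_pair_sum`, with x, y, z standing for q, q^r, q^(n-r) and treated as
independent, so that only a rational identity remains. -/
theorem bailey_telescope {K : Type*} [Field K] (O m e x y z u w : K) (hu : u ≠ 0) (hw : w ≠ 0)
    (h1 : 1 - x * y ^ 2 ≠ 0) (h2 : 1 - x ^ 2 * z ^ 2 ≠ 0) (h3 : 1 - x ^ 4 * y ^ 4 * z ^ 2 ≠ 0)
    (h4 : 1 - x ^ 2 * y ^ 2 * z ^ 2 ≠ 0) :
    (O * (1 - x ^ 3 * y ^ 2 * z ^ 2)) ^ 2 * (m * (e * y ^ 2) * (1 + x * y ^ 2) / (1 - x * y ^ 2) *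
      ((u * (1 - x ^ 2 * z ^ 2)) * (w * (1 - x ^ 4 * y ^ 4 * z ^ 2)))⁻¹) -
      O ^ 2 * (m * (e * y ^ 2) * (1 + x * y ^ 2) / (1 - x * y ^ 2) * (u * w)⁻¹) =
    -(O ^ 2 * (x ^ 2 * y ^ 2 * z ^ 2) * (-m * (e * y ^ 2)) * (1 - x ^ 2 * y ^ 2) /
      ((1 - x ^ 2 * y ^ 2 * z ^ 2) * (u * (w * (1 - x ^ 4 * y ^ 4 * z ^ 2))))) -
    -(O ^ 2 * (x ^ 2 * y ^ 2 * z ^ 2) * (m * e) * (1 - y ^ 2) /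
      ((1 - x ^ 2 * y ^ 2 * z ^ 2) * (u * (1 - x ^ 2 * z ^ 2) * w))) := by
  field_simp
  ring

/-- Up to normalisation, `baileyAlpha` and 1/(q;q²)_{n+1}² form a Bailey pair in base q². The left
side is shown to be independent of `n`: the change of each summand from `n` to `n + 1` is a
difference `G (r + 1) - G r`. -/
theorem bailey_pair_sum (n : ℕ) :
    qPoch X (X ^ 2) (n + 1) ^ 2 * ∑ r ∈ Finset.range (n + 1),
      baileyAlpha r * Ring.inverse (evenPoch (n - r) * evenPoch (n + r + 1)) = 1 := by
  apply IsFractionRing.injective ℤ⟦X⟧ (FractionRing ℤ⟦X⟧)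
  set ι := algebraMap ℤ⟦X⟧ (FractionRing ℤ⟦X⟧)
  set x := ι X with hx
  have hP : ∀ n, ι (evenPoch n) ≠ 0 := fun n => algebraMap_ne_zero_of_isUnit (isUnit_evenPoch n)
  have hα : ∀ r, ι (baileyAlpha r) =
      (-1) ^ r * x ^ (r * (r + 1)) * (1 + x ^ (2 * r + 1)) / (1 - x ^ (2 * r + 1)) := fun r => by
    rw [baileyAlpha, algebraMap_quot _ (isUnit_one_sub_X_pow (by lia))]
    simp [ι, x]
  have hsucc : ∀ n, ι (evenPoch (n + 1)) = ι (evenPoch n) * (1 - x ^ (2 * n + 2)) := fun n => by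
    rw [evenPoch_succ, map_mul, map_sub, map_one, map_pow]
  have hO : ∀ n, ι (qPoch X (X ^ 2) (n + 1)) = ι (qPoch X (X ^ 2) n) * (1 - x ^ (2 * n + 1)) :=
    fun n => by
    rw [qPoch_succ, map_mul, map_sub, map_one, map_mul, map_pow, map_pow, ← hx]; ring
  have hinv : ∀ i j, ι (Ring.inverse (evenPoch i * evenPoch j)) =
      (ι (evenPoch i) * ι (evenPoch j))⁻¹ := fun i j => by
    rw [algebraMap_inverse ((isUnit_evenPoch i).mul (isUnit_evenPoch j)), map_mul]
  have hne : ∀ {k : ℕ}, k ≠ 0 → 1 - x ^ k ≠ 0 := fun hk => one_sub_X_pow_ne_zero hk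
  simp only [map_mul, map_pow, map_sum, map_one, hα, hinv]
  induction n with
  | zero =>
    have h1 := hne one_ne_zero
    have h2 := hne two_ne_zero
    have h3 : ι (qPoch X (X ^ 2) (0 + 1)) = 1 - x := by rw [hO]; simp [qPoch_zero]
    have h4 : ι (evenPoch 0) = 1 := by simp [evenPoch, qPoch_zero]
    rw [h3]
    simp only [zero_add, Finset.sum_range_one, hsucc, h4, Nat.sub_zero]
    norm_num
    rw [pow_one] at h1
    field_simp
    ring
  | succ n ih =>
    set G : ℕ → FractionRing ℤ⟦X⟧ := fun r =>
      -(ι (qPoch X (X ^ 2) (n + 1)) ^ 2 * x ^ (2 * n + 2) * ((-1) ^ r * x ^ (r * (r - 1))) *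
        (1 - x ^ (2 * r)) / ((1 - x ^ (2 * n + 2)) *
          (ι (evenPoch (n + 1 - r)) * ι (evenPoch (n + 1 + r))))) with hG
    have hstep : ∀ r ∈ Finset.range (n + 1),
        ι (qPoch X (X ^ 2) (n + 1 + 1)) ^ 2 *
          ((-1) ^ r * x ^ (r * (r + 1)) * (1 + x ^ (2 * r + 1)) / (1 - x ^ (2 * r + 1)) *
            (ι (evenPoch (n + 1 - r)) * ι (evenPoch (n + 1 + r + 1)))⁻¹) -
        ι (qPoch X (X ^ 2) (n + 1)) ^ 2 *
          ((-1) ^ r * x ^ (r * (r + 1)) * (1 + x ^ (2 * r + 1)) / (1 - x ^ (2 * r + 1)) *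
            (ι (evenPoch (n - r)) * ι (evenPoch (n + r + 1)))⁻¹) = G (r + 1) - G r := by
      intro r hr
      obtain ⟨k, rfl⟩ := Nat.exists_eq_add_of_le (Finset.mem_range_succ_iff.mp hr)
      have := bailey_telescope (ι (qPoch X (X ^ 2) (r + k + 1))) ((-1) ^ r) (x ^ (r * (r - 1)))
        x (x ^ r) (x ^ k) (ι (evenPoch k)) (ι (evenPoch (r + k + r + 1))) (hP _) (hP _)
        (by convert hne (k := 2 * r + 1) (by lia) using 2; ring)
        (by convert hne (k := 2 * k + 2) (by lia) using 2; ring)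
        (by convert hne (k := 2 * (r + k + r + 1) + 2) (by lia) using 2; ring)
        (by convert hne (k := 2 * (r + k) + 2) (by lia) using 2; ring)
      have e1 : r * (r + 1) = r * (r - 1) + 2 * r := by
        rcases r with _ | r
        · rfl
        · rw [Nat.add_sub_cancel]; ring
      simp only [hG]
      rw [show r + k + 1 - r = k + 1 by lia, show r + k - r = k by lia,
        show r + k + 1 - (r + 1) = k by lia, show r + k + 1 + (r + 1) = r + k + r + 1 + 1 by lia,
        show r + k + 1 + r + 1 = r + k + r + 1 + 1 by lia,
        show r + k + 1 + r = r + k + r + 1 by lia, Nat.add_sub_cancel, mul_comm (r + 1) r,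
        e1, hO (r + k + 1), hsucc (r + k + r + 1), hsucc k]
      convert this using 1
      · ring
      · ring
    -- The summand `r = n + 1` has no counterpart at level `n`; it cancels the upper boundary term
    -- of the telescoping sum.
    have hlast : ι (qPoch X (X ^ 2) (n + 1 + 1)) ^ 2 *
          ((-1) ^ (n + 1) * x ^ ((n + 1) * (n + 1 + 1)) * (1 + x ^ (2 * (n + 1) + 1)) /
            (1 - x ^ (2 * (n + 1) + 1)) *
            (ι (evenPoch (n + 1 - (n + 1))) * ι (evenPoch (n + 1 + (n + 1) + 1)))⁻¹) =
        -G (n + 1) := by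
      have h4 : ι (evenPoch 0) = 1 := by simp [evenPoch, qPoch_zero]
      have h5 := hP (n + 1 + (n + 1))
      have h6 := hne (k := 2 * (n + 1) + 1) (by lia)
      have h7 := hne (k := 2 * n + 2) (by lia)
      have h8 : 1 - x ^ (2 * (n + 1 + (n + 1)) + 2) =
        (1 - x ^ (2 * (n + 1) + 1)) * (1 + x ^ (2 * (n + 1) + 1)) := by ring
      have h9 : 1 + x ^ (2 * (n + 1) + 1) ≠ 0 := by
        have := hne (k := 2 * (n + 1 + (n + 1)) + 2) (by lia)
        rw [h8] at this
        exact right_ne_zero_of_mul this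
      simp only [hG]
      rw [Nat.sub_self, h4, hO (n + 1), hsucc (n + 1 + (n + 1)), h8, Nat.add_sub_cancel,
        show 2 * (n + 1) = 2 * n + 2 by ring,
        show (n + 1) * (n + 1 + 1) = (n + 1) * n + (2 * n + 2) by ring, pow_add x ((n + 1) * n)]
      rw [show 2 * (n + 1) = 2 * n + 2 by ring] at h6 h9
      field_simp
    have hG0 : G 0 = 0 := by simp [hG]
    rw [Finset.sum_range_succ, mul_add, hlast, Finset.mul_sum]
    rw [Finset.mul_sum] at ih
    have := Finset.sum_congr rfl hstep
    rw [Finset.sum_sub_distrib, ih, Finset.sum_range_sub, hG0] at this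
    linear_combination this

/-! ### A `q`-Gauss sum -/

/-- The summand `(-q; q)_{N + 2 s} q ^ s / ((q^2; q^2)_s (q^2; q^2)_{s + N + 1})`. -/
noncomputable def gaussTerm (N s : ℕ) : ℤ⟦X⟧ :=
  quot (qPoch (-X) X (N + 2 * s) * X ^ s) (evenPoch s * evenPoch (s + N + 1))

theorem X_pow_dvd_gaussTerm (N s : ℕ) : X ^ s ∣ gaussTerm N s :=
  (Dvd.intro_left _ rfl).mul_right _

theorem summable_gaussTerm (N : ℕ) : Summable (gaussTerm N) :=
  (decays_nat (X_pow_dvd_gaussTerm N)).summable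

/-- Certificate for `tsum_gaussTerm_succ`, with y = q^s and t = q^(N+1) as free variables. -/
theorem gauss_telescope {K : Type*} [Field K] (p x y t u w : K) (hu : u ≠ 0) (hw : w ≠ 0)
    (h1 : 1 - x ^ 2 * y ^ 2 ≠ 0) (h2 : 1 - x ^ 2 * t ^ 2 * y ^ 2 ≠ 0) :
    (1 + t) * (p * y / (u * w)) - (1 + x * t) *
      (p * (1 + t * y ^ 2) * y / (u * (w * (1 - x ^ 2 * t ^ 2 * y ^ 2)))) =
    -(t * (x * y) * (p * (1 + t * y ^ 2) * (1 + x * t * y ^ 2)) * (1 - x ^ 2 * y ^ 2) /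
      ((u * (1 - x ^ 2 * y ^ 2)) * (w * (1 - x ^ 2 * t ^ 2 * y ^ 2)))) -
    -(t * y * p * (1 - y ^ 2) / (u * w)) := by
  -- The two denominators are made opaque so that clearing fractions does not expand them.
  obtain ⟨c, hc⟩ : ∃ c, c = 1 - x ^ 2 * y ^ 2 := ⟨_, rfl⟩
  obtain ⟨d, hd⟩ : ∃ d, d = 1 - x ^ 2 * t ^ 2 * y ^ 2 := ⟨_, rfl⟩
  rw [← hc] at h1
  rw [← hd] at h2
  rw [← hc, ← hd]
  field_simp
  rw [hd]
  ring

theorem tsum_gaussTerm_succ (N : ℕ) :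
    (1 + X ^ (N + 1)) * ∑' s, gaussTerm N s = (1 + X ^ (N + 2)) * ∑' s, gaussTerm (N + 1) s := by
  set G : ℕ → ℤ⟦X⟧ := fun s => -quot (X ^ (N + 1) * X ^ s * qPoch (-X) X (N + 2 * s) *
    (1 - X ^ (2 * s))) (evenPoch s * evenPoch (s + N + 1)) with hG
  have hstep : ∀ s, (1 + X ^ (N + 1)) * gaussTerm N s - (1 + X ^ (N + 2)) * gaussTerm (N + 1) s =
      G (s + 1) - G s := by
    intro s
    apply IsFractionRing.injective ℤ⟦X⟧ (FractionRing ℤ⟦X⟧)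
    set ι := algebraMap ℤ⟦X⟧ (FractionRing ℤ⟦X⟧)
    set x := ι X with hx
    have hu : ∀ i j, IsUnit (evenPoch i * evenPoch j) := fun i j =>
      (isUnit_evenPoch i).mul (isUnit_evenPoch j)
    have hquot : ∀ f i j, ι (quot f (evenPoch i * evenPoch j)) =
        ι f / (ι (evenPoch i) * ι (evenPoch j)) := fun f i j => by
      rw [algebraMap_quot _ (hu i j), map_mul]
    have hne : ∀ {k : ℕ}, k ≠ 0 → 1 - x ^ k ≠ 0 := fun hk => one_sub_X_pow_ne_zero hk
    have := gauss_telescope (ι (qPoch (-X) X (N + 2 * s))) x (x ^ s) (x ^ (N + 1))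
      (ι (evenPoch s)) (ι (evenPoch (s + N + 1)))
      (algebraMap_ne_zero_of_isUnit (isUnit_evenPoch _))
      (algebraMap_ne_zero_of_isUnit (isUnit_evenPoch _))
      (by convert hne (k := 2 * s + 2) (by lia) using 2; ring)
      (by convert hne (k := 2 * (s + N + 1) + 2) (by lia) using 2; ring)
    simp only [hG, gaussTerm, map_sub, map_mul, map_neg, map_add, map_one, map_pow,
      hquot, ← hx]
    rw [show N + 1 + 2 * s = N + 2 * s + 1 by ring,
      show N + 2 * (s + 1) = N + 2 * s + 1 + 1 by ring,
      show s + (N + 1) + 1 = s + N + 1 + 1 by ring, show s + 1 + N + 1 = s + N + 1 + 1 by ring,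
      evenPoch_succ (s + N + 1), evenPoch_succ s, qPoch_succ (-X) X (N + 2 * s + 1),
      qPoch_succ (-X) X (N + 2 * s)]
    simp only [map_sub, map_mul, map_neg, map_one, map_pow, ← hx]
    convert this using 1 <;> ring
  have h0 : G 0 = 0 := by simp [hG, quot]
  have hd : ∀ s, X ^ s ∣ G s := fun s => by
    simp only [hG, dvd_neg]
    exact (((Dvd.intro_left _ rfl).mul_right _).mul_right _).mul_right _
  have := tsum_telescope h0 hd
  rw [← tsum_congr hstep, ((summable_gaussTerm N).mul_left _).tsum_sub
    ((summable_gaussTerm (N + 1)).mul_left _), (summable_gaussTerm N).tsum_mul_left,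
    (summable_gaussTerm (N + 1)).tsum_mul_left, sub_eq_zero] at this
  exact this

/-- Euler: `∑ q ^ s / (q^2; q^2)_s = 1 / (q; q^2)_∞`. -/
theorem qPochInf_mul_tsum_quot_evenPoch :
    qPochInf X (X ^ 2) * ∑' s, quot (X ^ s) (evenPoch s) = 1 := by
  -- Replacing q^s by q^((2k+1)s) gives W(k+1) = (1 - q^(2k+1)) W(k) and W(k) → 1, so W(0) is the
  -- reciprocal of the infinite product.
  set W : ℕ → ℤ⟦X⟧ := fun k => ∑' s, quot (X ^ ((2 * k + 1) * s)) (evenPoch s) with hW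
  have hdec : ∀ k, Decays fun s => quot (X ^ ((2 * k + 1) * s)) (evenPoch s) := fun k =>
    decays_nat fun s => (pow_dvd_pow X (by nlinarith)).mul_right _
  have hrec : ∀ k, W (k + 1) = (1 - X * (X ^ 2) ^ k) * W k := by
    intro k
    have h1 : W k - W (k + 1) = X ^ (2 * k + 1) * W k := by
      simp only [hW]
      rw [← (hdec k).summable.tsum_sub (hdec (k + 1)).summable,
        ← (hdec k).summable.tsum_mul_left]
      have hs : Summable fun s => quot (X ^ ((2 * k + 1) * s)) (evenPoch s) -
          quot (X ^ ((2 * (k + 1) + 1) * s)) (evenPoch s) :=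
        (hdec k).summable.sub (hdec (k + 1)).summable
      rw [hs.tsum_eq_zero_add]
      simp only [mul_zero, sub_self, zero_add]
      refine tsum_congr fun s => ?_
      have hu := isUnit_evenPoch (s + 1)
      rw [← hu.mul_left_inj, sub_mul, quot_mul_cancel _ hu, quot_mul_cancel _ hu, evenPoch_succ,
        ← mul_assoc, mul_assoc (X ^ (2 * k + 1)), quot_mul_cancel _ (isUnit_evenPoch s)]
      ring
    linear_combination -h1
  have hprod : ∀ k, W k = qPoch X (X ^ 2) k * W 0 := by
    intro k
    induction k with
    | zero => rw [qPoch_zero, one_mul]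
    | succ k ih => rw [hrec, ih, qPoch_succ]; ring
  have hlim : Tendsto W atTop (𝓝 1) := by
    have : Tendsto (fun k => W k - 1) atTop (𝓝 0) := tendsto_zero_of_X_pow_dvd fun k => by
      simp only [hW]
      rw [(hdec k).summable.tsum_eq_zero_add]
      have h0 : quot (X ^ ((2 * k + 1) * 0)) (evenPoch 0) = 1 := by
        simp [quot, evenPoch, qPoch_zero]
      rw [h0, add_sub_cancel_left]
      exact X_pow_dvd_tsum fun s => (pow_dvd_pow X (by nlinarith)).mul_right _
    simpa using this.add_const 1
  have hX : (X : ℤ⟦X⟧) ∣ X ^ 2 := dvd_pow_self X two_ne_zero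
  have h := tendsto_nhds_unique hlim
    (((tendsto_qPoch X hX).mul_const (W 0)).congr fun k => (hprod k).symm)
  rw [h]
  simp [hW]

/-- The quantity (1 + q^(N+1)) ∑ `gaussTerm N s` does not depend on N, so it may be evaluated as N →
∞. There the summand becomes (-q;q)_∞ q^s / ((q²;q²)_s E_2), and Euler's sum finishes. -/
theorem tsum_gaussTerm (N : ℕ) : (1 + X ^ (N + 1)) * (∑' s, gaussTerm N s) * E 1 ^ 2 = E 2 := by
  have hX : (X : ℤ⟦X⟧) ∣ X ^ 2 := dvd_pow_self X two_ne_zero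
  have hconst : ∀ N, (1 + X ^ (N + 1)) * ∑' s, gaussTerm N s =
      (1 + X ^ (0 + 1)) * ∑' s, gaussTerm 0 s := by
    intro N
    induction N with
    | zero => rfl
    | succ N ih => rw [← ih]; exact (tsum_gaussTerm_succ N).symm
  rw [hconst]
  set C := (1 + X ^ (0 + 1)) * ∑' s, gaussTerm 0 s with hC
  set W := ∑' s, quot (X ^ s) (evenPoch s) with hW
  have hWs : Summable fun s => quot (X ^ s) (evenPoch s) :=
    (decays_nat fun s => Dvd.intro _ rfl).summable
  have hE2 : E 2 = qPochInf (X ^ 2) (X ^ 2) := rfl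
  have hmain : C * E 2 = qPochInf (-X) X * W := by
    refine eq_of_forall_X_pow_dvd fun N => ?_
    have h1 : X ^ N ∣ (∑' s, gaussTerm N s) * E 2 - qPochInf (-X) X * W := by
      rw [← (summable_gaussTerm N).tsum_mul_right, ← hWs.tsum_mul_left,
        ← ((summable_gaussTerm N).mul_right _).tsum_sub (hWs.mul_left _)]
      refine X_pow_dvd_tsum fun s => ?_
      have hu := isUnit_evenPoch s
      have hv := isUnit_evenPoch (s + N + 1)
      rw [← (hu.mul hv).dvd_mul_right, sub_mul, mul_right_comm, gaussTerm,
        quot_mul_cancel _ (hu.mul hv), mul_assoc (qPochInf (-X) X), ← mul_assoc (quot _ _),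
        quot_mul_cancel _ hu]
      have e1 : X ^ N ∣ E 2 - evenPoch (s + N + 1) :=
        (pow_dvd_pow X (by lia)).trans (X_pow_dvd_qPochInf_sub_qPoch (X ^ 2) hX (s + N + 1))
      have e2 : X ^ N ∣ qPochInf (-X) X - qPoch (-X) X (N + 2 * s) :=
        (pow_dvd_pow X (by lia)).trans
          (X_pow_dvd_qPochInf_sub_qPoch (-X) (dvd_refl X) (N + 2 * s))
      have : qPoch (-X) X (N + 2 * s) * X ^ s * E 2 -
          qPochInf (-X) X * (X ^ s * evenPoch (s + N + 1)) =
          X ^ s * (qPoch (-X) X (N + 2 * s) * (E 2 - evenPoch (s + N + 1)) -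
            evenPoch (s + N + 1) * (qPochInf (-X) X - qPoch (-X) X (N + 2 * s))) := by ring
      rw [this]
      exact (dvd_sub (e1.mul_left _) (e2.mul_left _)).mul_left _
    have h2 : C * E 2 - qPochInf (-X) X * W = X ^ N * (X * (∑' s, gaussTerm N s) * E 2) +
        ((∑' s, gaussTerm N s) * E 2 - qPochInf (-X) X * W) := by
      rw [← hconst N]; ring
    rw [h2]
    exact dvd_add (Dvd.intro _ rfl) h1
  linear_combination E 1 * C * E_one_eq + E 1 * qPochInf X (X ^ 2) * hmain +
    E 1 * qPochInf (-X) X * qPochInf_mul_tsum_quot_evenPoch + E_one_mul_qPochInf_neg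

/-! ### `φ` as an Appell–Lerch sum -/

/-- The Appell–Lerch sum `∑ (-1) ^ r q ^ ((r + 1) ^ 2) / (1 - q ^ (2 r + 1))`. -/
noncomputable def lerchSum : ℤ⟦X⟧ :=
  ∑' r : ℕ, quot ((-1) ^ r * X ^ ((r + 1) ^ 2)) (1 - X ^ (2 * r + 1))

/-- One double series is summed in two ways: along r + s = n the Bailey pair returns the n-th term
of φ, and for fixed r the sum over s is `tsum_gaussTerm` with N = 2r, whose factor 1 + q^(2r+1)
cancels that of `baileyAlpha`. -/
theorem phi_mul_E_one_sq : phi * E 1 ^ 2 = E 2 * lerchSum := by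
  set f : ℕ × ℕ → ℤ⟦X⟧ := fun p => X ^ (p.1 + 1) * baileyAlpha p.1 * gaussTerm (2 * p.1) p.2
    with hf
  have hX : Decays fun n : ℕ => (X : ℤ⟦X⟧) ^ n := decays_nat fun n => dvd_refl _
  have hdec : Decays f := (hX.mul hX).of_dvd fun p =>
    mul_dvd_mul ((pow_dvd_pow X (Nat.le_succ _)).mul_right _) (X_pow_dvd_gaussTerm _ _)
  have h1 : ∑' p, f p = phi := by
    rw [hdec.tsum_eq_tsum_antidiagonal, phi]
    refine tsum_congr fun n => ?_
    have hu : IsUnit (qPoch X (X ^ 2) (n + 1) ^ 2) := (isUnit_qPoch (n + 1)).pow 2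
    rw [← hu.mul_left_inj, phiTerm, quot_mul_cancel _ hu]
    have hs : ∑ p ∈ Finset.HasAntidiagonal.antidiagonal n, f p = qPoch (-X) X (2 * n) * X ^ (n + 1) *
        ∑ r ∈ Finset.range (n + 1),
          baileyAlpha r * Ring.inverse (evenPoch (n - r) * evenPoch (n + r + 1)) := by
      rw [Finset.Nat.sum_antidiagonal_eq_sum_range_succ_mk, Finset.mul_sum]
      refine Finset.sum_congr rfl fun r hr => ?_
      obtain ⟨k, rfl⟩ := Nat.exists_eq_add_of_le (Finset.mem_range_succ_iff.mp hr)
      simp only [hf, gaussTerm, quot]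
      rw [show r + k - r = k by lia, show 2 * r + 2 * k = 2 * (r + k) by ring,
        show k + 2 * r + 1 = r + k + r + 1 by ring]
      ring
    rw [hs]
    linear_combination qPoch (-X) X (2 * n) * X ^ (n + 1) * bailey_pair_sum n
  have hL : Summable fun r : ℕ => quot ((-1) ^ r * X ^ ((r + 1) ^ 2)) (1 - X ^ (2 * r + 1)) :=
    (decays_nat fun r => ((pow_dvd_pow X (by nlinarith)).mul_left _).mul_right _).summable
  rw [← h1, hdec.tsum_prod, ← Summable.tsum_mul_right, lerchSum, ← hL.tsum_mul_left]
  · refine tsum_congr fun r => ?_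
    have hu := isUnit_one_sub_X_pow (n := 2 * r + 1) (by lia)
    simp only [hf]
    rw [(summable_gaussTerm (2 * r)).tsum_mul_left, ← hu.mul_left_inj, mul_assoc (E 2),
      quot_mul_cancel _ hu, ← tsum_gaussTerm (2 * r)]
    have h2 : baileyAlpha r * (1 - X ^ (2 * r + 1)) =
        (-1) ^ r * X ^ (r * (r + 1)) * (1 + X ^ (2 * r + 1)) := quot_mul_cancel _ hu
    linear_combination X ^ (r + 1) * (∑' s, gaussTerm (2 * r) s) * E 1 ^ 2 * h2
  · refine (decays_nat fun r => X_pow_dvd_tsum fun s => ?_).summable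
    exact ((pow_dvd_pow X (Nat.le_succ r)).mul_right _).mul_right _

/-! ### Decomposing double theta series along sublattices -/

theorem Decays.tsum_eq_sum {ι κ : Type*} {d : ℕ} {f : ι → ℤ⟦X⟧} (hf : Decays f)
    {e : Fin d × κ → ι} (he : Function.Bijective e) :
    ∑' i, f i = ∑ r : Fin d, ∑' k, f (e (r, k)) := by
  rw [← (Equiv.ofBijective e he).tsum_eq f]
  have := (hf.comp_injective he.injective).tsum_prod
  simp only [Function.comp_def] at this
  simp only [Equiv.ofBijective_apply, this, tsum_fintype]

theorem th_mul_th {A B A' B' : ℤ} (h : IsThetaPair A B) (h' : IsThetaPair A' B') (s s' : ℤ⟦X⟧) :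
    th s A B * th s' A' B' = ∑' p : ℤ × ℤ, thTerm s A B p.1 * thTerm s' A' B' p.2 :=
  (h.decays_thTerm s).tsum_mul_tsum (h'.decays_thTerm s')

theorem th_neg_right (s : ℤ⟦X⟧) (A B : ℤ) : th s A (-B) = th s A B := by
  rw [th, th, ← (Equiv.neg ℤ).tsum_eq]
  refine tsum_congr fun n => ?_
  simp only [thTerm, sgn, qexp, Equiv.neg_apply, even_neg, neg_sq, neg_mul_neg]

theorem sgn_neg_one_sub (m n : ℤ) : sgn (-1) (m - n) = sgn (-1) m * sgn (-1) n := by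
  rw [sgn_mul (by ring)]
  exact sgn_congr _ ⟨-n, by ring⟩

theorem sgn_neg_one_add (m n : ℤ) : sgn (-1) (m + n) = sgn (-1) m * sgn (-1) n :=
  (sgn_mul (by ring) m n).symm

theorem sgn_neg_one_one : sgn (-1) 1 = -1 := by simp [sgn]

theorem sgn_neg_one_neg (n : ℤ) : sgn (-1) (-n) = sgn (-1) n :=
  sgn_congr _ ⟨-n, by ring⟩

/-- A sublattice piece of a double theta series. -/
theorem tsum_thTerm_mul_thTerm {A₁ B₁ A₂ B₂ A₃ B₃ A₄ B₄ : ℤ} (h₁ : IsThetaPair A₁ B₁)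
    (h₂ : IsThetaPair A₂ B₂) (h₃ : IsThetaPair A₃ B₃) (h₄ : IsThetaPair A₄ B₄)
    {s₁ s₂ s₃ s₄ c : ℤ⟦X⟧} {k : ℕ} (u v : ℤ × ℤ → ℤ)
    (hs : ∀ m n, sgn s₁ (u (m, n)) * sgn s₂ (v (m, n)) = c * (sgn s₃ m * sgn s₄ n))
    (he : ∀ m n, A₁ * u (m, n) ^ 2 + B₁ * u (m, n) + (A₂ * v (m, n) ^ 2 + B₂ * v (m, n)) =
      2 * k + (A₃ * m ^ 2 + B₃ * m) + (A₄ * n ^ 2 + B₄ * n)) :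
    ∑' p : ℤ × ℤ, thTerm s₁ A₁ B₁ (u p) * thTerm s₂ A₂ B₂ (v p) =
      c * X ^ k * (th s₃ A₃ B₃ * th s₄ A₄ B₄) := by
  rw [th_mul_th h₃ h₄, ← ((h₃.decays_thTerm s₃).mul (h₄.decays_thTerm s₄)).summable.tsum_mul_left]
  refine tsum_congr fun ⟨m, n⟩ => ?_
  have e : qexp A₁ B₁ (u (m, n)) + qexp A₂ B₂ (v (m, n)) = k + qexp A₃ B₃ m + qexp A₄ B₄ n := by
    have e₁ := h₁.two_mul_qexp (u (m, n))
    have e₂ := h₂.two_mul_qexp (v (m, n))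
    have e₃ := h₃.two_mul_qexp m
    have e₄ := h₄.two_mul_qexp n
    have e₅ := he m n
    rw [← e₁, ← e₂, ← e₃, ← e₄] at e₅
    lia
  simp only [thTerm]
  calc _ = sgn s₁ (u (m, n)) * sgn s₂ (v (m, n)) *
        X ^ (qexp A₁ B₁ (u (m, n)) + qexp A₂ B₂ (v (m, n))) := by ring
    _ = _ := by rw [hs, e]; ring

/-- A residue class of a theta series. -/
theorem tsum_thTerm_comp {A₁ B₁ A₂ B₂ : ℤ} (h₁ : IsThetaPair A₁ B₁) (h₂ : IsThetaPair A₂ B₂)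
    {s₁ s₂ c : ℤ⟦X⟧} {k : ℕ} (u : ℤ → ℤ) (hs : ∀ m, sgn s₁ (u m) = c * sgn s₂ m)
    (he : ∀ m, A₁ * u m ^ 2 + B₁ * u m = 2 * k + (A₂ * m ^ 2 + B₂ * m)) :
    ∑' m : ℤ, thTerm s₁ A₁ B₁ (u m) = c * X ^ k * th s₂ A₂ B₂ := by
  rw [th, ← (h₂.decays_thTerm s₂).summable.tsum_mul_left]
  refine tsum_congr fun m => ?_
  have e : qexp A₁ B₁ (u m) = k + qexp A₂ B₂ m := by
    have e₁ := h₁.two_mul_qexp (u m)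
    have e₂ := h₂.two_mul_qexp m
    have e₅ := he m
    rw [← e₁, ← e₂] at e₅
    lia
  simp only [thTerm]
  rw [hs, e]
  ring

/-- The cosets of the index-two sublattice `m + n` even. -/
def evenOddSplit (p : Fin 2 × ℤ × ℤ) : ℤ × ℤ := (p.2.1 + p.2.2 - p.1.val, p.2.1 - p.2.2)

theorem bijective_evenOddSplit : Function.Bijective evenOddSplit := by
  constructor
  · rintro ⟨r, m, n⟩ ⟨r', m', n'⟩ h
    simp only [evenOddSplit, Prod.mk.injEq] at h
    fin_cases r <;> fin_cases r' <;> simp at h ⊢ <;> lia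
  · rintro ⟨a, b⟩
    rcases Int.emod_two_eq_zero_or_one (a + b) with h | h
    · exact ⟨(0, (a + b) / 2, (a - b) / 2), by simp [evenOddSplit]; lia⟩
    · exact ⟨(1, (a + b + 1) / 2, (a - b + 1) / 2), by simp [evenOddSplit]; lia⟩

theorem th_mul_th_eq_add {A B A' B' : ℤ} (h : IsThetaPair A B) (h' : IsThetaPair A' B')
    (s s' : ℤ⟦X⟧) : th s A B * th s' A' B' =
      ∑' p : ℤ × ℤ, thTerm s A B (p.1 + p.2) * thTerm s' A' B' (p.1 - p.2) +
      ∑' p : ℤ × ℤ, thTerm s A B (p.1 + p.2 - 1) * thTerm s' A' B' (p.1 - p.2) := by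
  rw [th_mul_th h h',
    ((h.decays_thTerm s).mul (h'.decays_thTerm s')).tsum_eq_sum bijective_evenOddSplit]
  simp [evenOddSplit]

theorem isThetaPair_of {A B : ℤ} (h : 0 < A ∧ |B| ≤ A ∧ 2 ∣ A - B) : IsThetaPair A B :=
  ⟨h.1, h.2.1, h.2.2⟩

/-- `φ(q)^2 = φ(q^2)^2 + 4 q ψ(q^4)^2`. -/
theorem th_one_two_zero_sq : th 1 2 0 ^ 2 = th 1 4 0 ^ 2 + X * th 1 4 4 ^ 2 := by
  have h := isThetaPair_of (A := 2) (B := 0) (by decide)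
  have h0 := isThetaPair_of (A := 4) (B := 0) (by decide)
  have h4 := isThetaPair_of (A := 4) (B := -4) (by decide)
  rw [sq, th_mul_th_eq_add h h,
    tsum_thTerm_mul_thTerm h h h0 h0 (c := 1) (k := 0) (s₃ := 1) (s₄ := 1) (fun p => p.1 + p.2)
      (fun p => p.1 - p.2) (by simp) (fun m n => by push_cast; ring),
    tsum_thTerm_mul_thTerm h h h4 h4 (c := 1) (k := 1) (s₃ := 1) (s₄ := 1)
      (fun p => p.1 + p.2 - 1) (fun p => p.1 - p.2) (by simp) (fun m n => by push_cast; ring),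
    th_neg_right]
  ring

theorem powerSeries_two_ne_zero : (2 : ℤ⟦X⟧) ≠ 0 := fun h => by
  have := congrArg (constantCoeff (R := ℤ)) h
  rw [map_ofNat, map_zero] at this
  exact two_ne_zero this

/-- The reflection n ↦ -1-n preserves the exponent and reverses the sign. -/
theorem th_neg_one_four_four : th (-1) 4 4 = 0 := by
  have h : th (-1) 4 4 = -th (-1) 4 4 := by
    conv_lhs => rw [th, ← ((Equiv.neg ℤ).trans (Equiv.subRight 1)).tsum_eq]
    rw [th, ← tsum_neg]
    refine tsum_congr fun n => ?_
    simp only [thTerm, Equiv.trans_apply, Equiv.neg_apply, Equiv.subRight_apply]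
    rw [sgn_neg_one_sub, sgn_neg_one_neg, sgn_neg_one_one]
    have : qexp 4 4 (-n - 1) = qexp 4 4 n := by
      rw [qexp, qexp]; congr 2; ring
    rw [this]
    ring
  have h2 : (2 : ℤ⟦X⟧) * th (-1) 4 4 = 0 := by linear_combination h
  exact (mul_eq_zero.mp h2).resolve_left powerSeries_two_ne_zero

/-- `φ(q) φ(-q) = φ(-q^2)^2`. -/
theorem th_one_two_zero_mul_th_neg_one : th 1 2 0 * th (-1) 2 0 = th (-1) 4 0 ^ 2 := by
  have h := isThetaPair_of (A := 2) (B := 0) (by decide)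
  have h0 := isThetaPair_of (A := 4) (B := 0) (by decide)
  have h4 := isThetaPair_of (A := 4) (B := -4) (by decide)
  rw [th_mul_th_eq_add h h,
    tsum_thTerm_mul_thTerm h h h0 h0 (c := 1) (k := 0) (s₃ := -1) (s₄ := -1) (fun p => p.1 + p.2)
      (fun p => p.1 - p.2) (fun m n => by simp [sgn_neg_one_sub])
      (fun m n => by push_cast; ring),
    tsum_thTerm_mul_thTerm h h h4 h4 (c := 1) (k := 1) (s₃ := -1) (s₄ := -1)
      (fun p => p.1 + p.2 - 1) (fun p => p.1 - p.2) (fun m n => by simp [sgn_neg_one_sub])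
      (fun m n => by push_cast; ring),
    th_neg_right, th_neg_one_four_four]
  ring

/-- `ψ(q)^2 = φ(q) ψ(q^2)`. -/
theorem th_one_one_one_sq : th 1 1 1 ^ 2 = 2 * (th 1 2 0 * th 1 2 2) := by
  have h := isThetaPair_of (A := 1) (B := 1) (by decide)
  have h0 := isThetaPair_of (A := 2) (B := 0) (by decide)
  have h2 := isThetaPair_of (A := 2) (B := 2) (by decide)
  have h2' := isThetaPair_of (A := 2) (B := -2) (by decide)
  rw [sq, th_mul_th_eq_add h h,
    tsum_thTerm_mul_thTerm h h h2 h0 (c := 1) (k := 0) (s₃ := 1) (s₄ := 1) (fun p => p.1 + p.2)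
      (fun p => p.1 - p.2) (by simp) (fun m n => by push_cast; ring),
    tsum_thTerm_mul_thTerm h h h0 h2' (c := 1) (k := 0) (s₃ := 1) (s₄ := 1)
      (fun p => p.1 + p.2 - 1) (fun p => p.1 - p.2) (by simp) (fun m n => by push_cast; ring),
    th_neg_right]
  ring

/-- `f(q, q^4) f(-q^2, -q^3) = f(-q^3, -q^7) f(-q^4, -q^6) + q f(-q, -q^9) f(-q^2, -q^8)`. -/
theorem th_five_three_mul_th_neg_five_one :
    th 1 5 3 * th (-1) 5 1 =
      th (-1) 10 4 * th (-1) 10 2 + X * (th (-1) 10 8 * th (-1) 10 6) := by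
  have h3 := isThetaPair_of (A := 5) (B := 3) (by decide)
  have h1 := isThetaPair_of (A := 5) (B := 1) (by decide)
  have k4 := isThetaPair_of (A := 10) (B := 4) (by decide)
  have k2 := isThetaPair_of (A := 10) (B := 2) (by decide)
  have k8 := isThetaPair_of (A := 10) (B := -8) (by decide)
  have k6 := isThetaPair_of (A := 10) (B := -6) (by decide)
  rw [th_mul_th_eq_add h3 h1,
    tsum_thTerm_mul_thTerm h3 h1 k4 k2 (c := 1) (k := 0) (s₃ := -1) (s₄ := -1)
      (fun p => p.1 + p.2) (fun p => p.1 - p.2) (fun m n => by simp [sgn_neg_one_sub])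
      (fun m n => by push_cast; ring),
    tsum_thTerm_mul_thTerm h3 h1 k6 k8 (c := 1) (k := 1) (s₃ := -1) (s₄ := -1)
      (fun p => p.1 + p.2 - 1) (fun p => p.1 - p.2) (fun m n => by simp [sgn_neg_one_sub])
      (fun m n => by push_cast; ring),
    th_neg_right, th_neg_right]
  ring

/-- `f(-q, -q^4) f(q^2, q^3) = f(-q^3, -q^7) f(-q^4, -q^6) - q f(-q, -q^9) f(-q^2, -q^8)`. -/
theorem th_neg_five_three_mul_th_five_one :
    th (-1) 5 3 * th 1 5 1 =
      th (-1) 10 4 * th (-1) 10 2 - X * (th (-1) 10 8 * th (-1) 10 6) := by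
  have h3 := isThetaPair_of (A := 5) (B := 3) (by decide)
  have h1 := isThetaPair_of (A := 5) (B := 1) (by decide)
  have k4 := isThetaPair_of (A := 10) (B := 4) (by decide)
  have k2 := isThetaPair_of (A := 10) (B := 2) (by decide)
  have k8 := isThetaPair_of (A := 10) (B := -8) (by decide)
  have k6 := isThetaPair_of (A := 10) (B := -6) (by decide)
  rw [th_mul_th_eq_add h3 h1,
    tsum_thTerm_mul_thTerm h3 h1 k4 k2 (c := 1) (k := 0) (s₃ := -1) (s₄ := -1)
      (fun p => p.1 + p.2) (fun p => p.1 - p.2) (fun m n => by simp [sgn_neg_one_add])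
      (fun m n => by push_cast; ring),
    tsum_thTerm_mul_thTerm h3 h1 k6 k8 (c := -1) (k := 1) (s₃ := -1) (s₄ := -1)
      (fun p => p.1 + p.2 - 1) (fun p => p.1 - p.2)
      (fun m n => by simp [sgn_neg_one_sub, sgn_neg_one_add, sgn_neg_one_one])
      (fun m n => by push_cast; ring),
    th_neg_right, th_neg_right]
  ring

/-- The cosets of the lattice of multiples of `2 - i` in `ℤ[i]`, with representatives `v`. -/
def gaussSplit (v : Fin 5 → ℤ × ℤ) (p : Fin 5 × ℤ × ℤ) : ℤ × ℤ :=
  (2 * p.2.1 + p.2.2 + (v p.1).1, 2 * p.2.2 - p.2.1 + (v p.1).2)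

/-- The lattice of points (2m+n, 2n-m) is the kernel of (a, b) ↦ a + 2b modulo 5, so `v` is a
transversal exactly when `a + 2b` takes each residue once on it. -/
theorem bijective_gaussSplit {v : Fin 5 → ℤ × ℤ}
    (hv : ∀ r s : Fin 5, 5 ∣ (v r).1 + 2 * (v r).2 - ((v s).1 + 2 * (v s).2) → r = s)
    (hv' : ∀ j : Fin 5, ∃ r : Fin 5, 5 ∣ (j.val : ℤ) - ((v r).1 + 2 * (v r).2)) :
    Function.Bijective (gaussSplit v) := by
  constructor
  · rintro ⟨r, m, n⟩ ⟨r', m', n'⟩ h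
    simp only [gaussSplit, Prod.mk.injEq] at h
    obtain rfl : r = r' := hv r r' ⟨n' - n, by linarith⟩
    simp only [Prod.mk.injEq, true_and]
    lia
  · rintro ⟨a, b⟩
    obtain ⟨r, hr⟩ := hv' ⟨((a + 2 * b) % 5).toNat, by lia⟩
    refine ⟨(r, (2 * (a - (v r).1) - (b - (v r).2)) / 5,
      (a - (v r).1 + 2 * (b - (v r).2)) / 5), ?_⟩
    simp only [gaussSplit, Prod.mk.injEq] at hr ⊢
    lia

theorem th_mul_th_eq_sum {A B A' B' : ℤ} (h : IsThetaPair A B) (h' : IsThetaPair A' B')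
    (s s' : ℤ⟦X⟧) (v : Fin 5 → ℤ × ℤ)
    (hv : ∀ r s : Fin 5, 5 ∣ (v r).1 + 2 * (v r).2 - ((v s).1 + 2 * (v s).2) → r = s)
    (hv' : ∀ j : Fin 5, ∃ r : Fin 5, 5 ∣ (j.val : ℤ) - ((v r).1 + 2 * (v r).2)) :
    th s A B * th s' A' B' = ∑ r, ∑' p : ℤ × ℤ, thTerm s A B (2 * p.1 + p.2 + (v r).1) *
      thTerm s' A' B' (2 * p.2 - p.1 + (v r).2) := by
  rw [th_mul_th h h',
    ((h.decays_thTerm s).mul (h'.decays_thTerm s')).tsum_eq_sum (bijective_gaussSplit hv hv')]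
  rfl

/-- `ψ(q)^2 = q ψ(q^5)^2 + f(q, q^4) f(q^2, q^3)`. -/
theorem th_one_one_one_sq_eq_add :
    th 1 1 1 ^ 2 = X * th 1 5 5 ^ 2 + 4 * (th 1 5 1 * th 1 5 3) := by
  have h := isThetaPair_of (A := 1) (B := 1) (by decide)
  have h5 := isThetaPair_of (A := 5) (B := 5) (by decide)
  have h1 := isThetaPair_of (A := 5) (B := 1) (by decide)
  have h3 := isThetaPair_of (A := 5) (B := 3) (by decide)
  have h1' := isThetaPair_of (A := 5) (B := -1) (by decide)
  have h3' := isThetaPair_of (A := 5) (B := -3) (by decide)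
  -- The representatives keep every linear coefficient within the bounds of `IsThetaPair`. The coset
  -- of (1, 0) gives the square; the other four give the same mixed product up to reflections.
  rw [sq, th_mul_th_eq_sum h h 1 1 ![(0, 0), (1, 0), (-1, -1), (0, -1), (-1, 0)]
    (by decide) (by decide), Fin.sum_univ_five,
    tsum_thTerm_mul_thTerm h h h1 h3 (c := 1) (k := 0) (s₃ := 1) (s₄ := 1)
      (fun p => 2 * p.1 + p.2 + _) (fun p => 2 * p.2 - p.1 + _) (by simp)
      (fun m n => by simp; ring),
    tsum_thTerm_mul_thTerm h h h5 h5 (c := 1) (k := 1) (s₃ := 1) (s₄ := 1)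
      (fun p => 2 * p.1 + p.2 + _) (fun p => 2 * p.2 - p.1 + _) (by simp)
      (fun m n => by simp; ring),
    tsum_thTerm_mul_thTerm h h h1' h3' (c := 1) (k := 0) (s₃ := 1) (s₄ := 1)
      (fun p => 2 * p.1 + p.2 + _) (fun p => 2 * p.2 - p.1 + _) (by simp)
      (fun m n => by simp; ring),
    tsum_thTerm_mul_thTerm h h h3 h1' (c := 1) (k := 0) (s₃ := 1) (s₄ := 1)
      (fun p => 2 * p.1 + p.2 + _) (fun p => 2 * p.2 - p.1 + _) (by simp)
      (fun m n => by simp; ring),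
    tsum_thTerm_mul_thTerm h h h3' h1 (c := 1) (k := 0) (s₃ := 1) (s₄ := 1)
      (fun p => 2 * p.1 + p.2 + _) (fun p => 2 * p.2 - p.1 + _) (by simp)
      (fun m n => by simp; ring)]
  simp only [th_neg_right]
  ring

theorem sgn_gaussSplit (m n x y : ℤ) : sgn (-1) (2 * m + n + x) * sgn (-1) (2 * n - m + y) =
    sgn (-1) (x + y) * (sgn (-1) m * sgn (-1) n) := by
  rw [sgn_mul (by ring), sgn_mul (by ring), sgn_mul (by ring)]
  exact sgn_congr _ ⟨n, by ring⟩

/-- `φ(-q)^2 = φ(-q^5)^2 - 4 q f(-q, -q^9) f(-q^3, -q^7)`. -/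
theorem th_neg_one_two_zero_sq :
    th (-1) 2 0 ^ 2 = th (-1) 10 0 ^ 2 - 4 * X * (th (-1) 10 4 * th (-1) 10 8) := by
  have h := isThetaPair_of (A := 2) (B := 0) (by decide)
  have h0 := isThetaPair_of (A := 10) (B := 0) (by decide)
  have h4 := isThetaPair_of (A := 10) (B := 4) (by decide)
  have h8 := isThetaPair_of (A := 10) (B := 8) (by decide)
  have h4' := isThetaPair_of (A := 10) (B := -4) (by decide)
  have h8' := isThetaPair_of (A := 10) (B := -8) (by decide)
  -- The four Gaussian units represent the nonzero cosets, and up to reflections all four contribute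
  -- the same product with sign -1.
  rw [sq, th_mul_th_eq_sum h h (-1) (-1) ![(0, 0), (0, -1), (0, 1), (1, 0), (-1, 0)]
    (by decide) (by decide), Fin.sum_univ_five,
    tsum_thTerm_mul_thTerm h h h0 h0 (c := 1) (k := 0) (s₃ := -1) (s₄ := -1)
      (fun p => 2 * p.1 + p.2 + _) (fun p => 2 * p.2 - p.1 + _)
      (fun m n => by rw [sgn_gaussSplit]; simp [sgn]) (fun m n => by simp; ring),
    tsum_thTerm_mul_thTerm h h h4 h8' (c := -1) (k := 1) (s₃ := -1) (s₄ := -1)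
      (fun p => 2 * p.1 + p.2 + _) (fun p => 2 * p.2 - p.1 + _)
      (fun m n => by rw [sgn_gaussSplit]; simp [sgn]) (fun m n => by simp; ring),
    tsum_thTerm_mul_thTerm h h h4' h8 (c := -1) (k := 1) (s₃ := -1) (s₄ := -1)
      (fun p => 2 * p.1 + p.2 + _) (fun p => 2 * p.2 - p.1 + _)
      (fun m n => by rw [sgn_gaussSplit]; simp [sgn]) (fun m n => by simp; ring),
    tsum_thTerm_mul_thTerm h h h8 h4 (c := -1) (k := 1) (s₃ := -1) (s₄ := -1)
      (fun p => 2 * p.1 + p.2 + _) (fun p => 2 * p.2 - p.1 + _)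
      (fun m n => by rw [sgn_gaussSplit]; simp [sgn]) (fun m n => by simp; ring),
    tsum_thTerm_mul_thTerm h h h8' h4' (c := -1) (k := 1) (s₃ := -1) (s₄ := -1)
      (fun p => 2 * p.1 + p.2 + _) (fun p => 2 * p.2 - p.1 + _)
      (fun m n => by rw [sgn_gaussSplit]; simp [sgn]) (fun m n => by simp; ring)]
  simp only [th_neg_right]
  ring

/-! ### Five-dissections -/

/-- Residue classes modulo five. -/
def fiveSplit (p : Fin 5 × ℤ) : ℤ := 5 * p.2 + ((![0, 1, -1, 2, -2] : Fin 5 → ℤ) p.1)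

theorem bijective_fiveSplit : Function.Bijective fiveSplit := by
  constructor
  · rintro ⟨r, m⟩ ⟨r', m'⟩ h
    simp only [fiveSplit] at h
    fin_cases r <;> fin_cases r' <;> simp at h ⊢ <;> lia
  · intro a
    have h : a % 5 = 0 ∨ a % 5 = 1 ∨ a % 5 = 2 ∨ a % 5 = 3 ∨ a % 5 = 4 := by lia
    rcases h with h | h | h | h | h
    · exact ⟨(0, a / 5), by simp [fiveSplit]; lia⟩
    · exact ⟨(1, a / 5), by simp [fiveSplit]; lia⟩
    · exact ⟨(3, a / 5), by simp [fiveSplit]; lia⟩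
    · exact ⟨(4, a / 5 + 1), by simp [fiveSplit]; lia⟩
    · exact ⟨(2, a / 5 + 1), by simp [fiveSplit]; lia⟩

theorem th_eq_sum {A B : ℤ} (h : IsThetaPair A B) (s : ℤ⟦X⟧) :
    th s A B = ∑' m, thTerm s A B (5 * m) + ∑' m, thTerm s A B (5 * m + 1) +
      ∑' m, thTerm s A B (5 * m + -1) + ∑' m, thTerm s A B (5 * m + 2) +
      ∑' m, thTerm s A B (5 * m + -2) := by
  rw [th, (h.decays_thTerm s).tsum_eq_sum bijective_fiveSplit, Fin.sum_univ_five]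
  simp [fiveSplit]

theorem sgn_five_mul_add (m r : ℤ) : sgn (-1) (5 * m + r) = sgn (-1) r * sgn (-1) m := by
  rw [sgn_mul (by ring)]
  exact sgn_congr _ ⟨2 * m, by ring⟩

theorem th_neg_one_two_zero_dissection : th (-1) 2 0 =
    th (-1) 50 0 - 2 * X * th (-1) 50 20 + 2 * X ^ 4 * th (-1) 50 40 := by
  have h := isThetaPair_of (A := 2) (B := 0) (by decide)
  have h0 := isThetaPair_of (A := 50) (B := 0) (by decide)
  have h2 := isThetaPair_of (A := 50) (B := 20) (by decide)
  have h4 := isThetaPair_of (A := 50) (B := 40) (by decide)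
  have h2' := isThetaPair_of (A := 50) (B := -20) (by decide)
  have h4' := isThetaPair_of (A := 50) (B := -40) (by decide)
  rw [th_eq_sum h,
    tsum_thTerm_comp h h0 (c := 1) (k := 0) (s₂ := -1) (fun m => 5 * m)
      (fun m => by simpa using sgn_five_mul_add m 0) (fun m => by push_cast; ring),
    tsum_thTerm_comp h h2 (c := -1) (k := 1) (s₂ := -1) (fun m => 5 * m + 1)
      (fun m => by rw [sgn_five_mul_add]; simp [sgn]) (fun m => by push_cast; ring),
    tsum_thTerm_comp h h2' (c := -1) (k := 1) (s₂ := -1) (fun m => 5 * m + -1)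
      (fun m => by rw [sgn_five_mul_add]; simp [sgn]) (fun m => by push_cast; ring),
    tsum_thTerm_comp h h4 (c := 1) (k := 4) (s₂ := -1) (fun m => 5 * m + 2)
      (fun m => by rw [sgn_five_mul_add]; simp [sgn]) (fun m => by push_cast; ring),
    tsum_thTerm_comp h h4' (c := 1) (k := 4) (s₂ := -1) (fun m => 5 * m + -2)
      (fun m => by rw [sgn_five_mul_add]; simp [sgn]) (fun m => by push_cast; ring)]
  simp only [th_neg_right]
  ring

/-- Under n ↦ -1-n the class 0 is exchanged with -1 and 1 with -2, while 2 is fixed. Hence two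
components are doubled and the third is not. -/
theorem th_one_one_one_dissection : th 1 1 1 =
    2 * th 1 25 5 + 2 * X * th 1 25 15 + X ^ 3 * th 1 25 25 := by
  have h := isThetaPair_of (A := 1) (B := 1) (by decide)
  have h1 := isThetaPair_of (A := 25) (B := 5) (by decide)
  have h3 := isThetaPair_of (A := 25) (B := 15) (by decide)
  have h5 := isThetaPair_of (A := 25) (B := 25) (by decide)
  have h1' := isThetaPair_of (A := 25) (B := -5) (by decide)
  have h3' := isThetaPair_of (A := 25) (B := -15) (by decide)
  rw [th_eq_sum h,
    tsum_thTerm_comp h h1 (c := 1) (k := 0) (s₂ := 1) (fun m => 5 * m)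
      (by simp) (fun m => by push_cast; ring),
    tsum_thTerm_comp h h3 (c := 1) (k := 1) (s₂ := 1) (fun m => 5 * m + 1)
      (by simp) (fun m => by push_cast; ring),
    tsum_thTerm_comp h h1' (c := 1) (k := 0) (s₂ := 1) (fun m => 5 * m + -1)
      (by simp) (fun m => by push_cast; ring),
    tsum_thTerm_comp h h5 (c := 1) (k := 3) (s₂ := 1) (fun m => 5 * m + 2)
      (by simp) (fun m => by push_cast; ring),
    tsum_thTerm_comp h h3' (c := 1) (k := 1) (s₂ := 1) (fun m => 5 * m + -2)
      (by simp) (fun m => by push_cast; ring)]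
  simp only [th_neg_right]
  ring

/-! ### The coefficients of the Appell–Lerch sum in an auxiliary variable -/

/-- The sequence `d_0 = 0`, `d_{n + 1} = 1 - q ^ n d_n`. -/
noncomputable def lerchSeq : ℕ → ℤ⟦X⟧
  | 0 => 0
  | n + 1 => 1 - X ^ n * lerchSeq n

/-- The extension of `lerchSeq` to `ℤ` with `d_{-n} = q ^ n d_n`. -/
noncomputable def lerchCoeff : ℤ → ℤ⟦X⟧
  | Int.ofNat n => lerchSeq n
  | Int.negSucc n => X ^ (n + 1) * lerchSeq (n + 1)

theorem lerchCoeff_natCast (n : ℕ) : lerchCoeff n = lerchSeq n := rfl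

theorem lerchCoeff_neg_natCast (n : ℕ) : lerchCoeff (-n) = X ^ n * lerchSeq n := by
  cases n with
  | zero => simp [show lerchCoeff 0 = lerchSeq 0 from rfl, lerchSeq]
  | succ n => rfl

/-- The extension to negative indices is the one for which 1 - d_{k+1} = q^k d_k holds for all
integers k. Natural `p`, `r` with `r - p = k` replace the possibly negative power of q; the same
device recurs below. -/
theorem X_pow_mul_one_sub_lerchCoeff {p r : ℕ} {k : ℤ} (h : (r : ℤ) = p + k) :
    X ^ p * (1 - lerchCoeff (k + 1)) = X ^ r * lerchCoeff k := by
  obtain ⟨n, rfl | rfl⟩ : ∃ n : ℕ, k = n ∨ k = -((n + 1 : ℕ) : ℤ) := by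
    rcases le_or_gt 0 k with hk | hk
    · exact ⟨k.toNat, by lia⟩
    · exact ⟨(-k - 1).toNat, by lia⟩
  · obtain rfl : r = p + n := by lia
    rw [← Nat.cast_succ, lerchCoeff_natCast, lerchCoeff_natCast, lerchSeq]
    ring
  · obtain rfl : p = r + (n + 1) := by lia
    rw [show -((n + 1 : ℕ) : ℤ) + 1 = -(n : ℤ) by push_cast; ring, lerchCoeff_neg_natCast,
      lerchCoeff_neg_natCast, lerchSeq]
    ring

/-- The coefficients `(-1) ^ m q ^ (m (m - 1) / 2)`. -/
noncomputable def altTri (m : ℤ) : ℤ⟦X⟧ := sgn (-1) m * X ^ tri (-m)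

theorem decays_altTri : Decays altTri :=
  (decays_X_pow_tri.comp_injective neg_injective).mul_left _

theorem X_pow_mul_altTri_succ {p r : ℕ} {m : ℤ} (h : (r : ℤ) = p + m) :
    X ^ p * altTri (m + 1) = -(X ^ r * altTri m) := by
  have h1 := tri_eq (-m)
  rw [show -m - 1 = -(m + 1) by ring] at h1
  have h2 : p + tri (-(m + 1)) = r + tri (-m) := by lia
  rw [altTri, altTri, sgn_neg_one_succ]
  calc _ = -sgn (-1) m * X ^ (p + tri (-(m + 1))) := by ring
    _ = _ := by rw [h2]; ring

/-- The theta function with coefficients `altTri` vanishes at z = 1: the reflection m ↦ 1-m reverses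
the signs. -/
theorem tsum_altTri : ∑' m, altTri m = 0 := by
  have h : ∑' m, altTri m = -∑' m, altTri m := by
    conv_lhs => rw [← ((Equiv.neg ℤ).trans (Equiv.addRight 1)).tsum_eq]
    rw [← tsum_neg]
    refine tsum_congr fun m => ?_
    simp only [altTri, Equiv.trans_apply, Equiv.neg_apply, Equiv.coe_addRight, sgn_neg_one_succ,
      sgn_neg_one_neg]
    have h1 := two_mul_tri (-(-m + 1))
    have h2 := two_mul_tri (-m)
    have : tri (-(-m + 1)) = tri (-m) := by
      zify; linarith
    rw [this]
    ring
  have h2 : (2 : ℤ⟦X⟧) * ∑' m, altTri m = 0 := by linear_combination h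
  exact (mul_eq_zero.mp h2).resolve_left powerSeries_two_ne_zero

theorem decays_altTri_mul (f : ℤ → ℤ⟦X⟧) : Decays fun m => altTri m * f m :=
  decays_altTri.mul_right f

/-- The convolution of `altTri` and `lerchCoeff`. -/
noncomputable def lerchConv (s : ℤ) : ℤ⟦X⟧ := ∑' m, altTri m * lerchCoeff (s - m)

theorem X_pow_mul_cancel {p : ℕ} {f g : ℤ⟦X⟧} (h : X ^ p * f = X ^ p * g) : f = g :=
  mul_left_cancel₀ (pow_ne_zero p X_ne_zero) h

theorem altTri_succ_mul {p r : ℕ} {s m : ℤ} (h : (r : ℤ) = p + s) :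
    X ^ p * (altTri (m + 1) * (1 - lerchCoeff (s - m + 1))) =
      -(X ^ r * (altTri m * lerchCoeff (s - m))) := by
  have h1 := X_pow_mul_altTri_succ (p := m.natAbs) (r := (m.natAbs + m).toNat) (m := m) (by lia)
  have h2 := X_pow_mul_one_sub_lerchCoeff (p := (s - m).natAbs)
    (r := ((s - m).natAbs + (s - m)).toNat) (k := s - m) (by lia)
  -- Multiplying by these powers turns both functional equations into identities of power series;
  -- the common power is cancelled afterwards.
  refine X_pow_mul_cancel (p := m.natAbs + (s - m).natAbs) ?_
  have e : p + (m.natAbs + m).toNat + ((s - m).natAbs + (s - m)).toNat =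
      m.natAbs + (s - m).natAbs + r := by lia
  calc _ = X ^ p * (X ^ m.natAbs * altTri (m + 1)) *
        (X ^ (s - m).natAbs * (1 - lerchCoeff (s - m + 1))) := by ring
    _ = -(X ^ (p + (m.natAbs + m).toNat + ((s - m).natAbs + (s - m)).toNat) *
        (altTri m * lerchCoeff (s - m))) := by rw [h1, h2]; ring
    _ = _ := by rw [e]; ring

/-- Shifting the summation index and applying both functional equations gives c_{s+2} = ∑ `altTri` +
q^s c_s, and the first sum is zero. -/
theorem X_pow_mul_lerchConv_add_two {p r : ℕ} {s : ℤ} (h : (r : ℤ) = p + s) :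
    X ^ p * lerchConv (s + 2) = X ^ r * lerchConv s := by
  have h1 : lerchConv (s + 2) =
      ∑' m, (altTri (m + 1) - altTri (m + 1) * (1 - lerchCoeff (s - m + 1))) := by
    rw [lerchConv, ← (Equiv.addRight (1 : ℤ)).tsum_eq]
    refine tsum_congr fun m => ?_
    rw [Equiv.coe_addRight, show s + 2 - (m + 1) = s - m + 1 by ring]
    ring
  have hd : Decays fun m => altTri (m + 1) := decays_altTri.comp_injective (add_left_injective 1)
  have h2 : ∑' m, altTri (m + 1) = 0 := by
    rw [← tsum_altTri, ← (Equiv.addRight (1 : ℤ)).tsum_eq altTri]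
    rfl
  rw [h1, hd.summable.tsum_sub (hd.mul_right _).summable, h2, zero_sub, mul_neg,
    ← (hd.mul_right _).summable.tsum_mul_left, lerchConv,
    ← (decays_altTri_mul _).summable.tsum_mul_left, ← tsum_neg]
  exact tsum_congr fun m => by rw [altTri_succ_mul h, neg_neg]

theorem lerchConv_two_mul (n : ℤ) : lerchConv (2 * n) = X ^ qexp 2 (-2) n * lerchConv 0 := by
  have hp := isThetaPair_of (A := 2) (B := -2) (by decide)
  induction n using Int.induction_on with
  | zero => simp [qexp]
  | succ n ih =>
    have h := X_pow_mul_lerchConv_add_two (p := 0) (r := 2 * n) (s := 2 * n) (by push_cast; ring)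
    have e : 2 * n + qexp 2 (-2) n = qexp 2 (-2) (n + 1) := by
      have h1 := hp.two_mul_qexp n
      have h2 := hp.two_mul_qexp (n + 1)
      zify; linarith
    rw [mul_add, mul_one, ← e, pow_add, mul_assoc, ← ih, ← h]
    simp
  | pred n ih =>
    have h := X_pow_mul_lerchConv_add_two (p := 2 * (n + 1)) (r := 0) (s := 2 * (-n - 1))
      (by push_cast; ring)
    have e : qexp 2 (-2) (-n - 1) = 2 * (n + 1) + qexp 2 (-2) (-n) := by
      have h1 := hp.two_mul_qexp (-n)
      have h2 := hp.two_mul_qexp (-n - 1)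
      zify; linarith
    rw [show 2 * (-(n : ℤ) - 1) + 2 = 2 * -n by ring, ih] at h
    rw [e, pow_add, mul_assoc, h]
    simp

theorem lerchConv_two_mul_add_one (n : ℤ) :
    lerchConv (2 * n + 1) = X ^ qexp 2 0 n * lerchConv 1 := by
  have hp := isThetaPair_of (A := 2) (B := 0) (by decide)
  induction n using Int.induction_on with
  | zero => simp [qexp]
  | succ n ih =>
    have h := X_pow_mul_lerchConv_add_two (p := 0) (r := 2 * n + 1) (s := 2 * n + 1)
      (by push_cast; ring)
    have e : 2 * n + 1 + qexp 2 0 n = qexp 2 0 (n + 1) := by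
      have h1 := hp.two_mul_qexp n
      have h2 := hp.two_mul_qexp (n + 1)
      zify; linarith
    rw [show 2 * ((n : ℤ) + 1) + 1 = 2 * n + 1 + 2 by ring, ← e, pow_add, mul_assoc, ← ih, ← h]
    simp
  | pred n ih =>
    have h := X_pow_mul_lerchConv_add_two (p := 2 * n + 1) (r := 0) (s := 2 * (-n - 1) + 1)
      (by push_cast; ring)
    have e : qexp 2 0 (-n - 1) = 2 * n + 1 + qexp 2 0 (-n) := by
      have h1 := hp.two_mul_qexp (-n)
      have h2 := hp.two_mul_qexp (-n - 1)
      zify; linarith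
    rw [show 2 * (-(n : ℤ) - 1) + 1 + 2 = 2 * -n + 1 by ring, ih] at h
    rw [e, pow_add, mul_assoc, h]
    simp

/-- The cosets of `2 ℤ` in `ℤ`. -/
def twoSplit (p : Fin 2 × ℤ) : ℤ := 2 * p.2 + p.1.val

theorem bijective_twoSplit : Function.Bijective twoSplit := by
  constructor
  · rintro ⟨r, m⟩ ⟨r', m'⟩ h
    simp only [twoSplit] at h
    fin_cases r <;> fin_cases r' <;> simp at h ⊢ <;> lia
  · intro a
    rcases Int.emod_two_eq_zero_or_one a with h | h
    · exact ⟨(0, a / 2), by simp [twoSplit]; lia⟩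
    · exact ⟨(1, a / 2), by simp [twoSplit]; lia⟩

theorem Decays.tsum_eq_even_add_odd {f : ℤ → ℤ⟦X⟧} (hf : Decays f) :
    ∑' s, f s = ∑' n, f (2 * n) + ∑' n, f (2 * n + 1) := by
  rw [hf.tsum_eq_sum bijective_twoSplit, Fin.sum_univ_two]
  simp [twoSplit]

/-- A convolution of decaying bilateral sequences. -/
theorem Decays.tsum_mul_tsum_eq_conv {f g : ℤ → ℤ⟦X⟧} (hf : Decays f) (hg : Decays g) :
    (∑' m, f m) * ∑' k, g k = ∑' s, ∑' m, f m * g (s - m) := by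
  have hi : Function.Injective fun p : ℤ × ℤ => (p.2, p.1 - p.2) := by
    rintro ⟨s, m⟩ ⟨s', m'⟩ h
    simp only [Prod.mk.injEq] at h ⊢
    lia
  have hs : Function.Surjective fun p : ℤ × ℤ => (p.2, p.1 - p.2) := fun ⟨m, k⟩ =>
    ⟨(m + k, m), by simp⟩
  have hb : Function.Bijective fun p : ℤ × ℤ => (p.2, p.1 - p.2) := ⟨hi, hs⟩
  rw [hf.tsum_mul_tsum hg, ← (Equiv.ofBijective _ hb).tsum_eq]
  have := ((hf.mul hg).comp_injective hi).tsum_prod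
  simp only [Function.comp_def] at this
  simp only [Equiv.ofBijective_apply, this]

theorem Decays.conv {f g : ℤ → ℤ⟦X⟧} (hf : Decays f) (hg : Decays g) :
    Decays fun s => ∑' m, f m * g (s - m) := by
  intro n
  have hi : Function.Injective fun p : ℤ × ℤ => (p.2, p.1 - p.2) := by
    rintro ⟨s, m⟩ ⟨s', m'⟩ h
    simp only [Prod.mk.injEq] at h ⊢
    lia
  refine ((((hf.mul hg).comp_injective hi) n).image Prod.fst).subset fun s hs => ?_
  by_contra hc
  refine hs (X_pow_dvd_tsum fun m => ?_)
  by_contra hm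
  exact hc ⟨(s, m), hm, rfl⟩

theorem lerchConv_decays : Decays lerchConv := by
  have hp := isThetaPair_of (A := 2) (B := -2) (by decide)
  have hq := isThetaPair_of (A := 2) (B := 0) (by decide)
  intro n
  refine (((hp.decays n).image fun k => 2 * k).union
    ((hq.decays n).image fun k => 2 * k + 1)).subset fun s hs => ?_
  rcases Int.even_or_odd' s with ⟨k, rfl | rfl⟩
  · refine Or.inl ⟨k, fun h => hs ?_, rfl⟩
    rw [lerchConv_two_mul]
    exact h.mul_right _
  · refine Or.inr ⟨k, fun h => hs ?_, rfl⟩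
    rw [lerchConv_two_mul_add_one]
    exact h.mul_right _

theorem tsum_lerchConv :
    ∑' s, lerchConv s = th 1 2 2 * lerchConv 0 + th 1 2 0 * lerchConv 1 := by
  have hp := isThetaPair_of (A := 2) (B := -2) (by decide)
  have hq := isThetaPair_of (A := 2) (B := 0) (by decide)
  rw [lerchConv_decays.tsum_eq_even_add_odd, ← th_neg_right, th, th,
    ← (hp.decays_thTerm 1).summable.tsum_mul_right,
    ← (hq.decays_thTerm 1).summable.tsum_mul_right]
  simp only [lerchConv_two_mul, lerchConv_two_mul_add_one, thTerm, sgn_one, one_mul]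

/-! ### Evaluation of the sum of the convolution -/

/-- Tails of the vanishing sum `∑ altTri m`, regularised so as to decay. -/
noncomputable def altTail (p : ℤ × ℤ) : ℤ⟦X⟧ :=
  if p.1 ≤ 0 then (if p.2 < p.1 then altTri p.2 else 0)
  else (if p.1 ≤ p.2 then -altTri p.2 else 0)

theorem decays_altTail : Decays altTail := by
  intro n
  obtain ⟨B, hB⟩ := ((decays_altTri n).image Int.natAbs).bddAbove
  refine ((Set.finite_Icc (-B : ℤ) B).prod (Set.finite_Icc (-B : ℤ) B)).subset ?_
  rintro ⟨s, m⟩ h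
  have hm : ¬ X ^ n ∣ altTri m := fun hd => h (by
    simp only [altTail]
    split_ifs
    · exact hd
    · exact dvd_zero _
    · exact hd.neg_right
    · exact dvd_zero _)
  have hb : m.natAbs ≤ B := hB ⟨m, hm, rfl⟩
  have hs : altTail (s, m) ≠ 0 := fun h0 => h (h0 ▸ dvd_zero _)
  simp only [altTail] at hs
  simp only [Set.mem_prod, Set.mem_Icc]
  split_ifs at hs
  · lia
  · exact absurd rfl hs
  · lia
  · exact absurd rfl hs

theorem tsum_altTail_right (s : ℤ) :
    ∑' m, altTail (s, m) = ∑' m, if m < s then altTri m else 0 := by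
  have hd : Decays fun m => if m < s then altTri m else 0 :=
    decays_altTri.of_dvd fun m => by split_ifs; exacts [dvd_refl _, dvd_zero _]
  rcases le_or_gt s 0 with hs | hs
  · exact tsum_congr fun m => by simp [altTail, hs]
  · have key : ∑' m, altTail (s, m) =
        (∑' m, if m < s then altTri m else 0) - ∑' m, altTri m := by
      rw [← hd.summable.tsum_sub decays_altTri.summable]
      refine tsum_congr fun m => ?_
      simp only [altTail, not_le.mpr hs, if_false]
      rcases le_or_gt s m with h | h
      · simp [h, not_lt.mpr h]
      · simp [h, not_le.mpr h]
    rw [key, tsum_altTri, sub_zero]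

/-- For fixed m, exactly |m| values of s contribute: 1 ≤ s ≤ m with a minus sign, or m < s ≤ 0 with
a plus sign. -/
theorem tsum_altTail_left (m : ℤ) : ∑' s, altTail (s, m) = -m * altTri m := by
  rcases le_or_gt 0 m with hm | hm
  · rw [tsum_eq_sum (s := Finset.Icc 1 m)]
    · rw [Finset.sum_congr rfl (g := fun _ => -altTri m), Finset.sum_const, Int.card_Icc]
      · obtain ⟨n, rfl⟩ := Int.eq_ofNat_of_zero_le hm
        simp
      · intro s hs
        rw [Finset.mem_Icc] at hs
        simp only [altTail]
        rw [if_neg (by lia), if_pos (by lia)]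
    · intro s hs
      rw [Finset.mem_Icc] at hs
      simp only [altTail]
      split_ifs <;> first | rfl | lia
  · rw [tsum_eq_sum (s := Finset.Ioc m 0)]
    · rw [Finset.sum_congr rfl (g := fun _ => altTri m), Finset.sum_const, Int.card_Ioc]
      · obtain ⟨n, hn⟩ := Int.eq_ofNat_of_zero_le (a := -m) (by lia)
        obtain rfl : m = -(n : ℤ) := by lia
        simp
      · intro s hs
        rw [Finset.mem_Ioc] at hs
        simp only [altTail]
        rw [if_pos (by lia), if_pos (by lia)]
    · intro s hs
      rw [Finset.mem_Ioc] at hs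
      simp only [altTail]
      split_ifs <;> first | rfl | lia

/-- Interchanging the sums, legitimate after the regularisation by `altTail`, produces -∑ m `altTri
m`, the derivative in Jacobi's identity. -/
theorem tsum_tsum_altTri : ∑' s : ℤ, ∑' m, (if m < s then altTri m else 0) = E 1 ^ 3 := by
  simp only [← tsum_altTail_right]
  rw [← decays_altTail.tsum_prod, ← (Equiv.prodComm ℤ ℤ).tsum_eq]
  have h := (decays_altTail.comp_injective (Equiv.prodComm ℤ ℤ).injective).tsum_prod
  simp only [Function.comp_def, Equiv.prodComm_apply, Prod.swap_prod_mk] at h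
  simp only [Equiv.prodComm_apply]
  rw [h]
  simp only [tsum_altTail_left]
  rw [← (Equiv.neg ℤ).tsum_eq, ← tsum_int_mul_sgn_mul_X_pow_tri]
  refine tsum_congr fun j => ?_
  simp [altTri, sgn_neg_one_neg]

/-- `lerchCoeff k`, with its limit `1` for large `k` removed. -/
noncomputable def lerchRest (k : ℤ) : ℤ⟦X⟧ := lerchCoeff k - if 1 ≤ k then 1 else 0

theorem decays_lerchRest : Decays lerchRest := by
  have h : ∀ k : ℤ, X ^ (k.natAbs - 1) ∣ lerchRest k := by
    intro k
    obtain ⟨n, rfl | rfl⟩ : ∃ n : ℕ, k = (n + 1 : ℕ) ∨ k = -(n : ℤ) := by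
      rcases le_or_gt 1 k with hk | hk
      · exact ⟨(k - 1).toNat, by lia⟩
      · exact ⟨(-k).toNat, by lia⟩
    · rw [lerchRest, if_pos (by lia), lerchCoeff_natCast, lerchSeq, Int.natAbs_natCast,
        Nat.add_sub_cancel, sub_sub_cancel_left]
      exact (Dvd.intro _ rfl).neg_right
    · rw [lerchRest, if_neg (by lia), lerchCoeff_neg_natCast, sub_zero, Int.natAbs_neg,
        Int.natAbs_natCast]
      exact (pow_dvd_pow X (Nat.sub_le n 1)).mul_right _
  refine Decays.of_dvd (decays_X_pow fun n => ?_) h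
  refine (Set.finite_Icc (-(n + 1) : ℤ) (n + 1)).subset fun k hk => ?_
  have hk' : k.natAbs - 1 < n := hk
  rw [Set.mem_Icc]
  lia

/-- Subtracting the limit 1 from `lerchCoeff` at positive indices removes the pole at z = 1. The
decaying remainder is multiplied by ∑ `altTri` = 0, and the pole part contributes the double sum
above. -/
theorem tsum_lerchConv_eq : ∑' s, lerchConv s = E 1 ^ 3 := by
  have h1 : ∀ s, lerchConv s = ∑' m, altTri m * lerchRest (s - m) +
      ∑' m, if m < s then altTri m else 0 := by
    intro s
    have hd : Decays fun m => if m < s then altTri m else 0 :=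
      decays_altTri.of_dvd fun m => by split_ifs; exacts [dvd_refl _, dvd_zero _]
    rw [← (decays_altTri_mul _).summable.tsum_add hd.summable, lerchConv]
    refine tsum_congr fun m => ?_
    rw [lerchRest]
    rcases lt_or_ge m s with h | h
    · rw [if_pos h, if_pos (by lia)]; ring
    · rw [if_neg (not_lt.mpr h), if_neg (by lia)]; ring
  have h2 : Decays fun s => ∑' m, altTri m * lerchRest (s - m) :=
    decays_altTri.conv decays_lerchRest
  have h3 : Summable fun s : ℤ => ∑' m, if m < s then altTri m else 0 := by
    have := lerchConv_decays.summable.sub h2.summable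
    refine this.congr fun s => ?_
    rw [h1 s]; ring
  rw [tsum_congr h1, h2.summable.tsum_add h3, tsum_tsum_altTri,
    ← decays_altTri.tsum_mul_tsum_eq_conv decays_lerchRest, tsum_altTri]
  ring

theorem lerchConv_zero_one : th 1 2 2 * lerchConv 0 + th 1 2 0 * lerchConv 1 = E 1 ^ 3 := by
  rw [← tsum_lerchConv, tsum_lerchConv_eq]

/-! ### The product of the Appell–Lerch sum and a theta function -/

/-- These are the terms with r + m = N once each 1/(1 - q^(2r+1)) is expanded in powers indexed by
m. Raising r by one multiplies a term by -q^(2N+3), which is the recurrence of `lerchSeq` at q². -/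
theorem sum_antidiagonal_eq_lerchSeq (N : ℕ) :
    ∑ p ∈ Finset.HasAntidiagonal.antidiagonal N,
      (-1 : ℤ⟦X⟧) ^ p.1 * X ^ ((p.1 + 1) ^ 2 + p.2 * (2 * p.1 + 1)) =
      X ^ (N + 1) * expand 2 two_ne_zero (lerchSeq (N + 1)) := by
  induction N with
  | zero => simp [lerchSeq]
  | succ N ih =>
    rw [Finset.Nat.sum_antidiagonal_succ]
    have h : ∀ p ∈ Finset.HasAntidiagonal.antidiagonal N,
        (-1 : ℤ⟦X⟧) ^ (p.1 + 1) * X ^ ((p.1 + 1 + 1) ^ 2 + p.2 * (2 * (p.1 + 1) + 1)) =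
        -X ^ (2 * N + 3) * ((-1 : ℤ⟦X⟧) ^ p.1 * X ^ ((p.1 + 1) ^ 2 + p.2 * (2 * p.1 + 1))) := by
      rintro ⟨r, m⟩ hp
      rw [Finset.HasAntidiagonal.mem_antidiagonal] at hp
      dsimp only at hp ⊢
      rw [← hp]
      ring
    rw [Finset.sum_congr rfl h, ← Finset.mul_sum, ih, lerchSeq.eq_def (N + 1 + 1)]
    simp only [map_sub, map_mul, map_pow, expand_X, map_one]
    ring

theorem lerchSum_eq_tsum :
    lerchSum = ∑' N : ℕ, X ^ (N + 1) * expand 2 two_ne_zero (lerchSeq (N + 1)) := by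
  set f : ℕ × ℕ → ℤ⟦X⟧ := fun p => (-1 : ℤ⟦X⟧) ^ p.1 * X ^ ((p.1 + 1) ^ 2 + p.2 * (2 * p.1 + 1))
    with hf
  have hX : Decays fun n : ℕ => (X : ℤ⟦X⟧) ^ n := decays_nat fun n => dvd_refl _
  have hdec : Decays f := (hX.mul hX).of_dvd fun p => by
    rw [← pow_add]
    exact (pow_dvd_pow X (by nlinarith)).mul_left _
  simp only [← sum_antidiagonal_eq_lerchSeq]
  rw [← hdec.tsum_eq_tsum_antidiagonal, hdec.tsum_prod, lerchSum]
  refine tsum_congr fun r => ?_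
  have hu := isUnit_one_sub_X_pow (n := 2 * r + 1) (by lia)
  have h0 : constantCoeff ((X : ℤ⟦X⟧) ^ (2 * r + 1)) = 0 := by simp
  have hg := WithPiTopology.tsum_pow_mul_one_sub_of_constantCoeff_eq_zero h0
  have hs := WithPiTopology.summable_pow_of_constantCoeff_eq_zero h0
  rw [← hu.mul_left_inj, quot_mul_cancel _ hu]
  have : ∀ m, f (r, m) = (-1) ^ r * X ^ ((r + 1) ^ 2) * (X ^ (2 * r + 1)) ^ m := fun m => by
    simp only [hf]; ring
  rw [tsum_congr this, hs.tsum_mul_left, mul_assoc, hg, mul_one]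

/-- The bilateral coefficients of twice the Appell–Lerch sum. -/
noncomputable def lerchBi (k : ℤ) : ℤ⟦X⟧ :=
  X ^ k.natAbs * expand 2 two_ne_zero (lerchSeq k.natAbs)

theorem decays_lerchBi : Decays lerchBi := by
  refine Decays.mul_right (decays_X_pow fun n => ?_) _
  refine (Set.finite_Icc (-n : ℤ) n).subset fun k hk => ?_
  have hk' : k.natAbs < n := hk
  rw [Set.mem_Icc]
  lia

theorem tsum_lerchBi : ∑' k, lerchBi k = 2 * lerchSum := by
  have h1 : Summable fun n : ℕ => lerchBi n :=
    (decays_lerchBi.comp_injective Nat.cast_injective).summable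
  have h2 : Summable fun n : ℕ => lerchBi (-(n + 1 : ℤ)) :=
    (decays_lerchBi.comp_injective (e := fun n : ℕ => -(n + 1 : ℤ))
      fun m n h => by simpa using h).summable
  rw [tsum_of_nat_of_neg_add_one h1 h2, h1.tsum_eq_zero_add, lerchSum_eq_tsum]
  have h3 : lerchBi ((0 : ℕ) : ℤ) = 0 := by simp [lerchBi, lerchSeq]
  have h4 : ∀ n : ℕ, lerchBi (-(n + 1 : ℤ)) =
      X ^ (n + 1) * expand 2 two_ne_zero (lerchSeq (n + 1)) := fun n => by
    rw [lerchBi, Int.natAbs_neg, show ((n : ℤ) + 1).natAbs = n + 1 by lia]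
  have h5 : ∀ n : ℕ, lerchBi ((n + 1 : ℕ) : ℤ) =
      X ^ (n + 1) * expand 2 two_ne_zero (lerchSeq (n + 1)) := fun n => by
    rw [lerchBi, Int.natAbs_natCast]
  rw [h3, tsum_congr h4, tsum_congr h5]
  ring

theorem X_pow_mul_lerchBi {p r : ℕ} {k : ℤ} (h : (r : ℤ) = p + k) :
    X ^ p * lerchBi k = X ^ r * expand 2 two_ne_zero (lerchCoeff k) := by
  obtain ⟨n, rfl | rfl⟩ : ∃ n : ℕ, k = n ∨ k = -(n : ℤ) := ⟨k.natAbs, by lia⟩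
  · obtain rfl : r = p + n := by lia
    rw [lerchBi, Int.natAbs_natCast, lerchCoeff_natCast]
    ring
  · obtain rfl : p = r + n := by lia
    rw [lerchBi, Int.natAbs_neg, Int.natAbs_natCast, lerchCoeff_neg_natCast, map_mul, map_pow,
      expand_X]
    ring

theorem X_pow_mul_thTerm {p r : ℕ} {m : ℤ} (h : (r : ℤ) = p + m) :
    X ^ p * thTerm (-1) 2 0 m = X ^ r * expand 2 two_ne_zero (altTri m) := by
  have h1 := two_mul_tri (-m)
  have h2 := (isThetaPair_of (A := 2) (B := 0) (by decide)).two_mul_qexp m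
  have e : p + qexp 2 0 m = r + 2 * tri (-m) := by
    zify; linarith
  have hs : expand 2 two_ne_zero (sgn (-1) m) = sgn (-1) m := by
    rw [sgn]; split_ifs <;> simp
  rw [altTri, thTerm, map_mul, map_pow, expand_X, hs]
  calc _ = sgn (-1) m * X ^ (p + qexp 2 0 m) := by ring
    _ = _ := by rw [e]; ring

/-- Both factors are q^index times a sequence evaluated at q², so their convolution at s is q^s
c_s(q²). -/
theorem X_pow_mul_conv {p r : ℕ} {s : ℤ} (h : (r : ℤ) = p + s) :
    X ^ p * ∑' m, thTerm (-1) 2 0 m * lerchBi (s - m) =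
      X ^ r * expand 2 two_ne_zero (lerchConv s) := by
  have hd := (isThetaPair_of (A := 2) (B := 0) (by decide)).decays_thTerm (-1)
  have hs := (decays_altTri_mul fun m => lerchCoeff (s - m)).summable
  have hs' : Summable fun m => expand 2 two_ne_zero (altTri m * lerchCoeff (s - m)) :=
    hs.map (expand 2 two_ne_zero) (continuous_expand 2 two_ne_zero)
  rw [lerchConv, expand_tsum hs, ← hs'.tsum_mul_left, ← (hd.mul_right _).summable.tsum_mul_left]
  refine tsum_congr fun m => ?_
  have h1 := X_pow_mul_thTerm (p := m.natAbs) (r := (m.natAbs + m).toNat) (m := m) (by lia)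
  have h2 := X_pow_mul_lerchBi (p := (s - m).natAbs)
    (r := ((s - m).natAbs + (s - m)).toNat) (k := s - m) (by lia)
  refine X_pow_mul_cancel (p := m.natAbs + (s - m).natAbs) ?_
  have e : p + (m.natAbs + m).toNat + ((s - m).natAbs + (s - m)).toNat =
      m.natAbs + (s - m).natAbs + r := by lia
  calc _ = X ^ p * (X ^ m.natAbs * thTerm (-1) 2 0 m) *
        (X ^ (s - m).natAbs * lerchBi (s - m)) := by ring
    _ = X ^ (p + (m.natAbs + m).toNat + ((s - m).natAbs + (s - m)).toNat) *
        expand 2 two_ne_zero (altTri m * lerchCoeff (s - m)) := by rw [h1, h2, map_mul]; ring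
    _ = _ := by rw [e]; ring

theorem th_mul_lerchSum : th (-1) 2 0 * (2 * lerchSum) =
    th 1 4 0 * expand 2 two_ne_zero (lerchConv 0) +
      X * th 1 4 4 * expand 2 two_ne_zero (lerchConv 1) := by
  have hd := (isThetaPair_of (A := 2) (B := 0) (by decide)).decays_thTerm (-1)
  have h0 := isThetaPair_of (A := 4) (B := 0) (by decide)
  have h4 := isThetaPair_of (A := 4) (B := 4) (by decide)
  rw [← tsum_lerchBi, th, hd.tsum_mul_tsum_eq_conv decays_lerchBi,
    (hd.conv decays_lerchBi).tsum_eq_even_add_odd, th, th,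
    ← (h0.decays_thTerm 1).summable.tsum_mul_right,
    ← (h4.decays_thTerm 1).summable.tsum_mul_left,
    ← ((h4.decays_thTerm 1).mul_left fun _ => X).summable.tsum_mul_right]
  congr 1
  · refine tsum_congr fun n => ?_
    have h := X_pow_mul_conv (p := (2 * n).natAbs) (r := ((2 * n).natAbs + 2 * n).toNat)
      (s := 2 * n) (by lia)
    rw [lerchConv_two_mul, map_mul, map_pow, expand_X] at h
    refine X_pow_mul_cancel (h.trans ?_)
    have h1 := h0.two_mul_qexp n
    have h2 := (isThetaPair_of (A := 2) (B := -2) (by decide)).two_mul_qexp n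
    have e : ((2 * n).natAbs + 2 * n).toNat + 2 * qexp 2 (-2) n =
        (2 * n).natAbs + qexp 4 0 n := by
      have : (((2 * n).natAbs + 2 * n).toNat : ℤ) = (2 * n).natAbs + 2 * n := by lia
      zify at this ⊢
      linarith
    rw [thTerm, sgn_one, one_mul, ← mul_assoc, ← mul_assoc, ← pow_mul, ← pow_add, ← pow_add, e]
  · refine tsum_congr fun n => ?_
    have h := X_pow_mul_conv (p := (2 * n + 1).natAbs)
      (r := ((2 * n + 1).natAbs + (2 * n + 1)).toNat) (s := 2 * n + 1) (by lia)
    rw [lerchConv_two_mul_add_one, map_mul, map_pow, expand_X] at h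
    refine X_pow_mul_cancel (h.trans ?_)
    have h1 := h4.two_mul_qexp n
    have h2 := (isThetaPair_of (A := 2) (B := 0) (by decide)).two_mul_qexp n
    have e : ((2 * n + 1).natAbs + (2 * n + 1)).toNat + 2 * qexp 2 0 n =
        (2 * n + 1).natAbs + (1 + qexp 4 4 n) := by
      have : (((2 * n + 1).natAbs + (2 * n + 1)).toNat : ℤ) =
        (2 * n + 1).natAbs + (2 * n + 1) := by lia
      zify at this ⊢
      linarith
    rw [thTerm, sgn_one, one_mul, ← mul_assoc, ← mul_assoc, ← pow_mul, ← pow_add, ← pow_succ',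
      ← pow_add, e, add_comm 1]

/-! ### The odd part of `φ` -/

/-- `∑ a(2 n + 1) q ^ n = E_2 ^ 8 / E_1 ^ 7`. -/
theorem sect_two_one_phi : sect 2 1 phi * E 1 ^ 7 = E 2 ^ 8 := by
  set S := expand (R := ℤ) 2 two_ne_zero with hS
  have hp := isThetaPair_of (A := 2) (B := 0) (by decide)
  have hq := isThetaPair_of (A := 2) (B := 2) (by decide)
  have e1 : th 1 4 0 = S (th 1 2 0) := (expand_th hp two_ne_zero (by simp)).symm
  have e2 : th (-1) 4 0 = S (th (-1) 2 0) := (expand_th hp two_ne_zero (by simp)).symm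
  have e3 : th 1 4 4 = S (th 1 2 2) := (expand_th hq two_ne_zero (by simp)).symm
  have h1 := th_mul_lerchSum
  have h2 := th_one_two_zero_sq
  have h3 := th_one_two_zero_mul_th_neg_one
  rw [e1, e3, ← hS] at h1
  rw [e1, e3] at h2
  rw [e2] at h3
  have hE1 : E 1 ≠ 0 := (isUnit_E one_pos).ne_zero
  have hE2 : E 2 ≠ 0 := (isUnit_E two_pos).ne_zero
  have h4 : phi * th (-1) 2 0 = lerchSum := by
    refine mul_right_cancel₀ hE2 ?_
    linear_combination phi * th_neg_one_two_zero + phi_mul_E_one_sq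
  -- Multiplying by θ(q)² makes the left coefficient even, since θ(q)θ(-q) = θ(-q²)². On the right
  -- it splits into even and odd parts, and the cross terms combine into `lerchConv_zero_one`.
  have h5 : S (2 * th (-1) 2 0 ^ 4) * phi =
      S (th 1 2 2 * th 1 2 0 * E 1 ^ 3) * X ^ 1 + S (th 1 2 0 ^ 3 * lerchConv 0) * X ^ 0 +
        S (th 1 2 2 ^ 3 * lerchConv 1) * X ^ 2 := by
    rw [← lerchConv_zero_one]
    simp only [map_mul, map_add, map_pow, map_ofNat]
    linear_combination -2 * phi * (th 1 2 0 * th (-1) 2 0 + S (th (-1) 2 0) ^ 2) * h3 +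
      2 * th 1 2 0 ^ 2 * th (-1) 2 0 * h4 + th 1 2 0 ^ 2 * h1 +
      (S (th 1 2 0) * S (lerchConv 0) + X * S (th 1 2 2) * S (lerchConv 1)) * h2
  have h6 := congrArg (sect 2 1) h5
  rw [map_add, map_add, sect_expand_mul two_ne_zero one_lt_two,
    sect_expand_mul_X_pow_self two_ne_zero one_lt_two,
    sect_expand_mul_X_pow_of_ne two_ne_zero one_lt_two (by norm_num),
    sect_expand_mul_X_pow_of_ne two_ne_zero one_lt_two (by norm_num)] at h6
  set A := sect 2 1 phi
  have h7 : 4 * (A * th (-1) 2 0 ^ 4) = th 1 1 1 ^ 2 * E 1 ^ 3 := by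
    linear_combination 2 * h6 - E 1 ^ 3 * th_one_one_one_sq
  have h8 : 4 * E 1 ^ 3 * (A * E 1 ^ 7) = 4 * E 1 ^ 3 * E 2 ^ 8 := by
    have e8 : (th (-1) 2 0 * E 2) ^ 4 = (E 1 ^ 2) ^ 4 := by rw [th_neg_one_two_zero]
    have e9 : (th 1 1 1 * E 1) ^ 2 = (2 * E 2 ^ 2) ^ 2 := by rw [th_one_one_one]
    linear_combination E 1 ^ 2 * E 2 ^ 4 * h7 - 4 * A * E 1 ^ 2 * e8 + E 1 ^ 3 * E 2 ^ 4 * e9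
  refine mul_left_cancel₀ (mul_ne_zero ?_ (pow_ne_zero 3 hE1)) h8
  rw [show (4 : ℤ⟦X⟧) = 2 * 2 by norm_num]
  exact mul_ne_zero powerSeries_two_ne_zero powerSeries_two_ne_zero

/-! ### Products modulo `5` and `10` -/

/-- The Rogers–Ramanujan continued fraction is q^(1/5) `gOne` / `gTwo`; `hOne` and `hTwo` are `gOne`
and `gTwo` at q². -/
noncomputable def gOne : ℤ⟦X⟧ := qPochInf (X ^ 1) (X ^ 5) * qPochInf (X ^ 4) (X ^ 5)

noncomputable def gTwo : ℤ⟦X⟧ := qPochInf (X ^ 2) (X ^ 5) * qPochInf (X ^ 3) (X ^ 5)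

noncomputable def hOne : ℤ⟦X⟧ := qPochInf (X ^ 2) (X ^ 10) * qPochInf (X ^ 8) (X ^ 10)

noncomputable def hTwo : ℤ⟦X⟧ := qPochInf (X ^ 4) (X ^ 10) * qPochInf (X ^ 6) (X ^ 10)

theorem E_five_mul : gOne * gTwo * E 5 = E 1 := by
  have h := qPochInf_eq_prod (X ^ 1) (q := X) (d := 5) dvd_rfl (by norm_num)
  simp only [Finset.prod_range_succ, Finset.prod_range_zero, one_mul, ← pow_add] at h
  norm_num at h
  rw [E, E, gOne, gTwo, pow_one, h]
  ring

theorem E_ten_mul : hOne * hTwo * E 10 = E 2 := by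
  have h := qPochInf_eq_prod (X ^ 2) (q := X ^ 2) (d := 5) (dvd_pow_self _ two_ne_zero)
    (by norm_num)
  simp only [Finset.prod_range_succ, Finset.prod_range_zero, one_mul, ← pow_mul, ← pow_add] at h
  norm_num at h
  rw [E, E, hOne, hTwo, h]
  ring

theorem th_neg_one_five_three : th (-1) 5 3 = E 5 * gOne := by
  have h := th_eq_qPochInf (s := -1) (by ring) (i := 4) (j := 1) (by norm_num)
  norm_num at h
  rw [h, gOne, pow_one]
  ring

theorem th_neg_one_five_one : th (-1) 5 1 = E 5 * gTwo := by
  have h := th_eq_qPochInf (s := -1) (by ring) (i := 3) (j := 2) (by norm_num)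
  norm_num at h
  rw [h, gTwo]
  ring

theorem th_neg_one_ten_six : th (-1) 10 6 = E 10 * hOne := by
  have h := th_eq_qPochInf (s := -1) (by ring) (i := 8) (j := 2) (by norm_num)
  norm_num at h
  rw [h, hOne]
  ring

theorem th_neg_one_ten_two : th (-1) 10 2 = E 10 * hTwo := by
  have h := th_eq_qPochInf (s := -1) (by ring) (i := 6) (j := 4) (by norm_num)
  norm_num at h
  rw [h, hTwo]
  ring

theorem th_one_five_three_mul : th 1 5 3 * gOne = E 5 * hOne := by
  have h := th_eq_qPochInf (s := 1) (by ring) (i := 4) (j := 1) (by norm_num)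
  have h1 := qPochInf_X_pow_mul_neg 1 5 (by norm_num)
  have h2 := qPochInf_X_pow_mul_neg 4 5 (by norm_num)
  norm_num at h h1 h2
  rw [h, gOne, hOne, ← h1, ← h2, pow_one]
  ring

theorem th_one_five_one_mul : th 1 5 1 * gTwo = E 5 * hTwo := by
  have h := th_eq_qPochInf (s := 1) (by ring) (i := 3) (j := 2) (by norm_num)
  have h1 := qPochInf_X_pow_mul_neg 2 5 (by norm_num)
  have h2 := qPochInf_X_pow_mul_neg 3 5 (by norm_num)
  norm_num at h h1 h2
  rw [h, gTwo, hTwo, ← h1, ← h2]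
  ring

theorem th_neg_one_ten_eight_mul : th (-1) 10 8 * hTwo = E 10 * gOne := by
  have h := th_eq_qPochInf (s := -1) (by ring) (i := 9) (j := 1) (by norm_num)
  have h1 := qPochInf_X_pow_split 1 5 (by norm_num)
  have h2 := qPochInf_X_pow_split 4 5 (by norm_num)
  norm_num at h h1 h2
  rw [h, gOne, hTwo, pow_one, h1, h2]
  ring

theorem th_neg_one_ten_four_mul : th (-1) 10 4 * hOne = E 10 * gTwo := by
  have h := th_eq_qPochInf (s := -1) (by ring) (i := 7) (j := 3) (by norm_num)
  have h1 := qPochInf_X_pow_split 2 5 (by norm_num)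
  have h2 := qPochInf_X_pow_split 3 5 (by norm_num)
  norm_num at h h1 h2
  rw [h, gTwo, hOne, h1, h2]
  ring

theorem th_neg_one_ten_zero_mul : th (-1) 10 0 * E 10 = E 5 ^ 2 := by
  have h := congrArg (expand 5 (by norm_num)) th_neg_one_two_zero
  rwa [map_mul, map_pow, expand_th (isThetaPair_of (by decide)) _ (by simp),
    expand_E two_ne_zero, expand_E one_ne_zero] at h

/-- Ramanujan's theta function `ψ(q) = ∑ q ^ (n (n + 1) / 2)`. -/
noncomputable def psi : ℤ⟦X⟧ := quot (E 2 ^ 2) (E 1)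

theorem psi_mul_E_one : psi * E 1 = E 2 ^ 2 := quot_mul_cancel _ (isUnit_E one_pos)

theorem two_mul_psi : 2 * psi = th 1 1 1 := by
  refine mul_right_cancel₀ (isUnit_E one_pos).ne_zero ?_
  rw [mul_assoc, psi_mul_E_one, th_one_one_one]

theorem expand_psi_mul : expand 5 (by norm_num) psi * E 5 = E 10 ^ 2 := by
  have h := congrArg (expand 5 (by norm_num)) psi_mul_E_one
  rwa [map_mul, map_pow, expand_E two_ne_zero, expand_E one_ne_zero] at h

theorem two_mul_expand_psi : 2 * expand 5 (by norm_num) psi = th 1 5 5 := by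
  have h := congrArg (expand 5 (by norm_num)) two_mul_psi
  rwa [map_mul, map_ofNat, expand_th (isThetaPair_of (by decide)) _ (by simp)] at h

theorem psi_sq : psi ^ 2 = X * expand 5 (by norm_num) psi ^ 2 + th 1 5 1 * th 1 5 3 := by
  have h := th_one_one_one_sq_eq_add
  rw [← two_mul_psi, ← two_mul_expand_psi] at h
  refine mul_left_cancel₀ (mul_ne_zero powerSeries_two_ne_zero powerSeries_two_ne_zero) ?_
  linear_combination h

/-! ### Dissections modulo `5` -/

/-- The power series whose components modulo `5` are the given ones. -/
noncomputable def assemble (a₀ a₁ a₂ a₃ a₄ : ℤ⟦X⟧) : ℤ⟦X⟧ :=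
  expand 5 (by norm_num) a₀ * X ^ 0 + expand 5 (by norm_num) a₁ * X ^ 1 +
    expand 5 (by norm_num) a₂ * X ^ 2 + expand 5 (by norm_num) a₃ * X ^ 3 +
    expand 5 (by norm_num) a₄ * X ^ 4

theorem assemble_mul (a₀ a₁ a₂ a₃ a₄ b₀ b₁ b₂ b₃ b₄ : ℤ⟦X⟧) :
    assemble a₀ a₁ a₂ a₃ a₄ * assemble b₀ b₁ b₂ b₃ b₄ = assemble
      (a₀ * b₀ + X * (a₁ * b₄ + a₂ * b₃ + a₃ * b₂ + a₄ * b₁))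
      (a₀ * b₁ + a₁ * b₀ + X * (a₂ * b₄ + a₃ * b₃ + a₄ * b₂))
      (a₀ * b₂ + a₁ * b₁ + a₂ * b₀ + X * (a₃ * b₄ + a₄ * b₃))
      (a₀ * b₃ + a₁ * b₂ + a₂ * b₁ + a₃ * b₀ + X * (a₄ * b₄))
      (a₀ * b₄ + a₁ * b₃ + a₂ * b₂ + a₃ * b₁ + a₄ * b₀) := by
  simp only [assemble, map_add, map_mul, expand_X]
  ring

theorem sect_assemble (a₀ a₁ a₂ a₃ a₄ : ℤ⟦X⟧) : sect 5 4 (assemble a₀ a₁ a₂ a₃ a₄) = a₄ := by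
  rw [assemble, map_add, map_add, map_add, map_add,
    sect_expand_mul_X_pow_self (by norm_num) (by norm_num),
    sect_expand_mul_X_pow_of_ne (by norm_num) (by norm_num) (by norm_num),
    sect_expand_mul_X_pow_of_ne (by norm_num) (by norm_num) (by norm_num),
    sect_expand_mul_X_pow_of_ne (by norm_num) (by norm_num) (by norm_num),
    sect_expand_mul_X_pow_of_ne (by norm_num) (by norm_num) (by norm_num)]
  ring

theorem psi_eq_assemble :
    psi = assemble (th 1 5 1) (th 1 5 3) 0 (expand 5 (by norm_num) psi) 0 := by
  refine mul_left_cancel₀ powerSeries_two_ne_zero ?_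
  have h : expand 5 (by norm_num) (2 * expand 5 (by norm_num) psi) = th 1 25 25 := by
    rw [two_mul_expand_psi, expand_th (isThetaPair_of (by decide)) _ (by simp)]
    norm_num
  have h1 : expand 5 (by norm_num) (th 1 5 1) = th 1 25 5 :=
    expand_th (isThetaPair_of (by decide)) _ (by simp)
  have h2 : expand 5 (by norm_num) (th 1 5 3) = th 1 25 15 :=
    expand_th (isThetaPair_of (by decide)) _ (by simp)
  rw [map_mul, map_ofNat] at h
  rw [two_mul_psi, th_one_one_one_dissection, assemble, h1, h2, ← h, map_zero]
  ring

theorem th_neg_one_two_zero_eq_assemble :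
    th (-1) 2 0 =
      assemble (th (-1) 10 0) (-2 * th (-1) 10 4) 0 0 (2 * th (-1) 10 8) := by
  have h0 : expand 5 (by norm_num) (th (-1) 10 0) = th (-1) 50 0 :=
    expand_th (isThetaPair_of (by decide)) _ (by simp)
  have h1 : expand 5 (by norm_num) (th (-1) 10 4) = th (-1) 50 20 :=
    expand_th (isThetaPair_of (by decide)) _ (by simp)
  have h2 : expand 5 (by norm_num) (th (-1) 10 8) = th (-1) 50 40 :=
    expand_th (isThetaPair_of (by decide)) _ (by simp)
  rw [th_neg_one_two_zero_dissection, assemble, map_mul, map_mul, map_neg, map_ofNat, h0, h1, h2,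
    map_zero]
  ring

/-- The second factor is the product of the four conjugates f - 2ζqa + 2ζ⁴q⁴b with ζ⁵ = 1, ζ ≠ 1, so
the product is the norm. -/
theorem assemble_mul_cofactor (f a b : ℤ⟦X⟧) :
    assemble f (-2 * a) 0 0 (2 * b) * assemble
        (f ^ 4 + 12 * X * f ^ 2 * a * b + 16 * X ^ 2 * a ^ 2 * b ^ 2)
        (2 * f ^ 3 * a + 16 * X * f * a ^ 2 * b + 16 * X ^ 3 * b ^ 4)
        (4 * f ^ 2 * a ^ 2 - 8 * X ^ 2 * f * b ^ 3 + 16 * X * a ^ 3 * b)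
        (4 * X * f ^ 2 * b ^ 2 + 8 * f * a ^ 3 + 16 * X ^ 2 * a * b ^ 3)
        (-2 * f ^ 3 * b - 16 * X * f * a * b ^ 2 + 16 * a ^ 4) =
      expand 5 (by norm_num) (f ^ 5 - 32 * X * a ^ 5 + 32 * X ^ 4 * b ^ 5 +
        20 * X * f ^ 3 * a * b + 80 * X ^ 2 * f * a ^ 2 * b ^ 2) := by
  rw [assemble_mul]
  have e : ∀ N : ℤ⟦X⟧, expand 5 (by norm_num) N = assemble N 0 0 0 0 := fun N => by
    rw [assemble, map_zero]
    ring
  rw [e]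
  congr 1 <;> ring

/-- This rewriting of E_2^8/E_1^7 uses only ψ and θ(-q), whose 5-dissections have three terms each.
-/
theorem sect_two_one_phi_mul_th_sq : sect 2 1 phi * th (-1) 2 0 ^ 2 = psi ^ 3 := by
  have hE1 : E 1 ≠ 0 := (isUnit_E one_pos).ne_zero
  have hE2 : E 2 ≠ 0 := (isUnit_E two_pos).ne_zero
  refine mul_right_cancel₀ (mul_ne_zero (pow_ne_zero 2 hE2) (pow_ne_zero 3 hE1)) ?_
  have h1 : (th (-1) 2 0 * E 2) ^ 2 = (E 1 ^ 2) ^ 2 := by rw [th_neg_one_two_zero]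
  have h2 : (psi * E 1) ^ 3 = (E 2 ^ 2) ^ 3 := by rw [psi_mul_E_one]
  linear_combination sect 2 1 phi * E 1 ^ 3 * h1 + sect_two_one_phi - E 2 ^ 2 * h2

/-- The norm of `f - 2 q a + 2 q ^ 4 b` from `ℤ⟦q⟧` to `ℤ⟦q ^ 5⟧`, where `f`, `a`, `b` are power
series in `x = q ^ 5`. -/
def quinticNorm {R : Type*} [CommRing R] (x f a b : R) : R :=
  f ^ 5 - 32 * x * a ^ 5 + 32 * x ^ 4 * b ^ 5 + 20 * x * f ^ 3 * a * b +
    80 * x ^ 2 * f * a ^ 2 * b ^ 2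

/-- The last component modulo `5` of the product of the cube of `A + q B + q ^ 3 P` and the square
of `κ₀ + q κ₁ + q ^ 2 κ₂ + q ^ 3 κ₃ + q ^ 4 κ₄`. -/
def lastComponent {R : Type*} [CommRing R] (x A B P κ₀ κ₁ κ₂ κ₃ κ₄ : R) : R :=
  (A ^ 3 + 3 * x * B ^ 2 * P) * (2 * κ₀ * κ₄ + 2 * κ₁ * κ₃ + κ₂ ^ 2) +
    (3 * A ^ 2 * B + 3 * x * A * P ^ 2) * (2 * κ₀ * κ₃ + 2 * κ₁ * κ₂ + x * κ₄ ^ 2) +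
    (3 * A * B ^ 2 + 3 * x * B * P ^ 2) * (2 * κ₀ * κ₂ + κ₁ ^ 2 + 2 * x * κ₃ * κ₄) +
    (3 * A ^ 2 * P + B ^ 3) * (2 * κ₀ * κ₁ + x * (2 * κ₂ * κ₄ + κ₃ ^ 2)) +
    (6 * A * B * P + x * P ^ 3) * (κ₀ ^ 2 + 2 * x * (κ₁ * κ₄ + κ₂ * κ₃))

/-- `lastComponent` for the cofactor of `f - 2 q a + 2 q ^ 4 b` in its norm. -/
def cofactorComponent {R : Type*} [CommRing R] (x f a b A B P : R) : R :=
  lastComponent x A B P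
    (f ^ 4 + 12 * x * f ^ 2 * a * b + 16 * x ^ 2 * a ^ 2 * b ^ 2)
    (2 * f ^ 3 * a + 16 * x * f * a ^ 2 * b + 16 * x ^ 3 * b ^ 4)
    (4 * f ^ 2 * a ^ 2 - 8 * x ^ 2 * f * b ^ 3 + 16 * x * a ^ 3 * b)
    (4 * x * f ^ 2 * b ^ 2 + 8 * f * a ^ 3 + 16 * x ^ 2 * a * b ^ 3)
    (-2 * f ^ 3 * b - 16 * x * f * a * b ^ 2 + 16 * a ^ 4)

theorem sect_assemble_pow (A B P κ₀ κ₁ κ₂ κ₃ κ₄ : ℤ⟦X⟧) :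
    sect 5 4 (assemble A B 0 P 0 ^ 3 * assemble κ₀ κ₁ κ₂ κ₃ κ₄ ^ 2) =
      lastComponent X A B P κ₀ κ₁ κ₂ κ₃ κ₄ := by
  rw [pow_three', sq, assemble_mul, assemble_mul, assemble_mul, assemble_mul, sect_assemble,
    lastComponent]
  ring

theorem quinticNorm_sq_mul_sect :
    quinticNorm X (th (-1) 10 0) (th (-1) 10 4) (th (-1) 10 8) ^ 2 * sect 5 4 (sect 2 1 phi) =
      cofactorComponent X (th (-1) 10 0) (th (-1) 10 4) (th (-1) 10 8) (th 1 5 1) (th 1 5 3)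
        (expand 5 (by norm_num) psi) := by
  have h := assemble_mul_cofactor (th (-1) 10 0) (th (-1) 10 4) (th (-1) 10 8)
  rw [← th_neg_one_two_zero_eq_assemble, ← quinticNorm] at h
  rw [cofactorComponent, ← sect_assemble_pow, ← psi_eq_assemble, ← sect_expand_mul (by norm_num)
    (by norm_num), map_pow, ← h, ← sect_two_one_phi_mul_th_sq]
  congr 1
  ring

/-! ### Parametrisation by k and translation into eta quotients -/

section Field

variable {K : Type*} [Field K]

theorem quinticNorm_eq {x f a k : K} (ha : a ≠ 0) (hu : 1 + k ≠ 0) (hv : 1 - k ≠ 0)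
    (hx : x = k / ((1 + k) ^ 2 * (1 - k) ^ 3 * a ^ 5)) :
    quinticNorm x f (f * a) (f * ((1 + k) * (1 - k) ^ 2 * a ^ 4)) =
      f ^ 5 * (((1 + k) * (1 - k) - 4 * k) / ((1 + k) * (1 - k))) ^ 3 := by
  rw [quinticNorm, hx]
  field_simp
  ring

/-- Homogeneity under q ↦ aq: the factors are P a⁻³ (A + (aq)B + (aq)³) and f ∑ (aq)^i κ_i, so the
q⁴ component carries a⁻⁹ a⁴ = a⁻⁵. -/
theorem lastComponent_scale (x A B P f a κ₀ κ₁ κ₂ κ₃ κ₄ : K) (ha : a ≠ 0) :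
    lastComponent x (P * (A / a ^ 3)) (P * (B / a ^ 2)) P (f * κ₀) (f * (a * κ₁))
        (f * (a ^ 2 * κ₂)) (f * (a ^ 3 * κ₃)) (f * (a ^ 4 * κ₄)) =
      f ^ 2 * P ^ 3 / a ^ 5 * lastComponent (x * a ^ 5) A B 1 κ₀ κ₁ κ₂ κ₃ κ₄ := by
  rw [lastComponent, lastComponent]
  field_simp

theorem cofactorComponent_eq {x f p a k : K} (ha : a ≠ 0) (hu : 1 + k ≠ 0) (hv : 1 - k ≠ 0)
    (hx : x = k / ((1 + k) ^ 2 * (1 - k) ^ 3 * a ^ 5)) :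
    cofactorComponent x f (f * a) (f * ((1 + k) * (1 - k) ^ 2 * a ^ 4))
        (p * (1 / ((1 + k) * (1 - k)) / a ^ 3)) (p * (1 / (1 - k) / a ^ 2)) p =
      f ^ 8 * p ^ 3 / a ^ 5 * lastComponent (k / ((1 + k) ^ 2 * (1 - k) ^ 3))
        (1 / ((1 + k) * (1 - k))) (1 / (1 - k)) 1
        (1 + 12 * k / ((1 + k) * (1 - k)) + 16 * k ^ 2 / ((1 + k) * (1 - k)) ^ 2)
        (2 + 16 * k / ((1 + k) * (1 - k)) + 16 * k ^ 3 / ((1 + k) ^ 2 * (1 - k)))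
        (4 - 8 * k ^ 2 / (1 + k) + 16 * k / ((1 + k) * (1 - k)))
        (4 * k * (1 - k) + 8 + 16 * k ^ 2 / (1 + k))
        (-2 * (1 + k) * (1 - k) ^ 2 - 16 * k * (1 - k) + 16) := by
  have e := lastComponent_scale x (1 / ((1 + k) * (1 - k))) (1 / (1 - k)) p (f ^ 4) a
    (1 + 12 * k / ((1 + k) * (1 - k)) + 16 * k ^ 2 / ((1 + k) * (1 - k)) ^ 2)
    (2 + 16 * k / ((1 + k) * (1 - k)) + 16 * k ^ 3 / ((1 + k) ^ 2 * (1 - k)))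
    (4 - 8 * k ^ 2 / (1 + k) + 16 * k / ((1 + k) * (1 - k)))
    (4 * k * (1 - k) + 8 + 16 * k ^ 2 / (1 + k))
    (-2 * (1 + k) * (1 - k) ^ 2 - 16 * k * (1 - k) + 16) ha
  have e1 : x * a ^ 5 = k / ((1 + k) ^ 2 * (1 - k) ^ 3) := by
    rw [hx]
    field_simp
  rw [e1, ← pow_mul] at e
  rw [← e, cofactorComponent]
  congr 1 <;> (rw [hx]; field_simp)

/-- The computational core: with the scale removed, the component is a rational function of k, and
it is rewritten in the three combinations that are eta quotients. The factor 5 and all coefficients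
of the theorem appear here. -/
theorem lastComponent_eq {k : K} (hk : k ≠ 0) (hu : 1 + k ≠ 0) (hv : 1 - k ≠ 0)
    (hw : (1 + k) * (1 - k) + k ≠ 0) :
    lastComponent (k / ((1 + k) ^ 2 * (1 - k) ^ 3))
        (1 / ((1 + k) * (1 - k))) (1 / (1 - k)) 1
        (1 + 12 * k / ((1 + k) * (1 - k)) + 16 * k ^ 2 / ((1 + k) * (1 - k)) ^ 2)
        (2 + 16 * k / ((1 + k) * (1 - k)) + 16 * k ^ 3 / ((1 + k) ^ 2 * (1 - k)))
        (4 - 8 * k ^ 2 / (1 + k) + 16 * k / ((1 + k) * (1 - k)))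
        (4 * k * (1 - k) + 8 + 16 * k ^ 2 / (1 + k))
        (-2 * (1 + k) * (1 - k) ^ 2 - 16 * k * (1 - k) + 16) =
      5 * (k / ((1 + k) ^ 2 * (1 - k) ^ 3)) *
        (46 * (((1 + k) * (1 - k) - 4 * k) / k) ^ 6 +
          460 * (((1 + k) * (1 - k) - 4 * k) / k) ^ 5 +
          1125 * (((1 + k) * (1 - k) - 4 * k) / k) ^ 4 +
          1875 * ((1 + k) * (1 - k) / k) ^ 2 * (((1 + k) * (1 - k) + k) / k) *
            (((1 + k) * (1 - k) - 4 * k) / k) ^ 2 +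
          15625 * ((1 + k) * (1 - k) / k) ^ 4) /
        ((((1 + k) * (1 - k) + k) / k) * ((1 + k) * (1 - k) / k) ^ 4) := by
  rw [lastComponent]
  field_simp
  ring

theorem eta_combination {x e₁ e₂ e₅ e₁₀ : K} (hx : x ≠ 0) (h₁ : e₁ ≠ 0) (h₂ : e₂ ≠ 0) (h₅ : e₅ ≠ 0)
    (h₁₀ : e₁₀ ≠ 0) {A B C f p : K} (hA : A = e₂ * e₅ ^ 5 / (x * e₁ * e₁₀ ^ 5))
    (hB : B = e₂ ^ 4 * e₅ ^ 2 / (x * e₁ ^ 2 * e₁₀ ^ 4))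
    (hC : C = e₁ ^ 3 * e₅ / (x * e₂ * e₁₀ ^ 3)) (hf : f = e₅ ^ 2 / e₁₀) (hp : p = e₁₀ ^ 2 / e₅) :
    f ^ 8 * p ^ 3 * (5 * x * (46 * C ^ 6 + 460 * C ^ 5 + 1125 * C ^ 4 + 1875 * A ^ 2 * B * C ^ 2 +
        15625 * A ^ 4) / (B * A ^ 4)) / (f ^ 5 * (C / A) ^ 3) ^ 2 =
      5 * (46 * (e₅ * e₁₀ ^ 2 / e₂ ^ 2) + 460 * x * (e₁₀ ^ 5 / (e₁ ^ 3 * e₂)) +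
        1125 * x ^ 2 * (e₁₀ ^ 8 / (e₁ ^ 6 * e₅)) + 1875 * x * (e₂ ^ 8 * e₅ ^ 9 / e₁ ^ 16) +
        15625 * x ^ 2 * (e₂ ^ 8 * e₅ ^ 15 / e₁ ^ 22)) := by
  rw [hA, hB, hC, hf, hp]
  field_simp

theorem eq_eta_combination_of_quinticNorm {x g₁ g₂ h₁ h₂ e₁ e₂ e₅ e₁₀ f p r A₁ B₁ a b θ s : K}
    (hx : x ≠ 0) (hg₁ : g₁ ≠ 0) (hg₂ : g₂ ≠ 0) (hh₁ : h₁ ≠ 0) (hh₂ : h₂ ≠ 0) (he₁ : e₁ ≠ 0)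
    (he₂ : e₂ ≠ 0) (he₅ : e₅ ≠ 0) (he₁₀ : e₁₀ ≠ 0)
    (hge : g₁ * g₂ * e₅ = e₁) (hhe : h₁ * h₂ * e₁₀ = e₂) (hf : f * e₁₀ = e₅ ^ 2)
    (hp : p * e₅ = e₁₀ ^ 2) (ha : a * h₁ = e₁₀ * g₂) (hb : b * h₂ = e₁₀ * g₁)
    (hA : A₁ * g₂ = e₅ * h₂) (hB : B₁ * g₁ = e₅ * h₁)
    (hadd : B₁ * (e₅ * g₂) = a * (e₁₀ * h₂) + x * (b * (e₁₀ * h₁)))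
    (hsub : e₅ * g₁ * A₁ = a * (e₁₀ * h₂) - x * (b * (e₁₀ * h₁)))
    (hr : r * e₁ = e₂ ^ 2) (hr' : r ^ 2 = x * p ^ 2 + A₁ * B₁)
    (hθ : θ * e₂ = e₁ ^ 2) (hθ' : θ ^ 2 = f ^ 2 - 4 * x * (a * b))
    (hs : quinticNorm x f a b ^ 2 * s = cofactorComponent x f a b A₁ B₁ p) :
    s = 5 * (46 * (e₅ * e₁₀ ^ 2 / e₂ ^ 2) + 460 * x * (e₁₀ ^ 5 / (e₁ ^ 3 * e₂)) +
        1125 * x ^ 2 * (e₁₀ ^ 8 / (e₁ ^ 6 * e₅)) + 1875 * x * (e₂ ^ 8 * e₅ ^ 9 / e₁ ^ 16) +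
        15625 * x ^ 2 * (e₂ ^ 8 * e₅ ^ 15 / e₁ ^ 22)) := by
  rw [← eq_div_iff ‹_›] at hf hp ha hb hA hB hr hθ
  -- With g₁/g₂ and h₁/h₂ the continued fractions at q and q² without their fractional powers, this
  -- is R(q)R(q²)²; those powers multiply to x.
  obtain ⟨k, hk⟩ : ∃ k, k = x * g₁ * h₁ ^ 2 / (g₂ * h₂ ^ 2) := ⟨_, rfl⟩
  obtain ⟨α, hα⟩ : ∃ α, α = e₁₀ ^ 2 * g₂ / (e₅ ^ 2 * h₁) := ⟨_, rfl⟩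
  have hk0 : k ≠ 0 := by rw [hk]; positivity
  have hα0 : α ≠ 0 := by rw [hα]; positivity
  -- The sum and difference forms of the level-10 theta product identities, divided by their leading
  -- term, evaluate 1 + k and 1 - k as products.
  have hu : 1 + k = e₅ ^ 2 * h₁ ^ 2 / (e₁₀ ^ 2 * g₁ * h₂) := by
    rw [hk]
    rw [hB, ha, hb] at hadd
    field_simp at hadd ⊢
    linear_combination -hadd
  have hv : 1 - k = e₅ ^ 2 * g₁ * h₁ / (e₁₀ ^ 2 * g₂ ^ 2) := by
    rw [hk]
    rw [hA, ha, hb] at hsub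
    field_simp at hsub ⊢
    linear_combination -hsub
  have hu0 : 1 + k ≠ 0 := by rw [hu]; positivity
  have hv0 : 1 - k ≠ 0 := by rw [hv]; positivity
  have hxk : x = k / ((1 + k) ^ 2 * (1 - k) ^ 3 * α ^ 5) := by
    rw [hu, hv, hα, hk]
    field_simp
  have ha' : a = f * α := by
    rw [ha, hf, hα]
    field_simp
  have hb' : b = f * ((1 + k) * (1 - k) ^ 2 * α ^ 4) := by
    rw [hb, hf, hα, hu, hv]
    field_simp
  have hA' : A₁ = p * (1 / ((1 + k) * (1 - k)) / α ^ 3) := by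
    rw [hA, hp, hα, hu, hv]
    field_simp
  have hB' : B₁ = p * (1 / (1 - k) / α ^ 2) := by
    rw [hB, hp, hα, hv]
    field_simp
  have ht : (1 + k) * (1 - k) / k = e₂ * e₅ ^ 5 / (x * e₁ * e₁₀ ^ 5) := by
    rw [hu, hv, hk, ← hge, ← hhe]
    field_simp
  -- This is (1-k²)/k + 1, obtained by dividing the identity for ψ² by xp².
  have ht₁ : ((1 + k) * (1 - k) + k) / k = e₂ ^ 4 * e₅ ^ 2 / (x * e₁ ^ 2 * e₁₀ ^ 4) := by
    rw [add_div, ht, div_self hk0]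
    rw [hr, hp, hA, hB] at hr'
    rw [← hge, ← hhe] at hr' ⊢
    field_simp at hr' ⊢
    linear_combination -hr'
  -- This is (1-k²)/k - 4, obtained by dividing the identity for θ(-q)² by xab.
  have ht₄ : ((1 + k) * (1 - k) - 4 * k) / k = e₁ ^ 3 * e₅ / (x * e₂ * e₁₀ ^ 3) := by
    rw [sub_div, ht, mul_div_cancel_right₀ _ hk0]
    rw [hθ, hf, ha, hb] at hθ'
    rw [← hge, ← hhe] at hθ' ⊢
    field_simp at hθ' ⊢
    linear_combination -hθ'
  obtain ⟨t₀, ht₀⟩ : ∃ t₀, t₀ = (1 + k) * (1 - k) / k := ⟨_, rfl⟩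
  obtain ⟨t₁, ht₁'⟩ : ∃ t₁, t₁ = ((1 + k) * (1 - k) + k) / k := ⟨_, rfl⟩
  obtain ⟨t₄, ht₄'⟩ : ∃ t₄, t₄ = ((1 + k) * (1 - k) - 4 * k) / k := ⟨_, rfl⟩
  have hw : (1 + k) * (1 - k) + k ≠ 0 := fun h => by
    rw [h, zero_div] at ht₁
    refine (?_ : e₂ ^ 4 * e₅ ^ 2 / (x * e₁ ^ 2 * e₁₀ ^ 4) ≠ 0) ht₁.symm
    positivity
  have hN : quinticNorm x f a b = f ^ 5 * (t₄ / t₀) ^ 3 := by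
    rw [ha', hb', quinticNorm_eq hα0 hu0 hv0 hxk, ht₀, ht₄', div_div_div_cancel_right₀ hk0]
  have hM : cofactorComponent x f a b A₁ B₁ p = f ^ 8 * p ^ 3 *
      (5 * x * (46 * t₄ ^ 6 + 460 * t₄ ^ 5 + 1125 * t₄ ^ 4 + 1875 * t₀ ^ 2 * t₁ * t₄ ^ 2 +
        15625 * t₀ ^ 4) / (t₁ * t₀ ^ 4)) := by
    rw [ha', hb', hA', hB', cofactorComponent_eq hα0 hu0 hv0 hxk, lastComponent_eq hk0 hu0 hv0 hw,
      ← ht₀, ← ht₁', ← ht₄',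
      show k / ((1 + k) ^ 2 * (1 - k) ^ 3) = x * α ^ 5 by rw [hxk]; field_simp]
    field_simp
  rw [ht] at ht₀
  rw [ht₁] at ht₁'
  rw [ht₄] at ht₄'
  have hN0 : f ^ 5 * (t₄ / t₀) ^ 3 ≠ 0 := by
    rw [hf, ht₀, ht₄']
    positivity
  rw [← eta_combination hx he₁ he₂ he₅ he₁₀ ht₀ ht₁' ht₄' hf hp, ← hM, ← hs, hN,
    mul_div_cancel_left₀ _ (pow_ne_zero 2 hN0)]

end Field

/-! ### Return from the field of fractions to power series -/

theorem isUnit_gOne : IsUnit gOne :=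
  (isUnit_qPochInf (dvd_pow_self X one_ne_zero) (dvd_pow_self X (by norm_num))).mul
    (isUnit_qPochInf (dvd_pow_self X (by norm_num)) (dvd_pow_self X (by norm_num)))

theorem isUnit_gTwo : IsUnit gTwo :=
  (isUnit_qPochInf (dvd_pow_self X (by norm_num)) (dvd_pow_self X (by norm_num))).mul
    (isUnit_qPochInf (dvd_pow_self X (by norm_num)) (dvd_pow_self X (by norm_num)))

theorem isUnit_hOne : IsUnit hOne :=
  (isUnit_qPochInf (dvd_pow_self X (by norm_num)) (dvd_pow_self X (by norm_num))).mul
    (isUnit_qPochInf (dvd_pow_self X (by norm_num)) (dvd_pow_self X (by norm_num)))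

theorem isUnit_hTwo : IsUnit hTwo :=
  (isUnit_qPochInf (dvd_pow_self X (by norm_num)) (dvd_pow_self X (by norm_num))).mul
    (isUnit_qPochInf (dvd_pow_self X (by norm_num)) (dvd_pow_self X (by norm_num)))

theorem map_quinticNorm {R S : Type*} [CommRing R] [CommRing S] (φ : R →+* S) (x f a b : R) :
    φ (quinticNorm x f a b) = quinticNorm (φ x) (φ f) (φ a) (φ b) := by
  simp only [quinticNorm, map_add, map_sub, map_mul, map_pow, map_ofNat]

theorem map_cofactorComponent {R S : Type*} [CommRing R] [CommRing S] (φ : R →+* S)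
    (x f a b A B P : R) : φ (cofactorComponent x f a b A B P) =
      cofactorComponent (φ x) (φ f) (φ a) (φ b) (φ A) (φ B) (φ P) := by
  simp only [cofactorComponent, lastComponent, map_add, map_sub, map_neg, map_mul, map_pow,
    map_ofNat]

/-- The generating function of `a (10 n + 9)`, as a sum of quotients of the `E_j`. -/
theorem sect_five_four_sect_two_one_phi :
    sect 5 4 (sect 2 1 phi) =
        5 * (46 * quot (E 5 * E 10 ^ 2) (E 2 ^ 2)
          + 460 * X * quot (E 10 ^ 5) (E 1 ^ 3 * E 2)
          + 1125 * X ^ 2 * quot (E 10 ^ 8) (E 1 ^ 6 * E 5)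
          + 1875 * X * quot (E 2 ^ 8 * E 5 ^ 9) (E 1 ^ 16)
          + 15625 * X ^ 2 * quot (E 2 ^ 8 * E 5 ^ 15) (E 1 ^ 22)) := by
  have u₁ := isUnit_E one_pos
  have u₂ := isUnit_E two_pos
  have u₅ := isUnit_E (j := 5) (by norm_num)
  have u₁₀ := isUnit_E (j := 10) (by norm_num)
  have lift {u v : ℤ⟦X⟧} (h : u = v) := congrArg (algebraMap ℤ⟦X⟧ (FractionRing ℤ⟦X⟧)) h
  have hJ := lift th_five_three_mul_th_neg_five_one
  have hJ' := lift th_neg_five_three_mul_th_five_one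
  rw [th_neg_one_five_one, th_neg_one_ten_two, th_neg_one_ten_six] at hJ
  rw [th_neg_one_five_three, th_neg_one_ten_two, th_neg_one_ten_six] at hJ'
  have hθ' := lift th_neg_one_two_zero_sq
  have hr' := lift psi_sq
  have hge := lift E_five_mul
  have hhe := lift E_ten_mul
  have hf := lift th_neg_one_ten_zero_mul
  have hp := lift expand_psi_mul
  have ha := lift th_neg_one_ten_four_mul
  have hb := lift th_neg_one_ten_eight_mul
  have hA := lift th_one_five_one_mul
  have hB := lift th_one_five_three_mul
  have hr := lift psi_mul_E_one
  have hθ := lift th_neg_one_two_zero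
  have hs := lift quinticNorm_sq_mul_sect
  rw [map_mul, map_pow, map_quinticNorm, map_cofactorComponent] at hs
  simp only [map_mul, map_add, map_sub, map_pow, map_ofNat] at hJ hJ' hθ' hr' hge hhe hf hp
  simp only [map_mul, map_pow] at ha hb hA hB hr hθ
  apply IsFractionRing.injective ℤ⟦X⟧ (FractionRing ℤ⟦X⟧)
  rw [eq_eta_combination_of_quinticNorm
    ((map_ne_zero_iff _ (IsFractionRing.injective ℤ⟦X⟧ (FractionRing ℤ⟦X⟧))).mpr X_ne_zero)
    (algebraMap_ne_zero_of_isUnit isUnit_gOne) (algebraMap_ne_zero_of_isUnit isUnit_gTwo)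
    (algebraMap_ne_zero_of_isUnit isUnit_hOne) (algebraMap_ne_zero_of_isUnit isUnit_hTwo)
    (algebraMap_ne_zero_of_isUnit u₁) (algebraMap_ne_zero_of_isUnit u₂)
    (algebraMap_ne_zero_of_isUnit u₅) (algebraMap_ne_zero_of_isUnit u₁₀)
    hge hhe hf hp ha hb hA hB hJ hJ' hr hr' hθ hθ' hs]
  simp only [map_mul, map_add, map_pow, map_ofNat, algebraMap_quot _ (u₂.pow 2),
    algebraMap_quot _ ((u₁.pow 3).mul u₂), algebraMap_quot _ ((u₁.pow 6).mul u₅),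
    algebraMap_quot _ (u₁.pow 16), algebraMap_quot _ (u₁.pow 22)]

end AppellLerch

theorem theorem3p1 :
    PowerSeries.mk (fun n : ℕ => AppellLerch.a (10 * n + 9)) =
        5 * (46 * AppellLerch.quot (AppellLerch.E 5 * AppellLerch.E 10 ^ 2) (AppellLerch.E 2 ^ 2)
          + 460 * X * AppellLerch.quot (AppellLerch.E 10 ^ 5)
              (AppellLerch.E 1 ^ 3 * AppellLerch.E 2)
          + 1125 * X ^ 2 * AppellLerch.quot (AppellLerch.E 10 ^ 8)
              (AppellLerch.E 1 ^ 6 * AppellLerch.E 5)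
          + 1875 * X * AppellLerch.quot (AppellLerch.E 2 ^ 8 * AppellLerch.E 5 ^ 9)
              (AppellLerch.E 1 ^ 16)
          + 15625 * X ^ 2 * AppellLerch.quot (AppellLerch.E 2 ^ 8 * AppellLerch.E 5 ^ 15)
              (AppellLerch.E 1 ^ 22))
      ∧ ∀ n : ℕ, AppellLerch.a (10 * n + 9) ≡ 0 [ZMOD 5] := by
  have ha (n : ℕ) : coeff n (AppellLerch.sect 5 4 (AppellLerch.sect 2 1 AppellLerch.phi)) =
      AppellLerch.a (10 * n + 9) := by
    rw [AppellLerch.coeff_sect, AppellLerch.coeff_sect, AppellLerch.a]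
    -- The composed sections read off index 2(5n+4)+1 = 10n+9.
    congr 2
    ring
  rw [AppellLerch.sect_five_four_sect_two_one_phi] at ha
  refine ⟨PowerSeries.ext fun n => by rw [coeff_mk, ha], fun n => ?_⟩
  rw [← ha, Int.modEq_zero_iff_dvd, ← map_ofNat (C (R := ℤ)) 5, coeff_C_mul]
  exact dvd_mul_right _ _
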